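/- Let $n\ge 4$ and let $\pi/(n-1)<y<\pi/(n-2)$. Let $\mathcal A=\{\xi\in\mathbb R^n \mid \xi_1+\cdots+\xi_n=\pi,\ \xi_i\ge 0\ \forall i\}$, and for $\xi\in\mathcal A$ put $\delta(\xi)=\mathrm{diag}(\delta_1,\dots,\delta_n)$ with $\delta_1=\exp\bigl(\tfrac{2\mathrm i}{n}\sum_{j=1}^n j\xi_j\bigr)$ and $\delta_{k+1}=e^{2\mathrm i\xi_k}\delta_k$ for $1\le k\le n-1$; every $g\in \mathrm{SU}(n)$ is similar to $\delta(\xi)$ for a unique $\xi=:\Xi(g)\in\mathcal A$. Let $\mu_0(y)=\mathrm{diag}(e^{2\mathrm iy},\dots,e^{2\mathrm iy},e^{-2(n-1)\mathrm iy})$ and let $$\mathcal A_y=\{\Xi(B)\mid A,B\in \mathrm{SU}(n),\ ABA^{-1}B^{-1}=\mu_0(y)\}.$$ All indices of components of $\xi$ are understood modulo $n$. Then $\mathcal A_y$ is the $(n-1)$-dimensional polytope in the hyperplane $\xi_1+\cdots+\xi_n=\pi$ defined by the $2n$ inequalities $$\xi_\ell\le y,\qquad \xi_\ell+\xi_{\ell+1}\ge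 y,\qquad \ell=1,\dots,n,$$ and the following hold. 1. $\mathcal A_y$ has exactly $n(n-2)$ vertices and exactly $2n$ facets. 2. The vertices are exactly the cyclic permutations of the points $R$ and $I_s$ $(s=1,\dots,n-3)$ given by $$R:\ \xi_1=(n-1)y-\pi,\quad \xi_2=\xi_n=\pi-(n-2)y,\quad \xi_j=y\ \text{for all other } j,$$ $$I_s:\ \xi_1=0,\quad \xi_{2+s}=\pi-(n-2)y,\quad \xi_j=y\ \text{for all other } j.$$ The regular vertices, i.e. those with all components positive, are the $n$ cyclic permutations of $R$. The singular vertices, i.e. those lying on the boundary of $\mathcal A$, are the cyclic permutations of the $I_s$; there are $n(n-3)$ of them, and each has exactly one zero component. 3. For each $\ell$, the sets $\{\xi\in\mathcal A_y\mid \xi_\ell=y\}$ and $\{\xi\in\mathcal A_y\mid\xi_\ell+\xi_{\ell+1}=y\}$ are facets of $\mathcal A_y$, and these are all its facets. 4. Every regular vertex lies on exactly $n-1$ facets and every singular vertex on exactly $n$ facets. -/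

import Mathlib

open Real

/-- The simplex `𝒜 = {ξ ∈ ℝⁿ | ξ₁ + ⋯ + ξₙ = π, ξᵢ ≥ 0}` (a Weyl alcove of `SU(n)`).
Components are indexed by `Fin n`, so the component `ξⱼ` is `ξ (j - 1)` here. -/
def alcove (n : ℕ) : Set (Fin n → ℝ) :=
  {ξ | ∑ i, ξ i = π ∧ ∀ i, 0 ≤ ξ i}

/-- The relative interior `𝒜ʳᵉᵍ` of the simplex `𝒜`. -/
def alcoveReg (n : ℕ) : Set (Fin n → ℝ) :=
  {ξ ∈ alcove n | ∀ i, 0 < ξ i}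

/-- The boundary `∂𝒜` of the simplex `𝒜`. -/
def alcoveBoundary (n : ℕ) : Set (Fin n → ℝ) :=
  {ξ ∈ alcove n | ∃ i, ξ i = 0}

/-- The diagonal matrix `δ(ξ) = diag(δ₁(ξ), …, δₙ(ξ))`, where
`δ₁(ξ) = exp((2i/n) ∑ⱼ j ξⱼ)` and `δₖ₊₁(ξ) = exp(2i ξₖ) δₖ(ξ)`. -/
noncomputable def deltaMatrix {n : ℕ} (ξ : Fin n → ℝ) : Matrix (Fin n) (Fin n) ℂ :=
  Matrix.diagonal fun k : Fin n =>
    Complex.exp (2 * Complex.I *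
      (((∑ j : Fin n, (((j : ℕ) : ℝ) + 1) * ξ j) / (n : ℝ) + ∑ j with j < k, ξ j : ℝ) : ℂ))

/-- The diagonal matrix `μ₀(y) = diag(exp(2iy), …, exp(2iy), exp(-2(n-1)iy))`. -/
noncomputable def mu0 (n : ℕ) (y : ℝ) : Matrix (Fin n) (Fin n) ℂ :=
  Matrix.diagonal fun k : Fin n =>
    if (k : ℕ) + 1 = n then Complex.exp (-2 * ((n : ℂ) - 1) * Complex.I * (y : ℂ))
    else Complex.exp (2 * Complex.I * (y : ℂ))

/-- `HasAlcoveCoord g ξ` says `Ξ(g) = ξ`, where `Ξ : SU(n) → 𝒜` sends `g` to the unique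
`ξ ∈ 𝒜` such that `g` is similar to `δ(ξ)`. -/
def HasAlcoveCoord {n : ℕ} (g : Matrix.specialUnitaryGroup (Fin n) ℂ) (ξ : Fin n → ℝ) : Prop :=
  ξ ∈ alcove n ∧ IsConj (g : Matrix (Fin n) (Fin n) ℂ) (deltaMatrix ξ)

/-- The level set `μ⁻¹(μ₀(y)) ⊆ SU(n) × SU(n)` of the group commutator
`μ(A, B) = A B A⁻¹ B⁻¹`. -/
def commutatorLevel (n : ℕ) (y : ℝ) :
    Set (Matrix.specialUnitaryGroup (Fin n) ℂ × Matrix.specialUnitaryGroup (Fin n) ℂ) :=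
  {p | ((p.1 * p.2 * p.1⁻¹ * p.2⁻¹ : Matrix.specialUnitaryGroup (Fin n) ℂ) :
    Matrix (Fin n) (Fin n) ℂ) = mu0 n y}

/-- The momentum polytope `𝒜_y`: the image of the reduced phase space
`μ⁻¹(μ₀(y)) / SU(n)_{μ₀(y)}` under the map induced by `(A, B) ↦ Ξ(B)`. As this map is constant on
the orbits, its image on the quotient is its image on the level set. -/
def momentumPolytope (n : ℕ) (y : ℝ) : Set (Fin n → ℝ) :=
  {ξ | ∃ p ∈ commutatorLevel n y, HasAlcoveCoord p.2 ξ}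

/-- The vertices of a convex polytope `P`: the points `v` such that `{v}` is the intersection of
`P` with a hyperplane bounding a half-space that contains `P`. -/
def polytopeVertices {n : ℕ} (P : Set (Fin n → ℝ)) : Set (Fin n → ℝ) :=
  P.exposedPoints ℝ

/-- The dimension of a set: the dimension of its affine span. -/
noncomputable def affineDim {n : ℕ} (P : Set (Fin n → ℝ)) : ℕ :=
  Module.finrank ℝ (vectorSpan ℝ P)

/-- The facets of a convex polytope `P`: the non-empty faces (intersections of `P` with a
supporting hyperplane) whose dimension is one less than that of `P`. -/
def polytopeFacets {n : ℕ} (P : Set (Fin n → ℝ)) : Set (Set (Fin n → ℝ)) :=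
  {F | F.Nonempty ∧ IsExposed ℝ P F ∧ affineDim F + 1 = affineDim P}

/-- The cyclic permutation `σ(ξ)ⱼ = ξⱼ₊₁` of the components (indices modulo `n`). -/
def cyclicShift {n : ℕ} (ξ : Fin n → ℝ) : Fin n → ℝ :=
  fun j => ξ (finRotate n j)

/-- The set of all cyclic permutations of `ξ`. -/
def cyclicOrbit {n : ℕ} (ξ : Fin n → ℝ) : Set (Fin n → ℝ) :=
  {η | ∃ k : ℕ, η = cyclicShift^[k] ξ}

/-- The point `R`: `ξ₁ = (n-1)y - π`, `ξ₂ = ξₙ = π - (n-2)y`, all other components equal `y`. -/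
noncomputable def vertexR (n : ℕ) (y : ℝ) : Fin n → ℝ := fun i =>
  if (i : ℕ) = 0 then ((n : ℝ) - 1) * y - π
  else if (i : ℕ) = 1 ∨ (i : ℕ) + 1 = n then π - ((n : ℝ) - 2) * y
  else y

/-- The point `I_s`: `ξ₁ = 0`, `ξ₂₊ₛ = π - (n-2)y`, all other components equal `y`. -/
noncomputable def vertexI (n : ℕ) (y : ℝ) (s : ℕ) : Fin n → ℝ := fun i =>
  if (i : ℕ) = 0 then 0
  else if (i : ℕ) = 1 + s then π - ((n : ℝ) - 2) * y
  else y

open Polynomial in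
/-- The characteristic polynomial of a multiplicative rank one perturbation
`(1 + (t - 1) u vᵀ) diag(d)`, in terms of the weights `w k = u k * v k`. -/
noncomputable def secularPoly {ι : Type*} [Fintype ι] [DecidableEq ι] (d w : ι → ℂ) (t : ℂ) :
    ℂ[X] :=
  ∏ k, (X - C (d k)) - C (t - 1) * ∑ k, C (w k * d k) * ∏ j ∈ Finset.univ.erase k, (X - C (d j))

section RankOne

open Polynomial Matrix

theorem exists_perm_of_prod_X_sub_C_eq {ι : Type*} [Fintype ι] {e d : ι → ℂ}
    (h : ∏ k, (X - C (e k)) = ∏ k, (X - C (d k))) : ∃ σ : Equiv.Perm ι, ∀ i, d (σ i) = e i := by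
  have hroots : ∀ f : ι → ℂ, (∏ k, (X - C (f k))).roots = Multiset.map f Finset.univ.val := by
    intro f
    have := roots_multiset_prod_X_sub_C (Multiset.map f Finset.univ.val)
    rwa [Multiset.map_map] at this
  have hm := congrArg roots h
  rw [hroots, hroots] at hm
  have hcard : ∀ c, Nonempty ({a // e a = c} ≃ {b // d b = c}) := by
    intro c
    have hc := congrArg (Multiset.count c) hm
    rw [Multiset.count_map, Multiset.count_map] at hc
    refine Fintype.card_eq.1 ?_
    rw [Fintype.card_subtype, Fintype.card_subtype]
    simpa only [Finset.card, Finset.filter_val, eq_comm] using hc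
  exact ⟨Equiv.ofFiberEquiv fun c => (hcard c).some, fun i => Equiv.ofFiberEquiv_map _ i⟩

variable {ι : Type*} [Fintype ι] [DecidableEq ι]

theorem eval_secularPoly (d w : ι → ℂ) (t z : ℂ) :
    (secularPoly d w t).eval z =
      ∏ k, (z - d k) - (t - 1) * ∑ k, w k * d k * ∏ j ∈ Finset.univ.erase k, (z - d j) := by
  simp [secularPoly, eval_prod, eval_finsetSum]

theorem eq_of_eval_eq_off_finset {p q : ℂ[X]} (s : Finset ℂ)
    (h : ∀ z ∉ s, p.eval z = q.eval z) : p = q := by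
  apply eq_of_infinite_eval_eq
  refine (s.finite_toSet.infinite_compl).mono fun z hz => ?_
  exact h z (by simpa using hz)

theorem charpoly_rankOne_mul_diagonal (u v d : ι → ℂ) (t : ℂ) :
    ((1 + (t - 1) • vecMulVec u v) * diagonal d).charpoly =
      secularPoly d (fun k => u k * v k) t := by
  apply eq_of_eval_eq_off_finset (Finset.univ.image d)
  intro z hz
  have hz' : ∀ k, z - d k ≠ 0 := by
    intro k hk
    exact hz (Finset.mem_image.2 ⟨k, Finset.mem_univ k, (sub_eq_zero.1 hk).symm⟩)
  rw [eval_charpoly, eval_secularPoly]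
  have hM : scalar ι z - (1 + (t - 1) • vecMulVec u v) * diagonal d
      = diagonal (fun k => z - d k) + replicateCol Unit (fun k => -(t - 1) * u k)
        * replicateRow Unit (fun k => v k * d k) := by
    ext i j
    simp [Matrix.add_mul, Matrix.mul_apply, vecMulVec_apply, diagonal_apply]
    by_cases h : i = j
    · subst h; simp; ring
    · simp [h]; ring
  have hdet : (diagonal fun k => z - d k).det = ∏ k, (z - d k) := det_diagonal
  rw [hM, det_add_replicateCol_mul_replicateRow, hdet]
  · have hinv : (diagonal fun k => z - d k)⁻¹ = diagonal fun k => (z - d k)⁻¹ := by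
      apply inv_eq_right_inv
      rw [diagonal_mul_diagonal]
      simp [hz']
    rw [hinv, det_unique]
    have h1 : ((1 : Matrix Unit Unit ℂ) + replicateRow Unit (fun k => v k * d k) * (diagonal fun k => (z - d k)⁻¹)
        * replicateCol Unit (fun k => -(t - 1) * u k)) default default
        = 1 + ∑ k, v k * d k * (z - d k)⁻¹ * (-(t - 1) * u k) := by
      simp [Matrix.mul_apply, diagonal_apply]
    rw [h1, mul_add, mul_one, sub_eq_add_neg (∏ k, (z - d k)), Finset.mul_sum, Finset.mul_sum,
      ← Finset.sum_neg_distrib]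
    congr 1
    refine Finset.sum_congr rfl fun k _ => ?_
    rw [← Finset.mul_prod_erase _ _ (Finset.mem_univ k)]
    have := hz' k
    field_simp
  · rw [hdet]
    exact (Finset.prod_ne_zero_iff.2 fun k _ => hz' k).isUnit

theorem exists_unitary_diagonalization {U : Matrix ι ι ℂ} (hU : U ∈ unitaryGroup ι ℂ) :
    ∃ V ∈ unitaryGroup ι ℂ, ∃ d : ι → ℂ, U = V * diagonal d * star V := by
  obtain ⟨z, hz1, hz⟩ : ∃ z : ℂ, z * star z = 1 ∧ U.charpoly.eval z ≠ 0 := by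
    have hfin := (U.charpoly.roots.toFinset).finite_toSet
    have hinf : (Metric.sphere (0 : ℂ) 1).Infinite := by
      refine (isPreconnected_sphere (by simp [Complex.rank_real_complex]) 0 1).infinite_of_nontrivial
        ⟨1, by simp, -1, by simp, fun h => ?_⟩
      have := congrArg Complex.re h
      norm_num at this
    obtain ⟨z, hz, hz'⟩ := (hinf.sdiff hfin).nonempty
    refine ⟨z, ?_, ?_⟩
    · simp only [mem_sphere_iff_norm, sub_zero] at hz
      simp [Complex.mul_conj, Complex.normSq_eq_norm_sq, hz]
    · intro h
      apply hz'
      simp [h, (charpoly_monic U).ne_zero]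
  have hsc : scalar ι z = z • (1 : Matrix ι ι ℂ) := by
    rw [scalar_apply, smul_one_eq_diagonal]
  rw [eval_charpoly, hsc] at hz
  set N := z • (1 : Matrix ι ι ℂ) - U with hN
  set S := z • (1 : Matrix ι ι ℂ) + U with hS
  have hUs : U * star U = 1 := mem_unitaryGroup_iff.1 hU
  have hsU : star U * U = 1 := mem_unitaryGroup_iff'.1 hU
  have hNW : N * N⁻¹ = 1 := mul_nonsing_inv _ hz.isUnit
  have hWN : N⁻¹ * N = 1 := nonsing_inv_mul _ hz.isUnit
  set W := N⁻¹ with hW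
  have hWN' : star W * star N = 1 := by rw [← star_mul, hNW, star_one]
  have hskew : star N * S = -(star S * N) := by
    simp only [hN, hS, star_sub, star_add, star_smul, star_one, sub_mul, mul_add, add_mul, mul_sub,
      one_mul, mul_one, smul_mul_assoc, mul_smul_comm, hsU, smul_smul, hz1,
      one_smul, smul_add, smul_sub]
    abel
  set H := Complex.I • (S * W) with hH
  have hHerm : H.IsHermitian := by
    change star H = H
    have h1 : S * W = star W * (star N * S) * W := by
      rw [← mul_assoc, hWN', one_mul]
    have h2 : star W * star S = star W * (star S * N) * W := by
      rw [mul_assoc, mul_assoc, hNW, mul_one]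
    rw [hH, star_smul, star_mul, h2, h1, hskew]
    simp
  have hHN : (H + Complex.I • 1) * U = z • (H - Complex.I • 1) := by
    have h3 : H * N = Complex.I • S := by
      rw [hH, smul_mul_assoc, mul_assoc, hWN, mul_one]
    have h4 : H * N = z • H - H * U := by
      rw [hN, mul_sub, mul_smul_comm, mul_one]
    have h5 : H * U = z • H - Complex.I • S := by rw [← h3, h4]; abel
    rw [add_mul, h5, smul_mul_assoc, one_mul, hS, smul_sub, smul_add,
      smul_comm z Complex.I (1 : Matrix ι ι ℂ)]
    abel
  set V := hHerm.eigenvectorUnitary with hV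
  have hVm := V.2
  have hVV : (V : Matrix ι ι ℂ) * star (V : Matrix ι ι ℂ) = 1 := mem_unitaryGroup_iff.1 hVm
  have hVV' : star (V : Matrix ι ι ℂ) * (V : Matrix ι ι ℂ) = 1 := mem_unitaryGroup_iff'.1 hVm
  set h := hHerm.eigenvalues with hh
  have hspec : H = V * diagonal (fun k => (h k : ℂ)) * star (V : Matrix ι ι ℂ) := by
    have := hHerm.spectral_theorem
    rwa [Unitary.conjStarAlgAut_apply] at this
  have hne : ∀ k, (h k : ℂ) + Complex.I ≠ 0 := fun k hk => by
    have := congrArg Complex.im hk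
    simp at this
  refine ⟨V, hVm, fun k => z * (h k - Complex.I) / (h k + Complex.I), ?_⟩
  have hX : diagonal (fun k => (h k : ℂ) + Complex.I) * (star (V : Matrix ι ι ℂ) * U * V)
      = diagonal fun k => z * (h k - Complex.I) := by
    have e1 : diagonal (fun k => (h k : ℂ) + Complex.I)
        = star (V : Matrix ι ι ℂ) * (H + Complex.I • 1) * V := by
      rw [hspec, mul_add, add_mul, mul_smul_comm, mul_one, smul_mul_assoc, hVV', ← mul_assoc,
        ← mul_assoc, hVV', one_mul, mul_assoc, hVV', mul_one, smul_one_eq_diagonal, diagonal_add]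
    have e2 : diagonal (fun k => z * ((h k : ℂ) - Complex.I))
        = star (V : Matrix ι ι ℂ) * (z • (H - Complex.I • 1)) * V := by
      rw [hspec, mul_smul_comm, smul_mul_assoc, mul_sub, sub_mul, mul_smul_comm, mul_one,
        smul_mul_assoc, hVV', ← mul_assoc,
        ← mul_assoc, hVV', one_mul, mul_assoc, hVV', mul_one, smul_one_eq_diagonal, diagonal_sub]
      ext i j
      by_cases hij : i = j
      · subst hij; simp
      · simp [hij]
    rw [e1, e2, ← hHN]
    calc _ = star (V : Matrix ι ι ℂ) * (H + Complex.I • 1) * (V * star (V : Matrix ι ι ℂ)) * U * V := by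
          simp only [mul_assoc]
      _ = _ := by rw [hVV, mul_one]; simp only [mul_assoc]
  have hX2 : star (V : Matrix ι ι ℂ) * U * V
      = diagonal fun k => z * (h k - Complex.I) / (h k + Complex.I) := by
    have e3 : diagonal (fun k => ((h k : ℂ) + Complex.I)⁻¹) * diagonal (fun k => (h k : ℂ) + Complex.I)
        = 1 := by
      rw [diagonal_mul_diagonal]; simp [hne]
    rw [← one_mul (star (V : Matrix ι ι ℂ) * U * V), ← e3, mul_assoc, hX, diagonal_mul_diagonal]
    congr 1; funext k; ring
  rw [← hX2]
  calc U = (V * star (V : Matrix ι ι ℂ)) * U * (V * star (V : Matrix ι ι ℂ)) := by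
        rw [hVV, one_mul, mul_one]
    _ = _ := by simp only [mul_assoc]

theorem exists_unitary_diagonalization_of_charpoly {U : Matrix ι ι ℂ} (hU : U ∈ unitaryGroup ι ℂ)
    {d : ι → ℂ} (hd : U.charpoly = ∏ k, (X - C (d k))) :
    ∃ V ∈ unitaryGroup ι ℂ, U = V * diagonal d * star V := by
  obtain ⟨V, hV, e, rfl⟩ := exists_unitary_diagonalization hU
  have hVV' : star V * V = 1 := mem_unitaryGroup_iff'.1 hV
  rw [charpoly_mul_comm, ← mul_assoc, hVV', one_mul, charpoly_diagonal] at hd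
  obtain ⟨σ, hσ⟩ := exists_perm_of_prod_X_sub_C_eq hd
  have hstar : star (V.submatrix id σ.symm) = (star V).submatrix σ.symm id := rfl
  have hdiag : diagonal d = (diagonal e).submatrix σ.symm σ.symm := by
    rw [submatrix_diagonal_equiv]
    congr 1
    funext i
    simp [← hσ]
  refine ⟨V.submatrix id σ.symm, ?_, ?_⟩
  · rw [mem_unitaryGroup_iff, hstar, submatrix_mul_equiv, mem_unitaryGroup_iff.1 hV,
      submatrix_id_id]
  · rw [hstar, hdiag, submatrix_mul_equiv, submatrix_mul_equiv, submatrix_id_id]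

end RankOne

section Commutator

open Polynomial Matrix

theorem exists_unitary_row {ι : Type*} [Fintype ι] [DecidableEq ι] (i₀ : ι) (w : ι → ℝ)
    (hw : ∀ k, 0 ≤ w k) (hw1 : ∑ k, w k = 1) :
    ∃ V ∈ unitaryGroup ι ℂ, ∀ k, V i₀ k = (√(w k) : ℂ) := by
  set v : EuclideanSpace ℂ ι := WithLp.toLp 2 fun k => (√(w k) : ℂ) with hv
  have hnorm : ‖v‖ = 1 := by
    rw [EuclideanSpace.norm_eq]
    simp [hv, Real.sq_sqrt (hw _), hw1]
  have horth : Orthonormal ℂ (({i₀} : Set ι).domRestrict fun _ => v) := by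
    rw [orthonormal_iff_ite]
    rintro ⟨i, hi⟩ ⟨j, hj⟩
    obtain rfl := Set.mem_singleton_iff.1 hi
    obtain rfl := Set.mem_singleton_iff.1 hj
    have h1 : inner ℂ v v = (1 : ℂ) := by rw [inner_self_eq_norm_sq_to_K, hnorm]; simp
    simpa using h1
  obtain ⟨b, hb⟩ := horth.exists_orthonormalBasis_extension_of_card_eq (by simp)
  refine ⟨Matrix.of fun i k => b i k, ?_, fun k => ?_⟩
  · rw [mem_unitaryGroup_iff]
    ext i j
    have := orthonormal_iff_ite.1 b.orthonormal j i
    rw [Matrix.mul_apply, one_apply]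
    simp only [PiLp.inner_apply, RCLike.inner_apply] at this
    simpa [eq_comm (a := i)] using this
  · have := hb i₀ rfl
    simp [this, hv]

theorem charpoly_conj_unitary {ι : Type*} [Fintype ι] [DecidableEq ι] {V : Matrix ι ι ℂ}
    (hV : V ∈ unitaryGroup ι ℂ) (M : Matrix ι ι ℂ) : (V * M * star V).charpoly = M.charpoly := by
  rw [charpoly_mul_comm, ← mul_assoc, mem_unitaryGroup_iff'.1 hV, one_mul]

theorem charpoly_rankOne_mul_conj {ι : Type*} [Fintype ι] [DecidableEq ι] {V : Matrix ι ι ℂ}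
    (hV : V ∈ unitaryGroup ι ℂ) (i₀ : ι) (d : ι → ℂ) (t : ℂ) :
    ((1 + (t - 1) • vecMulVec (Pi.single i₀ 1) (Pi.single i₀ 1)) *
      (V * diagonal d * star V)).charpoly = secularPoly d (fun k => star (V i₀ k) * V i₀ k) t := by
  rw [← mul_assoc, charpoly_mul_comm, ← mul_assoc, ← mul_assoc,
    ← charpoly_rankOne_mul_diagonal (fun k => star (V i₀ k)) (fun k => V i₀ k) d t]
  congr 2
  rw [mul_add, mul_one, add_mul, mem_unitaryGroup_iff'.1 hV, mul_smul_comm, smul_mul_assoc,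
    mul_vecMulVec, vecMulVec_mul]
  congr 3
  · ext k; simp
  · ext k; simp

theorem smul_mu0_eq {n : ℕ} (hn : 0 < n) (y : ℝ) :
    Complex.exp (-(2 * Complex.I * y)) • mu0 n y
      = 1 + (Complex.exp (-(2 * Complex.I * (n * y))) - 1) •
        vecMulVec (Pi.single (⟨n - 1, by omega⟩ : Fin n) 1) (Pi.single ⟨n - 1, by omega⟩ 1) := by
  ext i j
  by_cases hij : i = j
  · subst hij
    by_cases hi : (i : ℕ) + 1 = n
    · have : i = ⟨n - 1, by omega⟩ := Fin.ext (by simp; omega)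
      simp only [mu0, Matrix.smul_apply, diagonal_apply_eq, hi, if_true, Matrix.add_apply, one_apply_eq,
        vecMulVec_apply, smul_eq_mul]
      rw [← Complex.exp_add, this]
      simp
      ring_nf
    · have : i ≠ ⟨n - 1, by omega⟩ := fun h => hi (by rw [h]; simp; omega)
      simp only [mu0, Matrix.smul_apply, diagonal_apply_eq, hi, if_false, Matrix.add_apply, one_apply_eq,
        vecMulVec_apply, smul_eq_mul]
      rw [← Complex.exp_add]
      simp [this]
  · have : (Pi.single (⟨n - 1, by omega⟩ : Fin n) 1 : Fin n → ℂ) i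
        * (Pi.single (⟨n - 1, by omega⟩ : Fin n) 1 : Fin n → ℂ) j = 0 := by
      by_cases hi : i = ⟨n - 1, by omega⟩
      · have : j ≠ ⟨n - 1, by omega⟩ := fun h => hij (hi.trans h.symm)
        simp [this]
      · simp [hi]
    simp [mu0, vecMulVec_apply, hij, this]

theorem diagonal_mem_unitaryGroup {ι : Type*} [Fintype ι] [DecidableEq ι] {d : ι → ℂ}
    (hd : ∀ k, d k * star (d k) = 1) : diagonal d ∈ unitaryGroup ι ℂ := by
  rw [mem_unitaryGroup_iff, star_eq_conjTranspose, diagonal_conjTranspose, diagonal_mul_diagonal]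
  simpa [funext_iff] using hd

theorem exp_mul_I_mul_star (x : ℝ) :
    Complex.exp (2 * Complex.I * x) * star (Complex.exp (2 * Complex.I * x)) = 1 := by
  rw [Complex.star_def, ← Complex.exp_conj, ← Complex.exp_add, map_mul, map_mul, Complex.conj_I,
    Complex.conj_ofReal, show (starRingEnd ℂ) 2 = 2 from Complex.conj_ofNat 2]
  simp

theorem mu0_mem_unitaryGroup (n : ℕ) (y : ℝ) : mu0 n y ∈ unitaryGroup (Fin n) ℂ := by
  refine diagonal_mem_unitaryGroup fun k => ?_
  split_ifs
  · have := exp_mul_I_mul_star (-((n - 1) * y))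
    push_cast at this
    rw [show -2 * ((n : ℂ) - 1) * Complex.I * y = 2 * Complex.I * -((n - 1) * y) by ring]
    exact this
  · exact exp_mul_I_mul_star y

theorem exists_specialUnitary_smul {n : ℕ} (hn : 0 < n) {V : Matrix (Fin n) (Fin n) ℂ}
    (hV : V ∈ unitaryGroup (Fin n) ℂ) :
    ∃ a : ℂ, a * star a = 1 ∧ a • V ∈ specialUnitaryGroup (Fin n) ℂ := by
  have hdet := det_of_mem_unitary hV
  have h1 : V.det * star V.det = 1 := (Unitary.mem_iff.1 hdet).2
  obtain ⟨a, ha⟩ := IsAlgClosed.exists_pow_nat_eq (star V.det) hn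
  have hnorm : ‖V.det‖ = 1 := by
    have := congrArg norm h1
    rw [norm_mul, norm_star, norm_one] at this
    nlinarith [norm_nonneg V.det]
  have hna : ‖a‖ = 1 := by
    have := congrArg norm ha
    rw [norm_pow, norm_star, hnorm] at this
    exact (pow_eq_one_iff_of_nonneg (norm_nonneg a) hn.ne').1 this
  have haa : a * star a = 1 := by
    rw [Complex.star_def, Complex.mul_conj, Complex.normSq_eq_norm_sq, hna]; simp
  refine ⟨a, haa, mem_specialUnitaryGroup_iff.2 ⟨?_, ?_⟩⟩
  · rw [mem_unitaryGroup_iff, star_smul, smul_mul_smul_comm, haa, one_smul,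
      mem_unitaryGroup_iff.1 hV]
  · rw [det_smul, Fintype.card_fin, ha, mul_comm, h1]

theorem exists_commutatorLevel_isConj_iff {n : ℕ} (hn : 0 < n) (y : ℝ) {d : Fin n → ℂ}
    (hd : ∀ k, d k * star (d k) = 1) (hdet : ∏ k, d k = 1) :
    (∃ p ∈ commutatorLevel n y, IsConj (p.2 : Matrix (Fin n) (Fin n) ℂ) (diagonal d)) ↔
      ∃ w : Fin n → ℝ, (∀ k, 0 ≤ w k) ∧ ∑ k, w k = 1 ∧
        ∏ k, (X - C (Complex.exp (-(2 * Complex.I * y)) * d k)) =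
          secularPoly d (fun k => (w k : ℂ)) (Complex.exp (-(2 * Complex.I * (n * y)))) := by
  set c := Complex.exp (-(2 * Complex.I * y)) with hc
  set t := Complex.exp (-(2 * Complex.I * (n * y))) with ht
  have hcharcd : ∀ V ∈ unitaryGroup (Fin n) ℂ, (c • (V * diagonal d * star V)).charpoly
      = ∏ k, (X - C (c * d k)) := by
    intro V hV
    rw [← smul_mul_assoc, ← mul_smul_comm, charpoly_conj_unitary hV, ← diagonal_smul,
      charpoly_diagonal]
    rfl
  have hc0 : c ≠ 0 := Complex.exp_ne_zero _
  constructor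
  · rintro ⟨⟨A, B⟩, hAB, hconj⟩
    have hcharB : (B : Matrix (Fin n) (Fin n) ℂ).charpoly = ∏ k, (X - C (d k)) := by
      obtain ⟨P, hP⟩ := hconj
      have hP' : (P : Matrix (Fin n) (Fin n) ℂ) * B = diagonal d * P := hP
      rw [← charpoly_units_conj P, ← coe_units_inv, (Units.mul_inv_eq_iff_eq_mul P).2 hP', charpoly_diagonal]
    obtain ⟨V, hV, hBV⟩ := exists_unitary_diagonalization_of_charpoly
      (mem_specialUnitaryGroup_iff.1 B.2).1 hcharB
    have hAu := (mem_specialUnitaryGroup_iff.1 A.2).1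
    have hAB' : mu0 n y * B = A * B * star (A : Matrix (Fin n) (Fin n) ℂ) := by
      have : mu0 n y = ((A * B * A⁻¹ * B⁻¹ : specialUnitaryGroup (Fin n) ℂ) :
        Matrix (Fin n) (Fin n) ℂ) := hAB.symm
      rw [this]
      have h2 : A * B * A⁻¹ * B⁻¹ * B = A * B * A⁻¹ := by group
      exact congrArg Subtype.val h2
    refine ⟨fun k => ‖V (⟨n - 1, by omega⟩) k‖ ^ 2, fun k => by positivity, ?_, ?_⟩
    · have := congrFun (congrFun (mem_unitaryGroup_iff.1 hV) ⟨n - 1, by omega⟩) ⟨n - 1, by omega⟩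
      rw [mul_apply, one_apply_eq] at this
      have h4 : ((∑ k, ‖V (⟨n - 1, by omega⟩) k‖ ^ 2 : ℝ) : ℂ) = 1 := by
        rw [← this]
        push_cast
        refine Finset.sum_congr rfl fun k _ => ?_
        simp [Complex.mul_conj, Complex.normSq_eq_norm_sq]
      exact_mod_cast h4
    · have h5 := charpoly_rankOne_mul_conj hV ⟨n - 1, by omega⟩ d t
      rw [← smul_mu0_eq hn y, ← hBV, smul_mul_assoc, hAB', ← smul_mul_assoc, ← mul_smul_comm,
        charpoly_conj_unitary hAu, hBV, hcharcd V hV] at h5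
      rw [h5]
      congr 1
      funext k
      rw [mul_comm]
      simp [Complex.mul_conj, Complex.normSq_eq_norm_sq]
  · rintro ⟨w, hw, hw1, hsec⟩
    obtain ⟨V, hV, hVw⟩ := exists_unitary_row ⟨n - 1, by omega⟩ w hw hw1
    have h5 := charpoly_rankOne_mul_conj hV ⟨n - 1, by omega⟩ d t
    have hww : (fun k => star (V ⟨n - 1, by omega⟩ k) * V ⟨n - 1, by omega⟩ k)
        = fun k => (w k : ℂ) := by
      funext k
      rw [hVw, Complex.star_def, Complex.conj_ofReal, ← Complex.ofReal_mul, Real.mul_self_sqrt (hw k)]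
    rw [hww, ← hsec, ← smul_mu0_eq hn y] at h5
    have hBu : V * diagonal d * star V ∈ unitaryGroup (Fin n) ℂ :=
      mul_mem (mul_mem hV (diagonal_mem_unitaryGroup hd)) (Unitary.star_mem hV)
    have hBdet : (V * diagonal d * star V).det = 1 := by
      rw [det_mul_right_comm, mem_unitaryGroup_iff.1 hV, one_mul, det_diagonal, hdet]
    have hMu : mu0 n y * (V * diagonal d * star V) ∈ unitaryGroup (Fin n) ℂ :=
      mul_mem (mu0_mem_unitaryGroup n y) hBu
    have hcc : c * star c = 1 := by
      have := exp_mul_I_mul_star (-y)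
      simpa [hc] using this
    have hcMu : (c • mu0 n y) * (V * diagonal d * star V) ∈ unitaryGroup (Fin n) ℂ := by
      rw [smul_mul_assoc, mem_unitaryGroup_iff, star_smul, smul_mul_smul_comm, hcc, one_smul,
        mem_unitaryGroup_iff.1 hMu]
    obtain ⟨V₂, hV₂, h6⟩ := exists_unitary_diagonalization_of_charpoly hcMu h5
    have h7 : mu0 n y * (V * diagonal d * star V) = V₂ * diagonal d * star V₂ := by
      have : (diagonal fun k => c * d k) = c • diagonal d := by rw [← diagonal_smul]; rfl
      rw [this, mul_smul_comm, smul_mul_assoc, smul_mul_assoc] at h6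
      exact smul_right_injective _ hc0 h6
    obtain ⟨a, haa, hA⟩ := exists_specialUnitary_smul hn (mul_mem hV₂ (Unitary.star_mem hV))
    let A : specialUnitaryGroup (Fin n) ℂ := ⟨_, hA⟩
    let B : specialUnitaryGroup (Fin n) ℂ := ⟨_, mem_specialUnitaryGroup_iff.2 ⟨hBu, hBdet⟩⟩
    have hVV := mem_unitaryGroup_iff'.1 hV
    have hVV' := mem_unitaryGroup_iff.1 hV
    refine ⟨(A, B), ?_, ?_⟩
    · have h8 : ((A * B : specialUnitaryGroup (Fin n) ℂ) : Matrix (Fin n) (Fin n) ℂ)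
          = mu0 n y * (B * A : specialUnitaryGroup (Fin n) ℂ) := by
        change (a • (V₂ * star V)) * (V * diagonal d * star V)
          = mu0 n y * ((V * diagonal d * star V) * (a • (V₂ * star V)))
        rw [← mul_assoc (mu0 n y), h7, smul_mul_assoc, mul_smul_comm]
        congr 1
        calc V₂ * star V * (V * diagonal d * star V)
            = V₂ * (star V * V) * diagonal d * star V := by simp only [mul_assoc]
          _ = V₂ * diagonal d * (star V₂ * V₂) * star V := by
            rw [hVV, mem_unitaryGroup_iff'.1 hV₂, mul_one, mul_one]
          _ = _ := by simp only [mul_assoc]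
      change ((A * B * A⁻¹ * B⁻¹ : specialUnitaryGroup (Fin n) ℂ) : Matrix (Fin n) (Fin n) ℂ)
        = mu0 n y
      have h9 : A * B * A⁻¹ * B⁻¹ = (A * B) * (B * A)⁻¹ := by group
      rw [h9, Submonoid.coe_mul, h8, mul_assoc, ← Submonoid.coe_mul, mul_inv_cancel]
      simp
    · refine ⟨⟨star V, V, hVV, hVV'⟩, ?_⟩
      change star V * (V * diagonal d * star V) = diagonal d * star V
      rw [← mul_assoc, ← mul_assoc, hVV, one_mul]

end Commutator

/-- The point `exp(2ix)` of the unit circle with half-angle `x`. -/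
noncomputable def circlePt (x : ℝ) : ℂ := Complex.exp (2 * Complex.I * x)

theorem circlePt_add (x y : ℝ) : circlePt (x + y) = circlePt x * circlePt y := by
  simp only [circlePt]
  rw [← Complex.exp_add]
  push_cast
  ring_nf

theorem circlePt_zero : circlePt 0 = 1 := by simp [circlePt]

theorem circlePt_ne_zero (x : ℝ) : circlePt x ≠ 0 := Complex.exp_ne_zero _

theorem circlePt_sum {ι : Type*} (s : Finset ι) (f : ι → ℝ) :
    circlePt (∑ i ∈ s, f i) = ∏ i ∈ s, circlePt (f i) := by
  simp only [circlePt]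
  rw [← Complex.exp_sum]
  push_cast
  rw [Finset.mul_sum]

theorem circlePt_eq_iff {x y : ℝ} : circlePt x = circlePt y ↔ ∃ m : ℤ, x = y + m * π := by
  simp only [circlePt]
  rw [Complex.exp_eq_exp_iff_exists_int]
  refine exists_congr fun m => ?_
  constructor
  · intro h
    have h2 : (2 * Complex.I) * (x : ℂ) = (2 * Complex.I) * ((y + m * π : ℝ) : ℂ) := by
      rw [h]; push_cast; ring
    have h3 := mul_left_cancel₀ (by simp) h2
    exact_mod_cast h3
  · intro h
    rw [h]; push_cast; ring

theorem circlePt_add_int_mul_pi (x : ℝ) (m : ℤ) : circlePt (x + m * π) = circlePt x :=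
  circlePt_eq_iff.2 ⟨m, rfl⟩

theorem continuous_circlePt : Continuous circlePt := by
  unfold circlePt; fun_prop

theorem circlePt_sub (x y : ℝ) : circlePt x - circlePt y =
    Complex.exp (Complex.I * (x + y)) * (2 * Complex.I) * (sin (x - y) : ℝ) := by
  have h1 : circlePt x = Complex.exp (Complex.I * (x + y)) * Complex.exp ((x - y : ℝ) * Complex.I) := by
    rw [circlePt, ← Complex.exp_add]; push_cast; ring_nf
  have h2 : circlePt y = Complex.exp (Complex.I * (x + y)) * Complex.exp (-(x - y : ℝ) * Complex.I) := by
    rw [circlePt, ← Complex.exp_add]; push_cast; ring_nf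
  rw [h1, h2, Complex.ofReal_sin, Complex.sin]
  field_simp
  ring_nf
  simp
  ring

/-- The real trigonometric form of the secular polynomial on the unit circle. -/
noncomputable def secularFun {ι : Type*} [Fintype ι] [DecidableEq ι] (θ w : ι → ℝ) (τ x : ℝ) : ℝ :=
  cos τ * ∏ k, sin (x - θ k) +
    sin τ * ∑ k, w k * (cos (x - θ k) * ∏ j ∈ Finset.univ.erase k, sin (x - θ j))

section Secular

open Polynomial

variable {ι : Type*} [Fintype ι] [DecidableEq ι]

theorem eval_secularPoly_circlePt (θ w : ι → ℝ) (hw : ∑ k, w k = 1) (τ x : ℝ) :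
    (secularPoly (fun k => circlePt (θ k)) (fun k => (w k : ℂ)) (circlePt (-τ))).eval (circlePt x) =
      (∏ k, (Complex.exp (Complex.I * (x + θ k)) * (2 * Complex.I))) *
        Complex.exp (-(Complex.I * τ)) * (secularFun θ w τ x : ℝ) := by
  set a : ι → ℂ := fun k => Complex.exp (Complex.I * (x + θ k)) * (2 * Complex.I) with ha
  set S : ι → ℂ := fun k => ∏ j ∈ Finset.univ.erase k, ((sin (x - θ j) : ℝ) : ℂ) with hS
  have hP : ∏ k, (circlePt x - circlePt (θ k)) = (∏ k, a k) * ∏ k, ((sin (x - θ k) : ℝ) : ℂ) := by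
    rw [← Finset.prod_mul_distrib]
    exact Finset.prod_congr rfl fun k _ => circlePt_sub x (θ k)
  have hPe : ∀ k, ∏ j ∈ Finset.univ.erase k, (circlePt x - circlePt (θ j))
      = (∏ j ∈ Finset.univ.erase k, a j) * S k := by
    intro k
    rw [hS, ← Finset.prod_mul_distrib]
    exact Finset.prod_congr rfl fun k _ => circlePt_sub x (θ k)
  have hM : ∀ k, a k * ∏ j ∈ Finset.univ.erase k, a j = ∏ j, a j := fun k =>
    Finset.mul_prod_erase _ _ (Finset.mem_univ k)
  have hSk : ∀ k, ((sin (x - θ k) : ℝ) : ℂ) * S k = ∏ k, ((sin (x - θ k) : ℝ) : ℂ) := fun k =>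
    Finset.mul_prod_erase _ (fun k => ((sin (x - θ k) : ℝ) : ℂ)) (Finset.mem_univ k)
  have ht : circlePt (-τ) - 1
      = -(Complex.exp (-(Complex.I * τ)) * (2 * Complex.I) * ((sin τ : ℝ) : ℂ)) := by
    rw [← circlePt_zero, circlePt_sub]
    simp
  have hak : ∀ k, (2 * Complex.I) * circlePt (θ k)
      = a k * (((cos (x - θ k) : ℝ) : ℂ) - Complex.I * ((sin (x - θ k) : ℝ) : ℂ)) := by
    intro k
    have h1 : (((cos (x - θ k) : ℝ) : ℂ) - Complex.I * ((sin (x - θ k) : ℝ) : ℂ))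
        = Complex.exp (-(x - θ k : ℝ) * Complex.I) := by
      rw [← Complex.ofReal_neg, Complex.exp_mul_I, ← Complex.ofReal_cos, ← Complex.ofReal_sin,
        cos_neg, sin_neg]
      push_cast; ring
    have h2 : Complex.exp (Complex.I * (x + θ k)) * Complex.exp (-(x - θ k : ℝ) * Complex.I)
        = circlePt (θ k) := by
      rw [← Complex.exp_add, circlePt]
      congr 1
      push_cast; ring
    rw [h1, ← h2, ha]
    ring
  have hone : Complex.exp (-(Complex.I * τ)) *
      (((cos τ : ℝ) : ℂ) + Complex.I * ((sin τ : ℝ) : ℂ)) = 1 := by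
    have : ((cos τ : ℝ) : ℂ) + Complex.I * ((sin τ : ℝ) : ℂ) = Complex.exp (Complex.I * τ) := by
      rw [mul_comm Complex.I (τ : ℂ), Complex.exp_mul_I, ← Complex.ofReal_cos, ← Complex.ofReal_sin]
      ring
    rw [this, ← Complex.exp_add, neg_add_cancel, Complex.exp_zero]
  have hwC : ∑ k, (w k : ℂ) = 1 := by exact_mod_cast hw
  set P : ℂ := ∏ k, ((sin (x - θ k) : ℝ) : ℂ) with hPdef
  have hterm : ∀ k, (circlePt (-τ) - 1) * ((w k : ℂ) * circlePt (θ k) *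
      ((∏ j ∈ Finset.univ.erase k, a j) * S k)) =
      -((∏ j, a j) * Complex.exp (-(Complex.I * τ)) * ((sin τ : ℝ) : ℂ) *
        (w k * (((cos (x - θ k) : ℝ) : ℂ) * S k)))
      + (∏ j, a j) * Complex.exp (-(Complex.I * τ)) * ((sin τ : ℝ) : ℂ) * Complex.I * P * w k := by
    intro k
    rw [ht, ← hM k, ← hSk k]
    linear_combination (-(Complex.exp (-(Complex.I * τ)) * ((sin τ : ℝ) : ℂ)) * (w k : ℂ) *
      ((∏ j ∈ Finset.univ.erase k, a j) * S k)) * hak k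
  have hfun : ((secularFun θ w τ x : ℝ) : ℂ) = ((cos τ : ℝ) : ℂ) * P +
      ((sin τ : ℝ) : ℂ) * ∑ k, (w k : ℂ) * (((cos (x - θ k) : ℝ) : ℂ) * S k) := by
    rw [secularFun, hPdef, hS]
    push_cast
    rfl
  rw [eval_secularPoly, hP]
  simp only [hPe]
  rw [Finset.mul_sum, Finset.sum_congr rfl fun k _ => hterm k, Finset.sum_add_distrib,
    Finset.sum_neg_distrib, ← Finset.mul_sum, ← Finset.mul_sum, hwC, hfun]
  linear_combination (-(∏ j, a j) * P) * hone

theorem degree_secularPoly_sub_lt (d w e : ι → ℂ) (t : ℂ) (hι : 0 < Fintype.card ι) :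
    (secularPoly d w t - ∏ k, (X - C (e k))).degree < (Fintype.card ι : WithBot ℕ) := by
  have hdeg : ∀ f : ι → ℂ, (∏ k, (X - C (f k))).degree = (Fintype.card ι : WithBot ℕ) := by
    intro f
    rw [degree_prod]; simp
  have h1 : (∏ k, (X - C (d k)) - ∏ k, (X - C (e k))).degree < (Fintype.card ι : WithBot ℕ) := by
    rw [← hdeg d]
    refine degree_sub_lt_left ((hdeg d).trans (hdeg e).symm) ?_ ?_
    · exact (monic_prod_of_monic _ _ fun k _ => monic_X_sub_C _).ne_zero
    · rw [(monic_prod_of_monic _ _ fun k _ => monic_X_sub_C (d k)).leadingCoeff,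
        (monic_prod_of_monic _ _ fun k _ => monic_X_sub_C (e k)).leadingCoeff]
  have h2 : (C (t - 1) * ∑ k, C (w k * d k) *
      ∏ j ∈ Finset.univ.erase k, (X - C (d j))).degree < (Fintype.card ι : WithBot ℕ) := by
    rw [← mem_degreeLT, ← smul_eq_C_mul]
    refine Submodule.smul_mem _ _ (Submodule.sum_mem _ fun k _ => ?_)
    rw [← smul_eq_C_mul]
    refine Submodule.smul_mem _ _ ?_
    rw [mem_degreeLT, degree_prod]
    simp only [degree_X_sub_C, Finset.sum_const, Finset.card_erase_of_mem (Finset.mem_univ k),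
      Finset.card_univ, nsmul_eq_mul, mul_one]
    exact_mod_cast Nat.sub_lt hι one_pos
  rw [secularPoly, sub_right_comm]
  exact (degree_sub_le _ _).trans_lt (max_lt h1 h2)

theorem secularPoly_eq_prod_of_eval_eq {d w e : ι → ℂ} {t : ℂ} {z : ι → ℂ}
    (hz : Function.Injective z)
    (h : ∀ k, (secularPoly d w t).eval (z k) = (∏ j, (X - C (e j))).eval (z k)) :
    secularPoly d w t = ∏ k, (X - C (e k)) := by
  rcases Nat.eq_zero_or_pos (Fintype.card ι) with h0 | hι
  · have := Fintype.card_eq_zero_iff.1 h0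
    simp [secularPoly]
  refine eq_of_degree_sub_lt_of_eval_finset_eq (Finset.univ.image z) ?_ ?_
  · rw [Finset.card_image_of_injective _ hz, Finset.card_univ]
    exact degree_secularPoly_sub_lt d w e t hι
  · simpa using h

theorem continuous_secularFun (θ w : ι → ℝ) (τ : ℝ) : Continuous (secularFun θ w τ) := by
  unfold secularFun; fun_prop

theorem secularFun_self (θ w : ι → ℝ) (τ : ℝ) (k : ι) :
    secularFun θ w τ (θ k) = sin τ * (w k * ∏ j ∈ Finset.univ.erase k, sin (θ k - θ j)) := by
  have h1 : ∏ j, sin (θ k - θ j) = 0 := Finset.prod_eq_zero (Finset.mem_univ k) (by simp)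
  rw [secularFun, h1, Finset.sum_eq_single k]
  · simp
  · intro j _ hj
    rw [Finset.prod_eq_zero (Finset.mem_erase.2 ⟨hj.symm, Finset.mem_univ k⟩) (by simp)]
    simp
  · simp

theorem secularFun_sub_pi (θ w : ι → ℝ) (τ x : ℝ) :
    secularFun θ w τ (x - π) = (-1) ^ Fintype.card ι * secularFun θ w τ x := by
  have hs : ∀ k, sin (x - π - θ k) = -1 * sin (x - θ k) := fun k => by
    rw [sub_right_comm, sin_sub_pi]; ring
  have hc : ∀ k, cos (x - π - θ k) = -1 * cos (x - θ k) := fun k => by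
    rw [sub_right_comm, cos_sub_pi]; ring
  have he : ∀ k : ι, (-1 : ℝ) * (-1) ^ (Finset.univ.erase k).card = (-1) ^ Fintype.card ι := by
    intro k
    rw [← pow_succ', Finset.card_erase_add_one (Finset.mem_univ k), Finset.card_univ]
  simp only [secularFun, hs, hc, Finset.prod_mul_distrib, Finset.prod_const, Finset.card_univ]
  rw [mul_add, Finset.mul_sum, Finset.mul_sum, Finset.mul_sum]
  congr 1
  · ring
  · refine Finset.sum_congr rfl fun k _ => ?_
    rw [← he k]; ring

end Secular

section Interlacing

open Polynomial

/-- `θ` lists, in increasing order, half-angles lying in a window of length at most `π`. -/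
def IsAngleWindow {N : ℕ} (θ : Fin (N + 1) → ℝ) : Prop :=
  Monotone θ ∧ θ (Fin.last N) ≤ θ 0 + π

/-- The half-angles `φ` interlace the half-angles `θ` on the circle of length `π`:
`θ_{k-1} ≤ φ_k ≤ θ_k` for all `k`. -/
def Interlaces {N : ℕ} (θ φ : Fin (N + 1) → ℝ) : Prop :=
  (∀ k, φ k ≤ θ k) ∧ (∀ k : Fin N, θ k.castSucc ≤ φ k.succ) ∧ θ (Fin.last N) - π ≤ φ 0

theorem exists_zero_of_mul_neg {g : ℝ → ℝ} (hg : Continuous g) {a b : ℝ} (hab : a < b)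
    (h : g a * g b < 0) : ∃ c, a < c ∧ c < b ∧ g c = 0 := by
  rcases mul_neg_iff.1 h with ⟨ha, hb⟩ | ⟨ha, hb⟩
  · obtain ⟨c, hc, hc0⟩ := intermediate_value_Ioo' hab.le hg.continuousOn ⟨hb, ha⟩
    exact ⟨c, hc.1, hc.2, hc0⟩
  · obtain ⟨c, hc, hc0⟩ := intermediate_value_Ioo hab.le hg.continuousOn ⟨ha, hb⟩
    exact ⟨c, hc.1, hc.2, hc0⟩

theorem prod_sin_sub_sign {N : ℕ} {θ : Fin (N + 1) → ℝ} (hθ : StrictMono θ)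
    (hθ' : θ (Fin.last N) < θ 0 + π) (k : Fin (N + 1)) :
    0 < (-1) ^ (N - (k : ℕ)) * ∏ j ∈ Finset.univ.erase k, sin (θ k - θ j) := by
  have hlt : ∀ i j : Fin (N + 1), θ i - θ j < π := fun i j => by
    have h1 := hθ.monotone (Fin.le_last i)
    have h2 := hθ.monotone (Fin.zero_le j)
    linarith
  have hsplit : Finset.univ.erase k = Finset.Iio k ∪ Finset.Ioi k := by
    ext j
    simp [lt_or_lt_iff_ne]
  have hdisj : Disjoint (Finset.Iio k) (Finset.Ioi k) :=
    Finset.disjoint_left.2 fun j h1 h2 => by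
      rw [Finset.mem_Iio] at h1
      rw [Finset.mem_Ioi] at h2
      exact lt_asymm h1 h2
  have hneg : ∏ j ∈ Finset.Ioi k, sin (θ k - θ j)
      = (-1) ^ (N - (k : ℕ)) * ∏ j ∈ Finset.Ioi k, sin (θ j - θ k) := by
    have hc : N - (k : ℕ) = (Finset.Ioi k).card := by
      rw [Fin.card_Ioi]; omega
    rw [hc, ← Finset.prod_const, ← Finset.prod_mul_distrib]
    refine Finset.prod_congr rfl fun j _ => ?_
    rw [← neg_sub, sin_neg]; ring
  rw [hsplit, Finset.prod_union hdisj, hneg]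
  have hsq : ((-1 : ℝ) ^ (N - (k : ℕ))) * (-1) ^ (N - (k : ℕ)) = 1 := by
    rw [← mul_pow]; simp
  have h1 : 0 < ∏ j ∈ Finset.Iio k, sin (θ k - θ j) :=
    Finset.prod_pos fun j hj => sin_pos_of_pos_of_lt_pi
      (sub_pos.2 (hθ (Finset.mem_Iio.1 hj))) (hlt k j)
  have h2 : 0 < ∏ j ∈ Finset.Ioi k, sin (θ j - θ k) :=
    Finset.prod_pos fun j hj => sin_pos_of_pos_of_lt_pi
      (sub_pos.2 (hθ (Finset.mem_Ioi.1 hj))) (hlt j k)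
  calc 0 < (∏ j ∈ Finset.Iio k, sin (θ k - θ j)) * ∏ j ∈ Finset.Ioi k, sin (θ j - θ k) :=
        mul_pos h1 h2
    _ = _ := by linear_combination (-(∏ j ∈ Finset.Iio k, sin (θ k - θ j)) *
        ∏ j ∈ Finset.Ioi k, sin (θ j - θ k)) * hsq

theorem injective_circlePt_of_strictMono {N : ℕ} {θ : Fin (N + 1) → ℝ} (hθ : StrictMono θ)
    (hθ' : θ (Fin.last N) < θ 0 + π) : Function.Injective fun k => circlePt (θ k) := by
  intro i j hij
  obtain ⟨m, hm⟩ := circlePt_eq_iff.1 hij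
  have hlt : ∀ i j : Fin (N + 1), θ i - θ j < π := fun i j => by
    have h1 := hθ.monotone (Fin.le_last i)
    have h2 := hθ.monotone (Fin.zero_le j)
    linarith
  have h1 : (m : ℝ) < 1 := by nlinarith [hlt i j, pi_pos]
  have h2 : (-1 : ℝ) < m := by nlinarith [hlt j i, pi_pos]
  have hm0 : m = 0 := by
    have h3 : m < 1 := by exact_mod_cast h1
    have h4 : -1 < m := by exact_mod_cast h2
    omega
  exact hθ.injective (by simpa [hm0] using hm)

theorem exists_interlacing_of_generic {N : ℕ} {θ w : Fin (N + 1) → ℝ} (hθ : StrictMono θ)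
    (hθ' : θ (Fin.last N) < θ 0 + π) (hw : ∀ k, 0 < w k) (hw1 : ∑ k, w k = 1) {τ : ℝ}
    (hτ : 0 < τ) (hτ' : τ < π) :
    ∃ φ, Interlaces θ φ ∧ secularPoly (fun k => circlePt (θ k)) (fun k => (w k : ℂ)) (circlePt (-τ))
      = ∏ k, (X - C (circlePt (φ k))) := by
  set g := secularFun θ w τ with hg
  have hgc : Continuous g := continuous_secularFun θ w τ
  have hsgn : ∀ k : Fin (N + 1), 0 < (-1) ^ (N - (k : ℕ)) * g (θ k) := by
    intro k
    rw [hg, secularFun_self]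
    have h1 := mul_pos (mul_pos (sin_pos_of_pos_of_lt_pi hτ hτ') (hw k)) (prod_sin_sub_sign hθ hθ' k)
    calc _ < _ := h1
      _ = _ := by ring
  have hroot0 : ∃ c, θ (Fin.last N) - π < c ∧ c < θ 0 ∧ g c = 0 := by
    refine exists_zero_of_mul_neg hgc (by linarith) ?_
    rw [hg, secularFun_sub_pi, ← hg]
    have h1 := hsgn (Fin.last N)
    have h2 := hsgn 0
    simp only [Fin.val_last, Nat.sub_self, pow_zero, one_mul, Fin.val_zero, Nat.sub_zero] at h1 h2
    have h3 := mul_pos h1 h2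
    rw [Fintype.card_fin, pow_succ]
    linarith
  have hroot : ∀ k : Fin N, ∃ c, θ k.castSucc < c ∧ c < θ k.succ ∧ g c = 0 := by
    intro k
    refine exists_zero_of_mul_neg hgc (hθ Fin.castSucc_lt_succ) ?_
    have h1 := hsgn k.castSucc
    have h2 := hsgn k.succ
    have hk : N - ((k.castSucc : Fin (N + 1)) : ℕ) = (N - ((k.succ : Fin (N + 1)) : ℕ)) + 1 := by
      simp only [Fin.val_castSucc, Fin.val_succ]
      have := k.2
      omega
    rw [hk, pow_succ] at h1
    have hsq : ((-1 : ℝ) ^ (N - ((k.succ : Fin (N + 1)) : ℕ))) *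
        (-1) ^ (N - ((k.succ : Fin (N + 1)) : ℕ)) = 1 := by
      rw [← mul_pow]; simp
    have h3 := mul_pos h1 h2
    have h4 : g (θ k.castSucc) * g (θ k.succ) =
      -((-1) ^ (N - ((k.succ : Fin (N + 1)) : ℕ)) * -1 * g (θ k.castSucc) *
        ((-1) ^ (N - ((k.succ : Fin (N + 1)) : ℕ)) * g (θ k.succ))) := by
      linear_combination (-(g (θ k.castSucc) * g (θ k.succ))) * hsq
    linarith
  obtain ⟨c₀, h01, h02, h03⟩ := hroot0
  choose c hc1 hc2 hc3 using hroot
  set φ : Fin (N + 1) → ℝ := Fin.cons c₀ c with hφ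
  have hφθ : ∀ k, φ k < θ k := by
    intro k
    refine Fin.cases ?_ (fun k => ?_) k
    · exact h02
    · exact hc2 k
  have hφg : ∀ k, g (φ k) = 0 := by
    intro k
    refine Fin.cases ?_ (fun k => ?_) k
    · exact h03
    · exact hc3 k
  have hφm : StrictMono φ := by
    refine Fin.strictMono_iff_lt_succ.2 fun k => ?_
    exact (hφθ _).trans (hc1 k)
  have hφl : φ (Fin.last N) < φ 0 + π := by
    have h1 := hφθ (Fin.last N)
    have h2 : θ (Fin.last N) - π < φ 0 := h01
    linarith
  refine ⟨φ, ⟨fun k => (hφθ k).le, fun k => (hc1 k).le, h01.le⟩, ?_⟩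
  refine secularPoly_eq_prod_of_eval_eq (injective_circlePt_of_strictMono hφm hφl) fun k => ?_
  rw [eval_secularPoly_circlePt θ w hw1, ← hg, hφg k, eval_prod]
  simp [Finset.prod_eq_zero (Finset.mem_univ k)]

theorem exists_interlacing {N : ℕ} {θ w : Fin (N + 1) → ℝ} (hθ : IsAngleWindow θ)
    (hw : ∀ k, 0 ≤ w k) (hw1 : ∑ k, w k = 1) {τ : ℝ} (hτ : 0 < τ) (hτ' : τ < π) :
    ∃ φ, Interlaces θ φ ∧ secularPoly (fun k => circlePt (θ k)) (fun k => (w k : ℂ)) (circlePt (-τ))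
      = ∏ k, (X - C (circlePt (φ k))) := by
  set ε : ℕ → ℝ := fun m => 1 / ((m : ℝ) + 1) with hε
  have hε0 : ∀ m, 0 < ε m := fun m => by positivity
  have hε1 : ∀ m, ε m ≤ 1 := fun m => by
    rw [hε]; simp only; rw [div_le_one (by positivity)]; linarith [(Nat.cast_nonneg m : (0:ℝ) ≤ m)]
  have hεt : Filter.Tendsto ε Filter.atTop (nhds 0) := tendsto_one_div_add_atTop_nhds_zero_nat
  set Θ : ℕ → Fin (N + 1) → ℝ := fun m k =>
    (1 - ε m) * θ k + ε m * (θ 0 + (k : ℕ) * (π / (N + 1))) with hΘ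
  set W : ℕ → Fin (N + 1) → ℝ := fun m k => (1 - ε m) * w k + ε m * (1 / (N + 1)) with hW
  have hN : (0 : ℝ) < N + 1 := by positivity
  have hgen : ∀ m, ∃ φ, Interlaces (Θ m) φ ∧ secularPoly (fun k => circlePt (Θ m k))
      (fun k => (W m k : ℂ)) (circlePt (-τ)) = ∏ k, (X - C (circlePt (φ k))) := by
    intro m
    have h1 := hε0 m
    have h2 := hε1 m
    refine exists_interlacing_of_generic ?_ ?_ ?_ ?_ hτ hτ'
    · intro i j hij
      have h3 := hθ.1 hij.le
      have h4 : ((i : ℕ) : ℝ) < ((j : ℕ) : ℝ) := by exact_mod_cast hij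
      have h5 : ((i : ℕ) : ℝ) * (π / (N + 1)) < ((j : ℕ) : ℝ) * (π / (N + 1)) :=
        mul_lt_mul_of_pos_right h4 (by positivity)
      have h6 := mul_lt_mul_of_pos_left h5 h1
      have h7 := mul_le_mul_of_nonneg_left h3 (sub_nonneg.2 h2)
      simp only [hΘ]
      linarith
    · have h3 := hθ.2
      have h4 : (N : ℝ) * (π / (N + 1)) < π := by
        rw [mul_div_assoc', div_lt_iff₀ hN]
        nlinarith [pi_pos]
      have h6 := mul_lt_mul_of_pos_left h4 h1
      have h7 := mul_le_mul_of_nonneg_left h3 (sub_nonneg.2 h2)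
      simp only [hΘ, Fin.val_last, Fin.val_zero, Nat.cast_zero, zero_mul]
      linarith
    · intro k
      have h3 := mul_nonneg (sub_nonneg.2 h2) (hw k)
      have h4 : 0 < ε m * (1 / (N + 1)) := by positivity
      simp only [hW]
      linarith
    · simp only [hW, Finset.sum_add_distrib, ← Finset.mul_sum, hw1]
      simp
      field_simp
      ring
  choose φ hφ hφs using hgen
  have hΘt : ∀ k, Filter.Tendsto (fun m => Θ m k) Filter.atTop (nhds (θ k)) := by
    intro k
    have := ((hεt.const_sub 1).mul_const (θ k)).add (hεt.mul_const (θ 0 + (k : ℕ) * (π / (N + 1))))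
    simpa using this
  have hWt : ∀ k, Filter.Tendsto (fun m => W m k) Filter.atTop (nhds (w k)) := by
    intro k
    have := ((hεt.const_sub 1).mul_const (w k)).add (hεt.mul_const (1 / ((N : ℝ) + 1)))
    simpa [hW] using this
  obtain ⟨a, b, hab⟩ : ∃ a b : ℝ, ∀ m, φ m ∈ Set.Icc (fun _ => a) (fun _ => b) := by
    have hΘb : ∀ m k, θ 0 ≤ Θ m k ∧ Θ m k ≤ θ 0 + π := by
      intro m k
      have h1 := (hε0 m).le
      have h2 := sub_nonneg.2 (hε1 m)
      have h3 := mul_le_mul_of_nonneg_left (hθ.1 (Fin.zero_le k)) h2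
      have h4 := mul_le_mul_of_nonneg_left ((hθ.1 (Fin.le_last k)).trans hθ.2) h2
      have h5 : 0 ≤ ((k : ℕ) : ℝ) * (π / (N + 1)) := by positivity
      have h6 : ((k : ℕ) : ℝ) * (π / (N + 1)) ≤ π := by
        have : ((k : ℕ) : ℝ) ≤ N := by exact_mod_cast Nat.lt_succ_iff.1 k.2
        rw [mul_div_assoc', div_le_iff₀ hN]
        nlinarith [pi_pos]
      have h7 := mul_nonneg h1 h5
      have h8 := mul_le_mul_of_nonneg_left h6 h1
      simp only [hΘ]
      constructor <;> linarith
    refine ⟨θ 0 - π, θ 0 + π, fun m => ⟨fun k => ?_, fun k => ((hφ m).1 k).trans (hΘb m k).2⟩⟩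
    refine Fin.cases ?_ (fun k => ?_) k
    · have h1 := (hφ m).2.2
      have h2 := (hΘb m (Fin.last N)).1
      simp only
      linarith
    · have h1 := (hφ m).2.1 k
      have h2 := (hΘb m k.castSucc).1
      simp only
      linarith [pi_pos]
  obtain ⟨φ₀, -, s, hs, hlim⟩ := (isCompact_Icc (a := fun _ : Fin (N + 1) => a)
    (b := fun _ => b)).tendsto_subseq hab
  have hlim' : ∀ k, Filter.Tendsto (fun m => φ (s m) k) Filter.atTop (nhds (φ₀ k)) :=
    tendsto_pi_nhds.1 hlim
  have hΘs : ∀ k, Filter.Tendsto (fun m => Θ (s m) k) Filter.atTop (nhds (θ k)) := fun k =>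
    (hΘt k).comp hs.tendsto_atTop
  have hWs : ∀ k, Filter.Tendsto (fun m => W (s m) k) Filter.atTop (nhds (w k)) := fun k =>
    (hWt k).comp hs.tendsto_atTop
  refine ⟨φ₀, ⟨fun k => ?_, fun k => ?_, ?_⟩, ?_⟩
  · exact le_of_tendsto_of_tendsto' (hlim' k) (hΘs k) fun m => (hφ (s m)).1 k
  · exact le_of_tendsto_of_tendsto' (hΘs _) (hlim' _) fun m => (hφ (s m)).2.1 k
  · exact le_of_tendsto_of_tendsto' ((hΘs _).sub_const π) (hlim' _) fun m => (hφ (s m)).2.2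
  · refine Polynomial.funext fun z => ?_
    have hc : ∀ {f : ℕ → ℝ} {x : ℝ}, Filter.Tendsto f Filter.atTop (nhds x) →
        Filter.Tendsto (fun m => circlePt (f m)) Filter.atTop (nhds (circlePt x)) := fun h =>
      (continuous_circlePt.tendsto _).comp h
    have hL : Filter.Tendsto (fun m => (∏ k, (X - C (circlePt (φ (s m) k)))).eval z) Filter.atTop
        (nhds ((∏ k, (X - C (circlePt (φ₀ k)))).eval z)) := by
      simp only [eval_prod, eval_sub, eval_X, eval_C]
      exact tendsto_finsetProd _ fun k _ => (hc (hlim' k)).const_sub z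
    have hR : Filter.Tendsto (fun m => (secularPoly (fun k => circlePt (Θ (s m) k))
        (fun k => (W (s m) k : ℂ)) (circlePt (-τ))).eval z) Filter.atTop
        (nhds ((secularPoly (fun k => circlePt (θ k)) (fun k => (w k : ℂ))
          (circlePt (-τ))).eval z)) := by
      simp only [eval_secularPoly]
      refine (tendsto_finsetProd _ fun k _ => (hc (hΘs k)).const_sub z).sub
        (Filter.Tendsto.const_mul _ (tendsto_finsetSum _ fun k _ => ?_))
      refine Filter.Tendsto.mul (Filter.Tendsto.mul ?_ (hc (hΘs k)))
        (tendsto_finsetProd _ fun j _ => (hc (hΘs j)).const_sub z)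
      exact (Complex.continuous_ofReal.tendsto _).comp (hWs k)
    simp only [hφs] at hR
    exact tendsto_nhds_unique hR hL

theorem Interlaces.sum_sub_mem {N : ℕ} {θ φ : Fin (N + 1) → ℝ} (h : Interlaces θ φ) :
    0 ≤ ∑ k, θ k - ∑ k, φ k ∧ ∑ k, θ k - ∑ k, φ k ≤ π := by
  constructor
  · exact sub_nonneg.2 (Finset.sum_le_sum fun k _ => h.1 k)
  · rw [Fin.sum_univ_castSucc θ, Fin.sum_univ_succ φ]
    have h1 := Finset.sum_le_sum fun k (_ : k ∈ (Finset.univ : Finset (Fin N))) => h.2.1 k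
    have h2 := h.2.2
    linarith

theorem circlePt_sum_of_secularPoly_eq {ι : Type*} [Fintype ι] [DecidableEq ι] {θ φ w : ι → ℝ}
    (hw1 : ∑ k, w k = 1) {τ : ℝ}
    (h : secularPoly (fun k => circlePt (θ k)) (fun k => (w k : ℂ)) (circlePt (-τ))
      = ∏ k, (X - C (circlePt (φ k)))) : circlePt (∑ k, θ k - ∑ k, φ k) = circlePt τ := by
  have h0 := congrArg (eval 0) h
  rw [eval_secularPoly, eval_prod] at h0
  simp only [zero_sub, eval_sub, eval_X, eval_C] at h0
  have hk : ∀ k, (w k : ℂ) * circlePt (θ k) * ∏ j ∈ Finset.univ.erase k, -circlePt (θ j)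
      = -(w k * ∏ j, -circlePt (θ j)) := by
    intro k
    rw [← Finset.mul_prod_erase _ (fun j => -circlePt (θ j)) (Finset.mem_univ k)]
    ring
  have hwC : ∑ k, (w k : ℂ) = 1 := by exact_mod_cast hw1
  rw [Finset.sum_congr rfl fun k _ => hk k, Finset.sum_neg_distrib, ← Finset.sum_mul, hwC,
    Finset.prod_neg, Finset.prod_neg, ← circlePt_sum, ← circlePt_sum] at h0
  have h1 : ((-1 : ℂ) ^ (Finset.univ : Finset ι).card) ≠ 0 := pow_ne_zero _ (by norm_num)
  have h2 : circlePt (-τ) * circlePt (∑ k, θ k) = circlePt (∑ k, φ k) := by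
    apply mul_left_cancel₀ h1
    linear_combination h0
  have h3 : circlePt (∑ k, θ k - ∑ k, φ k) * circlePt (∑ k, φ k)
      = circlePt τ * circlePt (∑ k, φ k) := by
    rw [← circlePt_add, ← h2, ← circlePt_add, ← circlePt_add]
    congr 1
    ring
  exact mul_right_cancel₀ (circlePt_ne_zero _) h3

theorem Interlaces.sum_sub_eq {N : ℕ} {θ φ w : Fin (N + 1) → ℝ} (hI : Interlaces θ φ)
    (hw1 : ∑ k, w k = 1) {τ : ℝ} (hτ : 0 < τ) (hτ' : τ < π)
    (h : secularPoly (fun k => circlePt (θ k)) (fun k => (w k : ℂ)) (circlePt (-τ))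
      = ∏ k, (X - C (circlePt (φ k)))) : ∑ k, θ k - ∑ k, φ k = τ := by
  obtain ⟨m, hm⟩ := circlePt_eq_iff.1 (circlePt_sum_of_secularPoly_eq hw1 h)
  obtain ⟨h1, h2⟩ := hI.sum_sub_mem
  have h3 : (m : ℝ) < 1 := by nlinarith [pi_pos]
  have h4 : (-1 : ℝ) < m := by nlinarith [pi_pos]
  have hm0 : m = 0 := by
    have h5 : m < 1 := by exact_mod_cast h3
    have h6 : -1 < m := by exact_mod_cast h4
    omega
  simpa [hm0] using hm

end Interlacing

section QuasiPeriodic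

open Polynomial

theorem exists_quasiPeriodic_extension {N : ℕ} {θ : Fin (N + 1) → ℝ} (hθ : IsAngleWindow θ) :
    ∃ Θ : ℤ → ℝ, Monotone Θ ∧ (∀ k, Θ (k + (N + 1 : ℕ)) = Θ k + π) ∧
      ∀ i : Fin (N + 1), Θ ((i : ℕ) : ℤ) = θ i := by
  have hn : (0 : ℤ) < (N + 1 : ℕ) := by positivity
  set r : ℤ → Fin (N + 1) := fun k => ⟨(k % (N + 1 : ℕ)).toNat, by
    have h1 := Int.emod_nonneg k hn.ne'
    have h2 := Int.emod_lt_of_pos k hn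
    omega⟩ with hr
  have hrv : ∀ k, ((r k : ℕ) : ℤ) = k % (N + 1 : ℕ) := fun k =>
    Int.toNat_of_nonneg (Int.emod_nonneg k hn.ne')
  set Θ : ℤ → ℝ := fun k => θ (r k) + (k / (N + 1 : ℕ) : ℤ) * π with hΘ
  have hval : ∀ (i : Fin (N + 1)) (q : ℤ), Θ (((i : ℕ) : ℤ) + q * (N + 1 : ℕ)) = θ i + q * π := by
    intro i q
    have hi : ((i : ℕ) : ℤ) < (N + 1 : ℕ) := by exact_mod_cast i.2
    have h1 : (((i : ℕ) : ℤ) + q * (N + 1 : ℕ)) / (N + 1 : ℕ) = q := by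
      rw [Int.add_mul_ediv_right _ _ hn.ne', Int.ediv_eq_zero_of_lt (by positivity) hi, zero_add]
    have h2 : r (((i : ℕ) : ℤ) + q * (N + 1 : ℕ)) = i := by
      have h3 := hrv (((i : ℕ) : ℤ) + q * (N + 1 : ℕ))
      rw [Int.add_mul_emod_self_right, Int.emod_eq_of_lt (by positivity) hi] at h3
      exact Fin.ext (by exact_mod_cast h3)
    simp only [hΘ]
    rw [h1, h2]
  have hdecomp : ∀ k : ℤ, k = ((r k : ℕ) : ℤ) + (k / (N + 1 : ℕ)) * (N + 1 : ℕ) := by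
    intro k
    rw [hrv, mul_comm, Int.emod_add_mul_ediv]
  refine ⟨Θ, monotone_int_of_le_succ fun k => ?_, fun k => ?_, fun i => ?_⟩
  · rw [hdecomp k]
    generalize k / (N + 1 : ℕ) = q
    generalize r k = i
    rw [hval]
    refine Fin.lastCases ?_ (fun i => ?_) i
    · have h1 : (((Fin.last N : Fin (N + 1)) : ℕ) : ℤ) + q * (N + 1 : ℕ) + 1
          = (((0 : Fin (N + 1)) : ℕ) : ℤ) + (q + 1) * (N + 1 : ℕ) := by
        simp; ring
      rw [h1, hval]
      push_cast
      linarith [hθ.2]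
    · have h1 : (((i.castSucc : Fin (N + 1)) : ℕ) : ℤ) + q * (N + 1 : ℕ) + 1
          = (((i.succ : Fin (N + 1)) : ℕ) : ℤ) + q * (N + 1 : ℕ) := by
        simp; ring
      rw [h1, hval]
      linarith [hθ.1 (Fin.castSucc_lt_succ (i := i)).le]
  · rw [hdecomp k]
    generalize k / (N + 1 : ℕ) = q
    generalize r k = i
    rw [hval, show ((i : ℕ) : ℤ) + q * (N + 1 : ℕ) + (N + 1 : ℕ)
      = ((i : ℕ) : ℤ) + (q + 1) * (N + 1 : ℕ) by ring, hval]
    push_cast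
    ring
  · simpa using hval i 0

@[to_additive]
theorem prod_range_add_of_periodic {M : Type*} [CommMonoid M] {n : ℕ} {F : ℤ → M}
    (hF : ∀ k, F (k + n) = F k) (i : ℤ) :
    ∏ l ∈ Finset.range n, F (i + l) = ∏ l ∈ Finset.range n, F l := by
  rcases n with _ | n
  · simp
  have hstep : ∀ i : ℤ, ∏ l ∈ Finset.range (n + 1), F (i + 1 + l)
      = ∏ l ∈ Finset.range (n + 1), F (i + l) := by
    intro i
    rw [Finset.prod_range_succ, Finset.prod_range_succ']
    congr 1
    · refine Finset.prod_congr rfl fun l _ => ?_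
      congr 1; push_cast; ring
    · have := hF i
      rw [Nat.cast_zero, add_zero, ← this]
      congr 1; push_cast; ring
  induction i using Int.induction_on with
  | zero => simp
  | succ i ih => rw [hstep, ih]
  | pred i ih => rw [← ih, ← hstep]; simp

theorem sum_range_add_of_quasiPeriodic {n : ℕ} (hn : 0 < n) {Θ : ℤ → ℝ}
    (hΘ : ∀ k, Θ (k + n) = Θ k + π) (m : ℤ) :
    ∑ l ∈ Finset.range n, Θ (m + l) = ∑ l ∈ Finset.range n, Θ l + m * π := by
  have hn' : (n : ℝ) ≠ 0 := by exact_mod_cast hn.ne'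
  have h := sum_range_add_of_periodic (F := fun k => Θ k - k * (π / n)) (n := n) (fun k => by
    rw [hΘ]; push_cast; field_simp; ring) m
  simp only [Finset.sum_sub_distrib, Int.cast_add, add_mul, Finset.sum_add_distrib,
    Finset.sum_const, Finset.card_range, nsmul_eq_mul] at h
  have h2 : (n : ℝ) * (m * (π / n)) = m * π := by field_simp
  linarith

theorem exists_least_ge_of_quasiPeriodic {n : ℕ} {Θ : ℤ → ℝ} (hm : Monotone Θ)
    (hΘ : ∀ k, Θ (k + n) = Θ k + π) (a : ℝ) :
    ∃ i : ℤ, (∀ l : ℕ, a ≤ Θ (i + l)) ∧ ∀ l : ℕ, l < n → Θ (i + l) < a + π := by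
  have hiter : ∀ q : ℤ, Θ (q * n) = Θ 0 + q * π := by
    intro q
    induction q using Int.induction_on with
    | zero => simp
    | succ q ih => rw [add_mul, one_mul, hΘ, ih]; push_cast; ring
    | pred q ih =>
      have := hΘ ((-q - 1) * n)
      rw [show (-(q : ℤ) - 1) * n + n = -q * n by ring, ih] at this
      push_cast at this ⊢
      linarith
  obtain ⟨i, hi, hmin⟩ := Int.exists_least_of_bdd (P := fun i => a ≤ Θ i) (by
    obtain ⟨q, hq⟩ := exists_int_lt ((a - Θ 0) / π)
    refine ⟨q * n, fun z hz => ?_⟩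
    by_contra hlt
    have h1 := hm (not_le.1 hlt).le
    rw [hiter] at h1
    rw [lt_div_iff₀ pi_pos] at hq
    linarith) (by
    obtain ⟨q, hq⟩ := exists_int_gt ((a - Θ 0) / π)
    refine ⟨q * n, ?_⟩
    rw [hiter]
    rw [div_lt_iff₀ pi_pos] at hq
    linarith)
  refine ⟨i, fun l => hi.trans (hm (by omega)), fun l hl => ?_⟩
  have h1 : Θ (i - 1) < a := by
    by_contra h
    have := hmin _ (not_lt.1 h)
    omega
  have h2 := hΘ (i - 1)
  have h3 : Θ (i + l) ≤ Θ (i - 1 + n) := hm (by omega)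
  linarith

theorem exists_shift_of_prod_eq {n : ℕ} (hn : 0 < n) {Φ Ψ : ℤ → ℝ} (hΦ : Monotone Φ)
    (hΨ : Monotone Ψ) (hΦp : ∀ k, Φ (k + n) = Φ k + π) (hΨp : ∀ k, Ψ (k + n) = Ψ k + π)
    (h : ∏ i : Fin n, (X - C (circlePt (Φ ((i : ℕ) : ℤ))))
      = ∏ i : Fin n, (X - C (circlePt (Ψ ((i : ℕ) : ℤ))))) : ∃ m : ℤ, ∀ k, Φ k = Ψ (k + m) := by
  obtain ⟨i, hi1, hi2⟩ := exists_least_ge_of_quasiPeriodic hΦ hΦp 0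
  obtain ⟨j, hj1, hj2⟩ := exists_least_ge_of_quasiPeriodic hΨ hΨp 0
  have hper : ∀ {Θ : ℤ → ℝ}, (∀ k, Θ (k + n) = Θ k + π) → ∀ i : ℤ,
      ∏ l : Fin n, (X - C (circlePt (Θ (i + (l : ℕ)))))
        = ∏ l : Fin n, (X - C (circlePt (Θ ((l : ℕ) : ℤ)))) := by
    intro Θ hΘ i
    rw [Fin.prod_univ_eq_prod_range (fun l => X - C (circlePt (Θ (i + (l : ℕ))))),
      Fin.prod_univ_eq_prod_range (fun l => X - C (circlePt (Θ (l : ℕ))))]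
    refine prod_range_add_of_periodic (F := fun k => X - C (circlePt (Θ k))) (fun k => ?_) i
    have := circlePt_add_int_mul_pi (Θ k) 1
    rw [Int.cast_one, one_mul] at this
    rw [hΘ, this]
  rw [← hper hΦp i, ← hper hΨp j] at h
  obtain ⟨σ, hσ⟩ := exists_perm_of_prod_X_sub_C_eq h
  have hσ' : ∀ l : Fin n, Ψ (j + (σ l : ℕ)) = Φ (i + (l : ℕ)) := by
    intro l
    obtain ⟨m, hm⟩ := circlePt_eq_iff.1 (hσ l)
    have h1 := hi1 l
    have h2 := hi2 l l.2
    have h3 := hj1 (σ l)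
    have h4 := hj2 (σ l) (σ l).2
    have h5 : (m : ℝ) < 1 := by nlinarith [pi_pos]
    have h6 : (-1 : ℝ) < m := by nlinarith [pi_pos]
    have hm0 : m = 0 := by
      have h7 : m < 1 := by exact_mod_cast h5
      have h8 : -1 < m := by exact_mod_cast h6
      omega
    simpa [hm0] using hm
  have heq := Tuple.unique_monotone (f := fun l : Fin n => Ψ (j + (l : ℕ))) (σ := σ) (τ := 1)
    (fun a b hab => by
      simp only [Function.comp, hσ']
      exact hΦ (by have : (a : ℕ) ≤ b := hab; omega))
    (fun a b hab => hΨ (by have : (a : ℕ) ≤ b := hab; simp; omega))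
  have heq' : ∀ l : ℕ, l < n → Φ (i + l) = Ψ (j + l) := by
    intro l hl
    have := congrFun heq ⟨l, hl⟩
    simp only [Function.comp, hσ'] at this
    exact this
  have hn' : (0 : ℤ) < n := by exact_mod_cast hn
  have hshift : ∀ {Θ : ℤ → ℝ}, (∀ k, Θ (k + n) = Θ k + π) → ∀ k q : ℤ,
      Θ (k + q * n) = Θ k + q * π := by
    intro Θ hΘ k q
    induction q using Int.induction_on with
    | zero => simp
    | succ q ih => rw [add_mul, one_mul, ← add_assoc, hΘ, ih]; push_cast; ring
    | pred q ih =>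
      have := hΘ (k + (-q - 1) * n)
      rw [show k + (-(q : ℤ) - 1) * n + n = k + -q * n by ring, ih] at this
      push_cast at this ⊢
      linarith
  refine ⟨j - i, fun k => ?_⟩
  have h1 := Int.emod_nonneg (k - i) hn'.ne'
  have h2 := Int.emod_lt_of_pos (k - i) hn'
  obtain ⟨l, hl⟩ := Int.eq_ofNat_of_zero_le h1
  have h3 := heq' l (by omega)
  have h4 : k = i + l + ((k - i) / n) * n := by
    have := Int.emod_add_mul_ediv (k - i) n
    rw [← hl]; linarith
  rw [show k + (j - i) = j + l + ((k - i) / n) * n by linarith]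
  nth_rewrite 1 [h4]
  rw [hshift hΦp, hshift hΨp, h3]

end QuasiPeriodic

section Necessity

open Polynomial

/-- The half-angles of the diagonal entries of `deltaMatrix ξ`. -/
noncomputable def alcoveAngle {n : ℕ} (ξ : Fin n → ℝ) (k : Fin n) : ℝ :=
  (∑ j : Fin n, (((j : ℕ) : ℝ) + 1) * ξ j) / (n : ℝ) + ∑ j with j < k, ξ j

theorem alcoveAngle_succ {N : ℕ} (ξ : Fin (N + 1) → ℝ) (k : Fin N) :
    alcoveAngle ξ k.succ = alcoveAngle ξ k.castSucc + ξ k.castSucc := by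
  have h : (Finset.univ.filter fun j => j < k.succ)
      = insert k.castSucc (Finset.univ.filter fun j => j < k.castSucc) := by
    ext j
    simp [Fin.lt_def, Fin.ext_iff]
    omega
  rw [alcoveAngle, alcoveAngle, h, Finset.sum_insert (by simp)]
  ring

theorem alcoveAngle_last {N : ℕ} (ξ : Fin (N + 1) → ℝ) :
    alcoveAngle ξ (Fin.last N) + ξ (Fin.last N) = alcoveAngle ξ 0 + ∑ i, ξ i := by
  have h : (Finset.univ : Finset (Fin (N + 1)))
      = insert (Fin.last N) (Finset.univ.filter fun j => j < Fin.last N) := by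
    ext j
    simp [Fin.lt_def, Fin.ext_iff]
    omega
  have h0 : (Finset.univ.filter fun j : Fin (N + 1) => j < 0) = ∅ := by
    ext j; simp
  have h1 : ∑ i, ξ i = ξ (Fin.last N) + ∑ j with j < Fin.last N, ξ j := by
    conv_lhs => rw [h]
    rw [Finset.sum_insert (by simp)]
  rw [h1, alcoveAngle, alcoveAngle, h0]
  simp
  ring

theorem isAngleWindow_alcoveAngle {N : ℕ} {ξ : Fin (N + 1) → ℝ} (hξ : ξ ∈ alcove (N + 1)) :
    IsAngleWindow (alcoveAngle ξ) := by
  constructor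
  · refine Fin.monotone_iff_le_succ.2 fun k => ?_
    rw [alcoveAngle_succ]
    linarith [hξ.2 k.castSucc]
  · have := alcoveAngle_last ξ
    rw [hξ.1] at this
    linarith [hξ.2 (Fin.last N)]

theorem quasiPeriodic_alcoveAngle_gap {N : ℕ} {ξ : Fin (N + 1) → ℝ} (hξ : ξ ∈ alcove (N + 1))
    {Θ : ℤ → ℝ} (hp : ∀ k, Θ (k + (N + 1 : ℕ)) = Θ k + π)
    (hΘ : ∀ i : Fin (N + 1), Θ ((i : ℕ) : ℤ) = alcoveAngle ξ i) (l : Fin (N + 1)) :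
    Θ ((l : ℕ) + 1) - Θ ((l : ℕ) : ℤ) = ξ l ∧ Θ ((l : ℕ) + 2) - Θ ((l : ℕ) + 1) = ξ (l + 1) := by
  have hgap : ∀ l : Fin (N + 1), Θ ((l : ℕ) + 1) - Θ ((l : ℕ) : ℤ) = ξ l := by
    intro l
    refine Fin.lastCases ?_ (fun l => ?_) l
    · have h1 := alcoveAngle_last ξ
      have h2 := hp 0
      have h3 := hΘ 0
      rw [hξ.1] at h1
      rw [hΘ (Fin.last N), Fin.val_last]
      rw [zero_add] at h2
      simp only [Fin.val_zero, Nat.cast_zero] at h3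
      rw [h3] at h2
      push_cast at h2
      rw [h2]
      linarith
    · have h1 := hΘ l.succ
      have h3 := hΘ l.castSucc
      rw [alcoveAngle_succ] at h1
      simp only [Fin.val_succ, Nat.cast_add, Nat.cast_one, Fin.val_castSucc] at h1 h3 ⊢
      rw [h1, h3]
      ring
  refine ⟨hgap l, ?_⟩
  have h := hgap (l + 1)
  rw [← h]
  refine Fin.lastCases ?_ (fun l => ?_) l
  · have h1 := hp 0
    have h2 := hp 1
    simp only [Fin.last_add_one, Fin.val_zero, Fin.val_last]
    rw [zero_add] at h1
    rw [add_comm 1] at h2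
    push_cast at h1 h2 ⊢
    rw [h1, show (N : ℤ) + 2 = N + 1 + 1 by ring, h2]
    simp
  · rw [Fin.coeSucc_eq_succ]
    simp only [Fin.val_succ, Fin.val_castSucc, Nat.cast_add, Nat.cast_one]
    rw [show ((l : ℕ) : ℤ) + 2 = l + 1 + 1 by ring]

theorem gap_bounds_of_secularPoly_eq {N : ℕ} {ξ : Fin (N + 1) → ℝ} (hξ : ξ ∈ alcove (N + 1))
    {y : ℝ} (hy₁ : π < (N + 1 : ℕ) * y) (hy₂ : (N + 1 : ℕ) * y < 2 * π) {w : Fin (N + 1) → ℝ}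
    (hw : ∀ k, 0 ≤ w k) (hw1 : ∑ k, w k = 1)
    (h : ∏ k, (X - C (circlePt (alcoveAngle ξ k - y))) =
      secularPoly (fun k => circlePt (alcoveAngle ξ k)) (fun k => (w k : ℂ))
        (circlePt (-((N + 1 : ℕ) * y)))) (l : Fin (N + 1)) :
    ξ l ≤ y ∧ y ≤ ξ l + ξ (l + 1) := by
  have hwin := isAngleWindow_alcoveAngle hξ
  set τ := (N + 1 : ℕ) * y - π with hτ
  have ht : circlePt (-((N + 1 : ℕ) * y)) = circlePt (-τ) :=
    circlePt_eq_iff.2 ⟨-1, by rw [hτ]; push_cast; ring⟩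
  rw [ht] at h
  obtain ⟨φ, hI, hφ⟩ := exists_interlacing hwin hw hw1 (τ := τ) (by linarith) (by linarith)
  have hsum := hI.sum_sub_eq hw1 (by linarith) (by linarith) hφ
  have hwinφ : IsAngleWindow φ := by
    constructor
    · exact Fin.monotone_iff_le_succ.2 fun k => (hI.1 _).trans (hI.2.1 k)
    · linarith [hI.1 (Fin.last N), hI.2.2]
  obtain ⟨Θ, hΘm, hΘp, hΘ⟩ := exists_quasiPeriodic_extension hwin
  obtain ⟨Φ, hΦm, hΦp, hΦ⟩ := exists_quasiPeriodic_extension hwinφ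
  have hyp : ∀ k, Θ (k + (N + 1 : ℕ)) - y = Θ k - y + π := fun k => by rw [hΘp]; ring
  obtain ⟨m, hm⟩ := exists_shift_of_prod_eq (Ψ := fun k => Θ k - y) N.succ_pos hΦm
    (fun a b hab => sub_le_sub_right (hΘm hab) y) hΦp hyp (by
      simp only [hΦ, hΘ]
      rw [h, hφ])
  have hsumθ : ∑ k, alcoveAngle ξ k = ∑ l ∈ Finset.range (N + 1), Θ l := by
    rw [← Fin.sum_univ_eq_sum_range (fun l => Θ (l : ℤ))]
    simp only [hΘ]
  have hsumφ : ∑ k, φ k = ∑ l ∈ Finset.range (N + 1), Θ l + m * π - (N + 1 : ℕ) * y := by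
    rw [← sum_range_add_of_quasiPeriodic N.succ_pos hΘp m]
    have h1 : ∑ k, φ k = ∑ l ∈ Finset.range (N + 1), Φ l := by
      rw [← Fin.sum_univ_eq_sum_range (fun l => Φ (l : ℤ))]
      simp only [hΦ]
    rw [h1]
    simp only [hm, Finset.sum_sub_distrib, add_comm m]
    simp
  have hm1 : m = 1 := by
    have h1 : (m : ℝ) * π = 1 * π := by linarith
    have h2 := mul_right_cancel₀ pi_ne_zero h1
    exact_mod_cast h2
  subst hm1
  obtain ⟨hg1, hg2⟩ := quasiPeriodic_alcoveAngle_gap hξ hΘp hΘ l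
  have hA : Φ ((l : ℕ) : ℤ) ≤ Θ ((l : ℕ) : ℤ) := by
    rw [hΦ, hΘ]; exact hI.1 l
  have hB : Θ ((l : ℕ) : ℤ) ≤ Φ ((l : ℕ) + 1) := by
    refine Fin.lastCases ?_ (fun l => ?_) l
    · rw [hΘ]
      have h1 := hΦp 0
      have h2 := hΦ 0
      simp only [Fin.val_zero, Nat.cast_zero] at h2
      rw [zero_add, h2] at h1
      push_cast at h1
      rw [Fin.val_last, h1]
      linarith [hI.2.2]
    · have h1 := hΦ l.succ
      have h2 := hΘ l.castSucc
      simp only [Fin.val_succ, Nat.cast_add, Nat.cast_one, Fin.val_castSucc] at h1 h2 ⊢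
      rw [h1, h2]
      exact hI.2.1 l
  rw [hm] at hA hB
  rw [show ((l : ℕ) : ℤ) + 1 + 1 = l + 2 by ring] at hB
  constructor <;> linarith

end Necessity

section Sufficiency

open Polynomial

theorem continuous_alcoveAngle {n : ℕ} (k : Fin n) :
    Continuous fun ξ : Fin n → ℝ => alcoveAngle ξ k := by
  unfold alcoveAngle; fun_prop

/-- The weights for which the secular polynomial at `θ` has the half-angles `θ k - y` as zeros. -/
noncomputable def residueWeight {ι : Type*} [Fintype ι] [DecidableEq ι] (θ : ι → ℝ) (y : ℝ)
    (k : ι) : ℝ :=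
  sin y / sin (Fintype.card ι * y) *
    ∏ j ∈ Finset.univ.erase k, sin (θ k - θ j + y) / sin (θ k - θ j)

theorem secularPoly_residueWeight {ι : Type*} [Fintype ι] [DecidableEq ι] {θ : ι → ℝ} {y : ℝ}
    (hθ : ∀ k j, j ≠ k → sin (θ k - θ j) ≠ 0) (hy : sin (Fintype.card ι * y) ≠ 0) :
    secularPoly (fun k => circlePt (θ k)) (fun k => (residueWeight θ y k : ℂ))
      (circlePt (-(Fintype.card ι * y))) = ∏ k, (X - C (circlePt (θ k - y))) := by
  have hinj : Function.Injective fun k => circlePt (θ k) := by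
    intro i j hij
    by_contra hne
    refine hθ i j (Ne.symm hne) ?_
    obtain ⟨m, hm⟩ := circlePt_eq_iff.1 hij
    rw [hm, add_sub_cancel_left]
    exact sin_int_mul_pi m
  refine secularPoly_eq_prod_of_eval_eq hinj fun k => ?_
  have hw : sin (Fintype.card ι * y) * (residueWeight θ y k *
      ∏ j ∈ Finset.univ.erase k, sin (θ k - θ j)) =
      sin y * ∏ j ∈ Finset.univ.erase k, sin (θ k - θ j + y) := by
    have h0 : ∏ j ∈ Finset.univ.erase k, sin (θ k - θ j) ≠ 0 :=
      Finset.prod_ne_zero_iff.2 fun j hj => hθ k j (Finset.mem_erase.1 hj).1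
    rw [residueWeight, Finset.prod_div_distrib]
    field_simp
  have hwC : ((sin (Fintype.card ι * y) : ℝ) : ℂ) * ((residueWeight θ y k : ℂ) *
      ∏ j ∈ Finset.univ.erase k, ((sin (θ k - θ j) : ℝ) : ℂ)) =
      ((sin y : ℝ) : ℂ) * ∏ j ∈ Finset.univ.erase k, ((sin (θ k - θ j + y) : ℝ) : ℂ) := by
    exact_mod_cast congrArg (fun x : ℝ => (x : ℂ)) hw
  set a : ι → ℂ := fun j => Complex.exp (Complex.I * (θ k + θ j)) * (2 * Complex.I) with ha
  have h1 : ∀ j, circlePt (θ k) - circlePt (θ j) = a j * ((sin (θ k - θ j) : ℝ) : ℂ) := fun j =>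
    circlePt_sub _ _
  have h2 : ∀ j, circlePt (θ k) - circlePt (θ j - y)
      = Complex.exp (-(Complex.I * y)) * (a j * ((sin (θ k - θ j + y) : ℝ) : ℂ)) := by
    intro j
    have h5 : Complex.exp (Complex.I * (θ k + (θ j - y : ℝ))) =
        Complex.exp (-(Complex.I * y)) * Complex.exp (Complex.I * (θ k + θ j)) := by
      rw [← Complex.exp_add]; push_cast; ring_nf
    rw [circlePt_sub, ha, h5, show θ k - (θ j - y) = θ k - θ j + y by ring]
    ring
  have h3 : circlePt (-(Fintype.card ι * y)) - 1 = -(Complex.exp (-(Complex.I * y)) ^ (Fintype.card ι)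
      * (2 * Complex.I) * ((sin (Fintype.card ι * y) : ℝ) : ℂ)) := by
    rw [← circlePt_zero, circlePt_sub, ← Complex.exp_nat_mul, sub_zero, sin_neg]
    push_cast
    rw [add_zero]
    ring_nf
  have h4 : a k = circlePt (θ k) * (2 * Complex.I) := by
    rw [ha, circlePt]
    ring_nf
  have hprod0 : ∏ j, (circlePt (θ k) - circlePt (θ j)) = 0 :=
    Finset.prod_eq_zero (Finset.mem_univ k) (sub_self _)
  have hsum : ∑ i, (residueWeight θ y i : ℂ) * circlePt (θ i) *
      ∏ j ∈ Finset.univ.erase i, (circlePt (θ k) - circlePt (θ j))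
      = (residueWeight θ y k : ℂ) * circlePt (θ k) *
      ∏ j ∈ Finset.univ.erase k, (circlePt (θ k) - circlePt (θ j)) := by
    refine Finset.sum_eq_single k (fun i _ hi => ?_) (by simp)
    rw [Finset.prod_eq_zero (Finset.mem_erase.2 ⟨hi.symm, Finset.mem_univ k⟩) (sub_self _), mul_zero]
  have hcard : Complex.exp (-(Complex.I * y)) ^ (Fintype.card ι) = Complex.exp (-(Complex.I * y)) *
      Complex.exp (-(Complex.I * y)) ^ (Finset.univ.erase k).card := by
    rw [← pow_succ', Finset.card_erase_add_one (Finset.mem_univ k), Finset.card_univ]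
  rw [eval_secularPoly, hprod0, hsum, eval_prod]
  simp only [eval_sub, eval_X, eval_C]
  rw [← Finset.mul_prod_erase _ _ (Finset.mem_univ k), h2 k, h3]
  simp only [h1, h2, Finset.prod_mul_distrib, Finset.prod_const]
  rw [hcard, sub_self, zero_add, h4]
  linear_combination (Complex.exp (-(Complex.I * y)) *
    Complex.exp (-(Complex.I * y)) ^ (Finset.univ.erase k).card * (2 * Complex.I) *
    circlePt (θ k) * ∏ j ∈ Finset.univ.erase k, a j) * hwC

theorem sum_residueWeight {ι : Type*} [Fintype ι] [DecidableEq ι] {θ : ι → ℝ} {y : ℝ}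
    (hθ : ∀ k j, j ≠ k → sin (θ k - θ j) ≠ 0) (hy : sin (Fintype.card ι * y) ≠ 0) :
    ∑ k, residueWeight θ y k = 1 := by
  have h := congrArg (eval 0) (secularPoly_residueWeight hθ hy)
  rw [eval_secularPoly, eval_prod] at h
  simp only [zero_sub, eval_sub, eval_X, eval_C] at h
  have hk : ∀ k, (residueWeight θ y k : ℂ) * circlePt (θ k) *
      ∏ j ∈ Finset.univ.erase k, -circlePt (θ j)
      = -(residueWeight θ y k * ∏ j, -circlePt (θ j)) := by
    intro k
    rw [← Finset.mul_prod_erase _ (fun j => -circlePt (θ j)) (Finset.mem_univ k)]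
    ring
  have hc : ∏ k, -circlePt (θ k - y)
      = circlePt (-(Fintype.card ι * y)) * ∏ k, -circlePt (θ k) := by
    have : circlePt (-(Fintype.card ι * y)) = ∏ _k : ι, circlePt (-y) := by
      rw [← circlePt_sum]; simp
    rw [this, ← Finset.prod_mul_distrib]
    refine Finset.prod_congr rfl fun k _ => ?_
    rw [sub_eq_add_neg, circlePt_add]; ring
  have hP : ∏ k, -circlePt (θ k) ≠ 0 :=
    Finset.prod_ne_zero_iff.2 fun k _ => neg_ne_zero.2 (circlePt_ne_zero _)
  rw [Finset.sum_congr rfl fun k _ => hk k, Finset.sum_neg_distrib, ← Finset.sum_mul, hc] at h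
  have ht : circlePt (-(Fintype.card ι * y)) - 1 ≠ 0 := by
    rw [← circlePt_zero, circlePt_sub, sub_zero, sin_neg]
    refine mul_ne_zero (mul_ne_zero (Complex.exp_ne_zero _) (by simp)) ?_
    exact_mod_cast neg_ne_zero.2 hy
  have h5 : ∑ k, (residueWeight θ y k : ℂ) = 1 := by
    apply mul_left_cancel₀ (mul_ne_zero ht hP)
    linear_combination h
  exact_mod_cast h5

theorem alcoveAngle_strictMono {N : ℕ} {ξ : Fin (N + 1) → ℝ} (hξ : ∀ k, 0 < ξ k) :
    StrictMono (alcoveAngle ξ) := by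
  refine Fin.strictMono_iff_lt_succ.2 fun k => ?_
  rw [alcoveAngle_succ]
  linarith [hξ k.castSucc]

/-- The positively oriented half-angle from `θ k` to `θ j`, taken in `(0, π)`. -/
theorem exists_oriented_angle {N : ℕ} {ξ : Fin (N + 1) → ℝ} (hξ : ξ ∈ alcove (N + 1))
    (hpos : ∀ k, 0 < ξ k) {k j : Fin (N + 1)} (hjk : j ≠ k) :
    ∃ D, 0 < D ∧ D < π ∧ (∀ y, sin (alcoveAngle ξ k - alcoveAngle ξ j + y) /
      sin (alcoveAngle ξ k - alcoveAngle ξ j) = sin (D - y) / sin D) ∧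
      (j = k + 1 → D = ξ k) ∧ (j ≠ k + 1 → ξ k + ξ (k + 1) ≤ D) := by
  obtain ⟨Θ, hm, hp, hΘ⟩ := exists_quasiPeriodic_extension (isAngleWindow_alcoveAngle hξ)
  obtain ⟨hg1, hg2⟩ := quasiPeriodic_alcoveAngle_gap hξ hp hΘ k
  have hs := alcoveAngle_strictMono hpos
  have hlast := alcoveAngle_last ξ
  rw [hξ.1] at hlast
  have hl := hpos (Fin.last N)
  have hlt : ∀ i j : Fin (N + 1), alcoveAngle ξ i - alcoveAngle ξ j < π := fun i j => by
    have h1 := hs.monotone (Fin.le_last i)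
    have h2 := hs.monotone (Fin.zero_le j)
    linarith
  have hk1 : ((k + 1 : Fin (N + 1)) : ℕ) = if k = Fin.last N then 0 else (k : ℕ) + 1 :=
    Fin.val_add_one k
  have hk := k.2
  have hj := j.2
  rcases lt_or_gt_of_ne hjk with hlt' | hgt
  · refine ⟨alcoveAngle ξ j + π - alcoveAngle ξ k, by linarith [hlt k j], by linarith [hs hlt'], ?_,
      fun h => ?_, fun h => ?_⟩
    · intro y
      rw [show alcoveAngle ξ j + π - alcoveAngle ξ k - y
          = π - (alcoveAngle ξ k - alcoveAngle ξ j + y) by ring, sin_pi_sub,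
        show alcoveAngle ξ j + π - alcoveAngle ξ k
          = π - (alcoveAngle ξ k - alcoveAngle ξ j) by ring, sin_pi_sub]
    · have hkl : k = Fin.last N := by
        by_contra hne
        rw [if_neg hne, ← h] at hk1
        have : (j : ℕ) < k := hlt'
        omega
      have hj0 : j = 0 := by
        rw [if_pos hkl, ← h] at hk1
        exact Fin.ext hk1
      rw [hj0, hkl]
      linarith
    · have h1 := hp ((j : ℕ) : ℤ)
      have hle : ((k : ℕ) : ℤ) + 2 ≤ ((j : ℕ) : ℤ) + (N + 1 : ℕ) := by
        by_contra hcon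
        have h2 : (j : ℕ) < k := hlt'
        have h3 : (j : ℕ) = 0 ∧ (k : ℕ) = N := by omega
        rw [if_pos (Fin.ext h3.2)] at hk1
        exact h (Fin.ext (h3.1.trans hk1.symm))
      have h2 := hm hle
      rw [h1, hΘ j] at h2
      rw [hΘ k] at hg1
      linarith
  · refine ⟨alcoveAngle ξ j - alcoveAngle ξ k, sub_pos.2 (hs hgt), hlt j k, ?_,
      fun h => ?_, fun h => ?_⟩
    · intro y
      rw [show alcoveAngle ξ k - alcoveAngle ξ j + y
          = -(alcoveAngle ξ j - alcoveAngle ξ k - y) by ring,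
        ← neg_sub (alcoveAngle ξ j), sin_neg, sin_neg, neg_div_neg_eq]
    · have hkl : k ≠ Fin.last N := by
        rintro rfl
        exact absurd (Fin.le_last j) (not_le.2 hgt)
      rw [if_neg hkl, ← h] at hk1
      rw [← hg1, ← hΘ j, hk1, hΘ k]
      push_cast
      rw [← hΘ k]
    · have hle : ((k : ℕ) : ℤ) + 2 ≤ ((j : ℕ) : ℤ) := by
        by_contra hcon
        have h2 : (k : ℕ) < j := hgt
        have hkl : k ≠ Fin.last N := by
          rintro rfl
          exact absurd (Fin.le_last j) (not_le.2 hgt)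
        rw [if_neg hkl] at hk1
        exact h (Fin.ext (by omega))
      have h2 := hm hle
      rw [hΘ j] at h2
      rw [hΘ k] at hg1
      linarith

theorem residueWeight_nonneg {N : ℕ} {ξ : Fin (N + 1) → ℝ} (hξ : ξ ∈ alcove (N + 1))
    (hpos : ∀ k, 0 < ξ k) (hN : 1 ≤ N) {y : ℝ} (hy₀ : 0 < y) (hyπ : y < π)
    (hy₁ : π < (N + 1 : ℕ) * y) (hy₂ : (N + 1 : ℕ) * y < 2 * π)
    (hbd : ∀ l, ξ l ≤ y ∧ y ≤ ξ l + ξ (l + 1)) (k : Fin (N + 1)) :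
    0 ≤ residueWeight (alcoveAngle ξ) y k := by
  have hsy := sin_pos_of_pos_of_lt_pi hy₀ hyπ
  have hsn : sin ((N + 1 : ℕ) * y) < 0 := by
    have h1 := sin_pos_of_pos_of_lt_pi (x := (N + 1 : ℕ) * y - π) (by linarith) (by linarith)
    rw [sin_sub_pi] at h1
    linarith
  rw [residueWeight, Fintype.card_fin]
  refine mul_nonneg_of_nonpos_of_nonpos (div_nonpos_of_nonneg_of_nonpos hsy.le hsn.le) ?_
  have hne : k + 1 ≠ k := by
    have : (1 : Fin (N + 1)) ≠ 0 := by
      intro h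
      have := congrArg Fin.val h
      rw [Fin.val_one'] at this
      rw [Nat.mod_eq_of_lt (by omega)] at this
      simp at this
    simpa using this
  rw [← Finset.mul_prod_erase _ _ (Finset.mem_erase.2 ⟨hne, Finset.mem_univ (k + 1)⟩)]
  refine mul_nonpos_of_nonpos_of_nonneg ?_ (Finset.prod_nonneg fun j hj => ?_)
  · obtain ⟨D, hD0, hDπ, hr, h1, -⟩ := exists_oriented_angle hξ hpos hne
    rw [hr]
    refine div_nonpos_of_nonpos_of_nonneg ?_ (sin_pos_of_pos_of_lt_pi hD0 hDπ).le
    exact sin_nonpos_of_nonpos_of_neg_pi_le (by linarith [h1 rfl, (hbd k).1]) (by linarith)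
  · rw [Finset.mem_erase, Finset.mem_erase] at hj
    obtain ⟨D, hD0, hDπ, hr, -, h2⟩ := exists_oriented_angle hξ hpos hj.2.1
    rw [hr]
    refine div_nonneg ?_ (sin_pos_of_pos_of_lt_pi hD0 hDπ).le
    exact sin_nonneg_of_nonneg_of_le_pi (by linarith [h2 hj.1, (hbd k).2]) (by linarith)

theorem exists_weights_of_pos {N : ℕ} {ξ : Fin (N + 1) → ℝ} (hξ : ξ ∈ alcove (N + 1))
    (hpos : ∀ k, 0 < ξ k) (hN : 1 ≤ N) {y : ℝ} (hy₀ : 0 < y) (hyπ : y < π)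
    (hy₁ : π < (N + 1 : ℕ) * y) (hy₂ : (N + 1 : ℕ) * y < 2 * π)
    (hbd : ∀ l, ξ l ≤ y ∧ y ≤ ξ l + ξ (l + 1)) :
    ∃ w : Fin (N + 1) → ℝ, (∀ k, 0 ≤ w k) ∧ ∑ k, w k = 1 ∧
      ∏ k, (X - C (circlePt (alcoveAngle ξ k - y))) =
      secularPoly (fun k => circlePt (alcoveAngle ξ k)) (fun k => (w k : ℂ))
        (circlePt (-((N + 1 : ℕ) * y))) := by
  have hθ : ∀ k j, j ≠ k → sin (alcoveAngle ξ k - alcoveAngle ξ j) ≠ 0 := by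
    intro k j hjk h0
    obtain ⟨D, hD0, hDπ, hr, -, -⟩ := exists_oriented_angle hξ hpos hjk
    have h1 := hr (D - π / 2)
    rw [h0, div_zero, sub_sub_cancel, sin_pi_div_two] at h1
    have h2 := sin_pos_of_pos_of_lt_pi hD0 hDπ
    have h3 := one_div_pos.2 h2
    linarith
  have hsn : sin (Fintype.card (Fin (N + 1)) * y) ≠ 0 := by
    have h1 := sin_pos_of_pos_of_lt_pi (x := (N + 1 : ℕ) * y - π) (by linarith) (by linarith)
    rw [sin_sub_pi] at h1
    rw [Fintype.card_fin]
    linarith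
  have h := secularPoly_residueWeight hθ hsn
  rw [Fintype.card_fin] at h
  exact ⟨residueWeight (alcoveAngle ξ) y,
    residueWeight_nonneg hξ hpos hN hy₀ hyπ hy₁ hy₂ hbd, sum_residueWeight hθ hsn, h.symm⟩

theorem exists_weights {N : ℕ} {ξ : Fin (N + 1) → ℝ} (hξ : ∑ i, ξ i = π) (hN : 3 ≤ N) {y : ℝ}
    (hy₁ : π < N * y) (hy₂ : ((N : ℝ) - 1) * y < π)
    (hbd : ∀ l, ξ l ≤ y ∧ y ≤ ξ l + ξ (l + 1)) :
    ∃ w : Fin (N + 1) → ℝ, (∀ k, 0 ≤ w k) ∧ ∑ k, w k = 1 ∧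
      ∏ k, (X - C (circlePt (alcoveAngle ξ k - y))) =
      secularPoly (fun k => circlePt (alcoveAngle ξ k)) (fun k => (w k : ℂ))
        (circlePt (-((N + 1 : ℕ) * y))) := by
  have hN' : (3 : ℝ) ≤ N := by exact_mod_cast hN
  have hy₀ : 0 < y := by
    by_contra h
    nlinarith [pi_pos]
  have hyπ : y < π := by nlinarith
  set ε : ℕ → ℝ := fun m => 1 / ((m : ℝ) + 1) with hε
  have hε0 : ∀ m, 0 < ε m := fun m => by positivity
  have hε1 : ∀ m, ε m ≤ 1 := fun m => by
    rw [hε]; simp only; rw [div_le_one (by positivity)]; linarith [(Nat.cast_nonneg m : (0:ℝ) ≤ m)]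
  have hεt : Filter.Tendsto ε Filter.atTop (nhds 0) := tendsto_one_div_add_atTop_nhds_zero_nat
  set c : ℝ := π / (N + 1) with hc
  have hcN : (N + 1) * c = π := by rw [hc]; field_simp
  have hc0 : 0 < c := by positivity
  set Ξ : ℕ → Fin (N + 1) → ℝ := fun m k => (1 - ε m) * ξ k + ε m * c with hΞ
  have hgen : ∀ m, ∃ w : Fin (N + 1) → ℝ, (∀ k, 0 ≤ w k) ∧ ∑ k, w k = 1 ∧
      ∏ k, (X - C (circlePt (alcoveAngle (Ξ m) k - y))) =
      secularPoly (fun k => circlePt (alcoveAngle (Ξ m) k)) (fun k => (w k : ℂ))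
        (circlePt (-((N + 1 : ℕ) * y))) := by
    intro m
    have h1 := hε0 m
    have h2 := sub_nonneg.2 (hε1 m)
    have hpos : ∀ k, 0 < Ξ m k := fun k => by
      have h3 : 0 ≤ ξ k := by linarith [(hbd k).2, (hbd (k + 1)).1]
      have := mul_nonneg h2 h3
      have := mul_pos h1 hc0
      simp only [hΞ]; linarith
    refine exists_weights_of_pos ⟨?_, fun k => (hpos k).le⟩ hpos (by omega) hy₀ hyπ ?_ ?_ ?_
    · simp only [hΞ, Finset.sum_add_distrib, ← Finset.mul_sum, hξ]
      simp
      linear_combination (ε m) * hcN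
    · push_cast; nlinarith
    · push_cast; nlinarith
    · intro l
      have hcy : c ≤ y := by nlinarith
      have hcy' : y ≤ c + c := by nlinarith
      have h3 := mul_le_mul_of_nonneg_left (hbd l).1 h2
      have h4 := mul_le_mul_of_nonneg_left (hbd l).2 h2
      have h5 := mul_le_mul_of_nonneg_left hcy h1.le
      have h6 := mul_le_mul_of_nonneg_left hcy' h1.le
      simp only [hΞ]
      constructor <;> linarith
  choose w hw hw1 hws using hgen
  have hΞt : Filter.Tendsto Ξ Filter.atTop (nhds ξ) := by
    refine tendsto_pi_nhds.2 fun k => ?_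
    have := ((hεt.const_sub 1).mul_const (ξ k)).add (hεt.mul_const c)
    simpa using this
  have hwb : ∀ m, w m ∈ Set.Icc (fun _ => (0 : ℝ)) (fun _ => 1) := fun m =>
    ⟨fun k => hw m k, fun k => by
      simp only
      rw [← hw1 m]
      exact Finset.single_le_sum (fun j _ => hw m j) (Finset.mem_univ k)⟩
  obtain ⟨w₀, -, s, hs, hlim⟩ := (isCompact_Icc (a := fun _ : Fin (N + 1) => (0 : ℝ))
    (b := fun _ => 1)).tendsto_subseq hwb
  have hlim' : ∀ k, Filter.Tendsto (fun m => w (s m) k) Filter.atTop (nhds (w₀ k)) :=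
    tendsto_pi_nhds.1 hlim
  have hΞs : ∀ k, Filter.Tendsto (fun m => alcoveAngle (Ξ (s m)) k) Filter.atTop
      (nhds (alcoveAngle ξ k)) := fun k =>
    ((continuous_alcoveAngle k).tendsto ξ).comp (hΞt.comp hs.tendsto_atTop)
  refine ⟨w₀, fun k => ge_of_tendsto' (hlim' k) fun m => hw (s m) k, ?_, ?_⟩
  · have h1 := tendsto_finsetSum (Finset.univ : Finset (Fin (N + 1))) fun k _ => hlim' k
    simp only [hw1] at h1
    exact tendsto_nhds_unique h1 tendsto_const_nhds
  · refine Polynomial.funext fun z => ?_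
    have hcp : ∀ {f : ℕ → ℝ} {x : ℝ}, Filter.Tendsto f Filter.atTop (nhds x) →
        Filter.Tendsto (fun m => circlePt (f m)) Filter.atTop (nhds (circlePt x)) := fun h =>
      (continuous_circlePt.tendsto _).comp h
    have hL : Filter.Tendsto (fun m => (∏ k, (X - C (circlePt (alcoveAngle (Ξ (s m)) k - y)))).eval z)
        Filter.atTop (nhds ((∏ k, (X - C (circlePt (alcoveAngle ξ k - y)))).eval z)) := by
      simp only [eval_prod, eval_sub, eval_X, eval_C]
      exact tendsto_finsetProd _ fun k _ => (hcp ((hΞs k).sub_const y)).const_sub z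
    have hR : Filter.Tendsto (fun m => (secularPoly (fun k => circlePt (alcoveAngle (Ξ (s m)) k))
        (fun k => (w (s m) k : ℂ)) (circlePt (-((N + 1 : ℕ) * y)))).eval z) Filter.atTop
        (nhds ((secularPoly (fun k => circlePt (alcoveAngle ξ k)) (fun k => (w₀ k : ℂ))
          (circlePt (-((N + 1 : ℕ) * y)))).eval z)) := by
      simp only [eval_secularPoly]
      refine (tendsto_finsetProd _ fun k _ => (hcp (hΞs k)).const_sub z).sub
        (Filter.Tendsto.const_mul _ (tendsto_finsetSum _ fun k _ => ?_))
      refine Filter.Tendsto.mul (Filter.Tendsto.mul ?_ (hcp (hΞs k)))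
        (tendsto_finsetProd _ fun j _ => (hcp (hΞs j)).const_sub z)
      exact (Complex.continuous_ofReal.tendsto _).comp (hlim' k)
    simp only [← hws] at hR
    exact tendsto_nhds_unique hL hR

theorem sum_alcoveAngle {n : ℕ} (hn : 0 < n) (ξ : Fin n → ℝ) :
    ∑ k, alcoveAngle ξ k = n * ∑ i, ξ i := by
  have hn' : (n : ℝ) ≠ 0 := by exact_mod_cast hn.ne'
  have h1 : ∑ k : Fin n, ∑ j with j < k, ξ j = ∑ j : Fin n, ((n : ℝ) - (j + 1)) * ξ j := by
    simp only [Finset.sum_filter]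
    rw [Finset.sum_comm]
    refine Finset.sum_congr rfl fun j _ => ?_
    rw [← Finset.sum_filter, Finset.sum_const, nsmul_eq_mul]
    have : (Finset.univ.filter fun k => j < k) = Finset.Ioi j := by ext; simp
    rw [this, Fin.card_Ioi]
    have hj := j.2
    rw [Nat.sub_sub, add_comm 1, Nat.cast_sub (by omega)]
    push_cast
    ring
  simp only [alcoveAngle]
  rw [Finset.sum_add_distrib, h1, Finset.sum_const, Finset.card_univ, Fintype.card_fin, nsmul_eq_mul,
    mul_div_cancel₀ _ hn', ← Finset.sum_add_distrib, Finset.mul_sum]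
  exact Finset.sum_congr rfl fun j _ => by ring

theorem mem_momentumPolytope_iff {n : ℕ} (hn : 0 < n) (y : ℝ) (ξ : Fin n → ℝ) :
    ξ ∈ momentumPolytope n y ↔ ξ ∈ alcove n ∧
      ∃ w : Fin n → ℝ, (∀ k, 0 ≤ w k) ∧ ∑ k, w k = 1 ∧
        ∏ k, (X - C (circlePt (alcoveAngle ξ k - y))) =
        secularPoly (fun k => circlePt (alcoveAngle ξ k)) (fun k => (w k : ℂ))
          (circlePt (-(n * y))) := by
  have h1 : ξ ∈ momentumPolytope n y ↔ ξ ∈ alcove n ∧ ∃ p ∈ commutatorLevel n y,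
      IsConj (p.2 : Matrix (Fin n) (Fin n) ℂ)
        (Matrix.diagonal fun k => circlePt (alcoveAngle ξ k)) := by
    constructor
    · rintro ⟨p, hp, hξ, hc⟩
      exact ⟨hξ, p, hp, hc⟩
    · rintro ⟨hξ, p, hp, hc⟩
      exact ⟨p, hp, hξ, hc⟩
  rw [h1]
  refine and_congr_right fun hξ => ?_
  rw [exists_commutatorLevel_isConj_iff hn y (d := fun k => circlePt (alcoveAngle ξ k))
    (fun k => exp_mul_I_mul_star (alcoveAngle ξ k))]
  · have e1 : Complex.exp (-(2 * Complex.I * y)) = circlePt (-y) := by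
      rw [circlePt]; push_cast; ring_nf
    have e2 : Complex.exp (-(2 * Complex.I * (n * y))) = circlePt (-(n * y)) := by
      rw [circlePt]; push_cast; ring_nf
    have e3 : ∀ x, circlePt (-y) * circlePt x = circlePt (x - y) := fun x => by
      rw [← circlePt_add]; ring_nf
    simp only [e1, e2, e3]
  · rw [← circlePt_sum, sum_alcoveAngle hn, hξ.1, ← circlePt_zero]
    exact circlePt_eq_iff.2 ⟨n, by simp⟩

theorem momentumPolytope_eq {n : ℕ} (hn : 4 ≤ n) {y : ℝ}
    (hy₁ : π / ((n : ℝ) - 1) < y) (hy₂ : y < π / ((n : ℝ) - 2)) :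
    momentumPolytope n y =
      {ξ | ∑ i, ξ i = π ∧ ∀ l, ξ l ≤ y ∧ y ≤ ξ l + ξ (finRotate n l)} := by
  obtain ⟨N, rfl⟩ : ∃ N, n = N + 1 := ⟨n - 1, by omega⟩
  have hN : (3 : ℝ) ≤ N := by exact_mod_cast (by omega : 3 ≤ N)
  push_cast at hy₁ hy₂
  rw [div_lt_iff₀ (by linarith)] at hy₁
  rw [lt_div_iff₀ (by linarith)] at hy₂
  have hy₀ : 0 < y := by
    by_contra h
    nlinarith [pi_pos]
  ext ξ
  rw [mem_momentumPolytope_iff (by omega)]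
  simp only [finRotate_apply, Set.mem_ofPred_eq]
  constructor
  · rintro ⟨hξ, w, hw, hw1, h⟩
    exact ⟨hξ.1, gap_bounds_of_secularPoly_eq hξ (by push_cast; nlinarith) (by push_cast; nlinarith)
      hw hw1 h⟩
  · rintro ⟨hξ, hbd⟩
    refine ⟨⟨hξ, fun k => by linarith [(hbd k).2, (hbd (k + 1)).1]⟩, ?_⟩
    exact exists_weights hξ (by omega) (by linarith) (by linarith) hbd

end Sufficiency

section GeneralPolytope

open Module

theorem vectorSpan_eq_of_forall_add_smul_mem {E : Type*} [AddCommGroup E] [Module ℝ E] {Q : Set E}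
    {p : E} (hp : p ∈ Q) {W : Submodule ℝ E} (hW : ∀ x ∈ Q, x - p ∈ W)
    (hd : ∀ d ∈ W, ∃ ε : ℝ, 0 < ε ∧ p + ε • d ∈ Q) : vectorSpan ℝ Q = W := by
  apply le_antisymm
  · rw [vectorSpan_eq_span_vsub_set_right ℝ hp, Submodule.span_le]
    rintro _ ⟨x, hx, rfl⟩
    exact hW x hx
  · intro d hdW
    obtain ⟨ε, hε, hmem⟩ := hd d hdW
    have h1 := vsub_mem_vectorSpan ℝ hmem hp
    rw [vsub_eq_sub, add_sub_cancel_left] at h1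
    have h2 := Submodule.smul_mem _ ε⁻¹ h1
    rwa [smul_smul, inv_mul_cancel₀ hε.ne', one_smul] at h2

theorem finrank_ker_inf_ker_add_one {E : Type*} [AddCommGroup E] [Module ℝ E]
    [FiniteDimensional ℝ E] (S L : E →ₗ[ℝ] ℝ) {u : E} (hS : S u = 0) (hL : L u ≠ 0) :
    finrank ℝ (S.ker ⊓ L.ker : Submodule ℝ E) + 1 = finrank ℝ S.ker := by
  have hne : L.domRestrict S.ker ≠ 0 := fun h => hL (LinearMap.congr_fun h ⟨u, hS⟩)
  rw [← Module.Dual.finrank_ker_add_one_of_ne_zero (f := L.domRestrict S.ker) hne]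
  have hmap : (S.ker ⊓ L.ker : Submodule ℝ E)
      = Submodule.map S.ker.subtype (L.domRestrict S.ker).ker := by
    ext x
    simp [and_comm]
  rw [hmap, Submodule.finrank_map_subtype_eq]

variable {n : ℕ} {κ : Type*}

/-- The polytope cut out of the hyperplane `S x = s` by the inequalities `L c x ≤ b c`. -/
def hPolytope (S : StrongDual ℝ (Fin n → ℝ)) (s : ℝ) (L : κ → StrongDual ℝ (Fin n → ℝ))
    (b : κ → ℝ) : Set (Fin n → ℝ) :=
  {x | S x = s ∧ ∀ c, L c x ≤ b c}

/-- The face of `hPolytope` on which the inequality `c` is an equality. -/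
def hFace (S : StrongDual ℝ (Fin n → ℝ)) (s : ℝ) (L : κ → StrongDual ℝ (Fin n → ℝ))
    (b : κ → ℝ) (c : κ) : Set (Fin n → ℝ) :=
  {x ∈ hPolytope S s L b | L c x = b c}

variable {S : StrongDual ℝ (Fin n → ℝ)} {s : ℝ} {L : κ → StrongDual ℝ (Fin n → ℝ)} {b : κ → ℝ}

theorem exists_pos_add_smul_mem_hPolytope [Finite κ] {p d : Fin n → ℝ} (hp : p ∈ hPolytope S s L b)
    (hS : S d = 0) (hd : ∀ c, L c p < b c ∨ L c d = 0) :
    ∃ ε : ℝ, 0 < ε ∧ p + ε • d ∈ hPolytope S s L b := by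
  have h1 : ∀ c, ∀ᶠ ε : ℝ in nhdsWithin 0 (Set.Ioi 0), L c (p + ε • d) ≤ b c := by
    intro c
    rcases hd c with h | h
    · have hc : Continuous fun ε : ℝ => L c (p + ε • d) := by fun_prop
      have h2 : ∀ᶠ ε : ℝ in nhds 0, L c (p + ε • d) < b c :=
        hc.continuousAt.eventually_lt continuousAt_const (by simpa using h)
      exact (h2.filter_mono nhdsWithin_le_nhds).mono fun _ h => h.le
    · refine Filter.Eventually.of_forall fun ε => ?_
      rw [map_add, map_smul, h, smul_zero, add_zero]
      exact hp.2 c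
  have h2 := (Filter.eventually_all.2 h1).and self_mem_nhdsWithin
  obtain ⟨ε, hε, hpos⟩ := h2.exists
  refine ⟨ε, hpos, ?_, hε⟩
  rw [map_add, map_smul, hS, smul_zero, add_zero]
  exact hp.1

theorem vectorSpan_hPolytope [Finite κ] {p : Fin n → ℝ} (hp : p ∈ hPolytope S s L b)
    (hlt : ∀ c, L c p < b c) : vectorSpan ℝ (hPolytope S s L b) = (S : (Fin n → ℝ) →ₗ[ℝ] ℝ).ker := by
  refine vectorSpan_eq_of_forall_add_smul_mem hp (fun x hx => ?_) fun d hd => ?_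
  · simp [hx.1, hp.1]
  · exact exists_pos_add_smul_mem_hPolytope hp (by simpa using hd) fun c => Or.inl (hlt c)

theorem vectorSpan_hFace [Finite κ] {c : κ} {p : Fin n → ℝ} (hp : p ∈ hFace S s L b c)
    (hlt : ∀ c', c' ≠ c → L c' p < b c') : vectorSpan ℝ (hFace S s L b c) =
      (S : (Fin n → ℝ) →ₗ[ℝ] ℝ).ker ⊓ (L c : (Fin n → ℝ) →ₗ[ℝ] ℝ).ker := by
  refine vectorSpan_eq_of_forall_add_smul_mem hp (fun x hx => ?_) fun d hd => ?_
  · simp [hx.1.1, hp.1.1, hx.2, hp.2]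
  · have hd1 : S d = 0 := hd.1
    have hd2 : L c d = 0 := hd.2
    obtain ⟨ε, hε, hmem⟩ := exists_pos_add_smul_mem_hPolytope hp.1 hd1 fun c' => by
      by_cases h : c' = c
      · exact Or.inr (h ▸ hd2)
      · exact Or.inl (hlt c' h)
    refine ⟨ε, hε, hmem, ?_⟩
    rw [map_add, map_smul, hd2, smul_zero, add_zero]
    exact hp.2

/-- A system of inequalities is facet-defining when it has a common strict solution, and every
inequality can be made an equality with all the others remaining strict. -/
structure IsFacetSystem (S : StrongDual ℝ (Fin n → ℝ)) (s : ℝ) (L : κ → StrongDual ℝ (Fin n → ℝ))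
    (b : κ → ℝ) : Prop where
  exists_interior : ∃ p ∈ hPolytope S s L b, ∀ c, L c p < b c
  exists_face_interior : ∀ c, ∃ p ∈ hFace S s L b c, ∀ c', c' ≠ c → L c' p < b c'

namespace IsFacetSystem

theorem affineDim_add_one [Finite κ] (h : IsFacetSystem S s L b) (hS : S ≠ 0) :
    affineDim (hPolytope S s L b) + 1 = n := by
  obtain ⟨p, hp, hlt⟩ := h.exists_interior
  rw [affineDim, vectorSpan_hPolytope hp hlt]
  have hne : (S : (Fin n → ℝ) →ₗ[ℝ] ℝ) ≠ 0 := fun h0 => hS (by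
    ext x
    exact LinearMap.congr_fun h0 _)
  rw [Module.Dual.finrank_ker_add_one_of_ne_zero (f := (S : (Fin n → ℝ) →ₗ[ℝ] ℝ)) hne]
  simp

theorem affineDim_hFace_add_one [Finite κ] (h : IsFacetSystem S s L b) (c : κ) :
    affineDim (hFace S s L b c) + 1 = affineDim (hPolytope S s L b) := by
  obtain ⟨p, hp, hlt⟩ := h.exists_interior
  obtain ⟨q, hq, hqlt⟩ := h.exists_face_interior c
  rw [affineDim, affineDim, vectorSpan_hPolytope hp hlt, vectorSpan_hFace hq hqlt]
  refine finrank_ker_inf_ker_add_one _ _ (u := q - p) ?_ ?_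
  · simp [hq.1.1, hp.1]
  · have := hlt c
    have h2 := hq.2
    simp only [ContinuousLinearMap.coe_coe, map_sub]
    linarith

theorem hFace_mem_facets [Finite κ] (h : IsFacetSystem S s L b) (c : κ) :
    hFace S s L b c ∈ polytopeFacets (hPolytope S s L b) := by
  obtain ⟨q, hq, -⟩ := h.exists_face_interior c
  refine ⟨⟨q, hq⟩, fun _ => ⟨L c, ?_⟩, h.affineDim_hFace_add_one c⟩
  ext x
  constructor
  · rintro ⟨hx, hxc⟩
    exact ⟨hx, fun z hz => hxc ▸ hz.2 c⟩
  · rintro ⟨hx, hmax⟩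
    exact ⟨hx, le_antisymm (hx.2 c) (hq.2 ▸ hmax q hq.1)⟩

theorem injective_hFace (h : IsFacetSystem S s L b) : Function.Injective (hFace S s L b) := by
  intro c c' hcc
  obtain ⟨q, hq, hlt⟩ := h.exists_face_interior c
  by_contra hne
  have h1 : q ∈ hFace S s L b c' := hcc ▸ hq
  exact (hlt c' (Ne.symm hne)).ne h1.2

theorem exists_subset_hFace [Fintype κ] [Nonempty κ]
    {F : Set (Fin n → ℝ)} (hF : F ∈ polytopeFacets (hPolytope S s L b)) :
    ∃ c, F ⊆ hFace S s L b c := by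
  obtain ⟨hne, hexp, hdim⟩ := hF
  by_contra! hcon
  have hconv : Convex ℝ (hPolytope S s L b) := by
    intro x hx z hz α β hα hβ hαβ
    refine ⟨?_, fun c => ?_⟩
    · rw [map_add, map_smul, map_smul, hx.1, hz.1, ← add_smul, hαβ, one_smul]
    · rw [map_add, map_smul, map_smul, smul_eq_mul, smul_eq_mul]
      have h1 := mul_le_mul_of_nonneg_left (hx.2 c) hα
      have h2 := mul_le_mul_of_nonneg_left (hz.2 c) hβ
      calc _ ≤ α * b c + β * b c := add_le_add h1 h2
        _ = b c := by rw [← add_mul, hαβ, one_mul]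
  have hFconv := hexp.convex hconv
  have hstrict : ∀ c, ∃ x ∈ F, L c x < b c := by
    intro c
    obtain ⟨x, hx, hx'⟩ := Set.not_subset.1 (hcon c)
    exact ⟨x, hx, lt_of_le_of_ne ((hexp.subset hx).2 c) fun he => hx' ⟨hexp.subset hx, he⟩⟩
  choose x hxF hxlt using hstrict
  have hcard : (0 : ℝ) < Fintype.card κ := by exact_mod_cast Fintype.card_pos
  set p := ∑ c, ((Fintype.card κ : ℝ)⁻¹) • x c with hp
  have hpF : p ∈ F := hFconv.sum_mem (fun _ _ => by positivity)
    (by simp [hcard.ne']) fun c _ => hxF c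
  have hpP := hexp.subset hpF
  have hplt : ∀ c, L c p < b c := by
    intro c
    have h1 : L c p = ∑ c', (Fintype.card κ : ℝ)⁻¹ * L c (x c') := by
      rw [hp, map_sum]; simp
    have h2 : ∑ c' : κ, (Fintype.card κ : ℝ)⁻¹ * b c = b c := by
      simp [hcard.ne']
    rw [h1, ← h2]
    refine Finset.sum_lt_sum (fun c' _ => ?_) ⟨c, Finset.mem_univ c, ?_⟩
    · exact mul_le_mul_of_nonneg_left ((hexp.subset (hxF c')).2 c) (by positivity)
    · exact mul_lt_mul_of_pos_left (hxlt c) (by positivity)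
  obtain ⟨f, hf⟩ := hexp hne
  have hpmax : ∀ z ∈ hPolytope S s L b, f z ≤ f p := by
    rw [hf] at hpF; exact hpF.2
  have hker : ∀ d, S d = 0 → f d ≤ 0 := by
    intro d hd
    obtain ⟨ε, hε, hmem⟩ := exists_pos_add_smul_mem_hPolytope hpP hd fun c => Or.inl (hplt c)
    have := hpmax _ hmem
    rw [map_add, map_smul, smul_eq_mul] at this
    by_contra hpos
    nlinarith [mul_pos hε (not_le.1 hpos)]
  have hall : F = hPolytope S s L b := by
    refine hexp.subset.antisymm fun z hz => ?_
    rw [hf]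
    refine ⟨hz, fun u hu => ?_⟩
    have := hker (u - z) (by rw [map_sub, hu.1, hz.1, sub_self])
    rw [map_sub] at this
    linarith
  rw [hall] at hdim
  omega

theorem facets_eq [Fintype κ] [Nonempty κ] (h : IsFacetSystem S s L b) :
    polytopeFacets (hPolytope S s L b) = Set.range (hFace S s L b) := by
  refine Set.Subset.antisymm (fun F hF => ?_) ?_
  · obtain ⟨c, hc⟩ := exists_subset_hFace hF
    refine ⟨c, ?_⟩
    obtain ⟨⟨x₀, hx₀⟩, hexp, hdim⟩ := hF
    have hspan : vectorSpan ℝ F = vectorSpan ℝ (hFace S s L b c) := by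
      refine Submodule.eq_of_le_of_finrank_eq (vectorSpan_mono ℝ hc) ?_
      have := h.affineDim_hFace_add_one c
      rw [← hdim] at this
      exact (Nat.add_right_cancel this).symm
    obtain ⟨f, hf⟩ := hexp ⟨x₀, hx₀⟩
    have hker : vectorSpan ℝ F ≤ (f : (Fin n → ℝ) →ₗ[ℝ] ℝ).ker := by
      rw [vectorSpan_eq_span_vsub_set_right ℝ hx₀, Submodule.span_le]
      rintro _ ⟨x, hx, rfl⟩
      rw [hf] at hx hx₀
      have h1 := le_antisymm (hx₀.2 x hx.1) (hx.2 x₀ hx₀.1)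
      simp [h1]
    refine Set.Subset.antisymm (fun x hx => ?_) hc
    have h1 : x -ᵥ x₀ ∈ vectorSpan ℝ F := by
      rw [hspan]
      exact vsub_mem_vectorSpan ℝ hx (hc hx₀)
    have h2 : f (x - x₀) = 0 := hker h1
    rw [map_sub, sub_eq_zero] at h2
    rw [hf] at hx₀ ⊢
    exact ⟨hx.1, fun z hz => h2 ▸ hx₀.2 z hz⟩
  · rintro _ ⟨c, rfl⟩
    exact h.hFace_mem_facets c

theorem ncard_facets [Fintype κ] [Nonempty κ] (h : IsFacetSystem S s L b) :
    (polytopeFacets (hPolytope S s L b)).ncard = Nat.card κ := by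
  rw [h.facets_eq, Set.ncard_range_of_injective h.injective_hFace]

theorem ncard_facets_mem [Fintype κ] [Nonempty κ] (h : IsFacetSystem S s L b) {v : Fin n → ℝ}
    (hv : v ∈ hPolytope S s L b) :
    {F ∈ polytopeFacets (hPolytope S s L b) | v ∈ F}.ncard = {c | L c v = b c}.ncard := by
  have : {F ∈ polytopeFacets (hPolytope S s L b) | v ∈ F} = hFace S s L b '' {c | L c v = b c} := by
    rw [h.facets_eq]
    ext F
    constructor
    · rintro ⟨⟨c, rfl⟩, hF⟩
      exact ⟨c, hF.2, rfl⟩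
    · rintro ⟨c, hc, rfl⟩
      exact ⟨⟨c, rfl⟩, hv, hc⟩
  rw [this, Set.ncard_image_of_injective _ h.injective_hFace]

end IsFacetSystem

theorem mem_exposedPoints_hPolytope [Fintype κ] {v : Fin n → ℝ} (hv : v ∈ hPolytope S s L b)
    (h : ∀ x ∈ hPolytope S s L b, (∀ c, L c v = b c → L c x = b c) → x = v) :
    v ∈ (hPolytope S s L b).exposedPoints ℝ := by
  classical
  set T : Finset κ := Finset.univ.filter fun c => L c v = b c with hT
  have hle : ∀ x ∈ hPolytope S s L b, ∀ c ∈ T, L c x ≤ L c v := fun x hx c hc =>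
    (hx.2 c).trans (Finset.mem_filter.1 hc).2.ge
  refine ⟨hv, ∑ c ∈ T, L c, fun x hx => ⟨?_, fun hmax => h x hx fun c hc => ?_⟩⟩
  · simp only [sum_apply]
    exact Finset.sum_le_sum (hle x hx)
  · simp only [sum_apply] at hmax
    have heq := le_antisymm (Finset.sum_le_sum (hle x hx)) hmax
    rw [← hc]
    exact (Finset.sum_eq_sum_iff_of_le (hle x hx)).1 heq c (Finset.mem_filter.2 ⟨Finset.mem_univ c, hc⟩)

theorem eq_zero_of_mem_exposedPoints_hPolytope [Finite κ] {v d : Fin n → ℝ}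
    (hv : v ∈ (hPolytope S s L b).exposedPoints ℝ) (hS : S d = 0)
    (hd : ∀ c, L c v < b c ∨ L c d = 0) : d = 0 := by
  obtain ⟨hvP, f, hf⟩ := hv
  have key : ∀ d : Fin n → ℝ, S d = 0 → (∀ c, L c v < b c ∨ L c d = 0) →
      f d ≤ 0 ∧ (f d = 0 → d = 0) := by
    intro d hS hd
    obtain ⟨ε, hε, hmem⟩ := exists_pos_add_smul_mem_hPolytope hvP hS hd
    have h1 := hf _ hmem
    rw [map_add, map_smul, smul_eq_mul] at h1
    refine ⟨?_, fun h0 => ?_⟩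
    · by_contra hpos
      nlinarith [mul_pos hε (not_le.1 hpos)]
    · have h2 := h1.2 (by rw [h0]; simp)
      have h3 : ε • d = 0 := by simpa using h2
      exact (smul_eq_zero.1 h3).resolve_left hε.ne'
  have h1 := key d hS hd
  have h2 := key (-d) (by rw [map_neg, hS, neg_zero]) fun c => (hd c).imp_right fun h => by
    rw [map_neg, h, neg_zero]
  rw [map_neg] at h2
  exact h1.2 (le_antisymm h1.1 (by linarith [h2.1]))

end GeneralPolytope

section GapPolytope


/-- The sum of the components as a continuous linear functional. -/
noncomputable def sumFunctional (n : ℕ) : StrongDual ℝ (Fin n → ℝ) :=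
  ∑ i, ContinuousLinearMap.proj i

theorem sumFunctional_apply {n : ℕ} (ξ : Fin n → ℝ) : sumFunctional n ξ = ∑ i, ξ i := by
  simp [sumFunctional]

theorem sum_ite_three {ι : Type*} [Fintype ι] [DecidableEq ι] {a b c : ι} (hab : a ≠ b) (hac : a ≠ c)
    (hbc : b ≠ c) (A B C z : ℝ) :
    (∑ j, if j = a then A else if j = b then B else if j = c then C else z)
      = A + B + C + ((Fintype.card ι : ℝ) - 3) * z := by
  have h : ∀ j, (if j = a then A else if j = b then B else if j = c then C else z)
      = (if j = a then A - z else 0) + (if j = b then B - z else 0) + (if j = c then C - z else 0)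
        + z := by
    intro j
    by_cases h1 : j = a
    · subst h1; simp [hab, hac]
    · by_cases h2 : j = b
      · subst h2; simp [hbc, h1]
      · by_cases h3 : j = c
        · simp [h3, hac.symm, hbc.symm]
        · simp [h1, h2, h3]
  simp only [h, Finset.sum_add_distrib, Finset.sum_ite_eq', Finset.mem_univ, if_true,
    Finset.sum_const, Finset.card_univ, nsmul_eq_mul]
  ring

theorem sum_ite_two {ι : Type*} [Fintype ι] [DecidableEq ι] {a b : ι} (hab : a ≠ b) (A B z : ℝ) :
    (∑ j, if j = a then A else if j = b then B else z) = A + B + ((Fintype.card ι : ℝ) - 2) * z := by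
  have h : ∀ j, (if j = a then A else if j = b then B else z)
      = (if j = a then A - z else 0) + (if j = b then B - z else 0) + z := by
    intro j
    by_cases h1 : j = a
    · subst h1; simp [hab]
    · by_cases h2 : j = b
      · simp [h2, hab.symm]
      · simp [h1, h2]
  simp only [h, Finset.sum_add_distrib, Finset.sum_ite_eq', Finset.mem_univ, if_true,
    Finset.sum_const, Finset.card_univ, nsmul_eq_mul]
  ring

/-- The range of the parameter `y` in terms of `τ = n y - π`. -/
structure GapRange (n : ℕ) (y : ℝ) : Prop where
  four_le : 4 ≤ n
  lower : y < n * y - π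
  upper : n * y - π < 2 * y

theorem GapRange.of_div {n : ℕ} (hn : 4 ≤ n) {y : ℝ} (hy₁ : π / ((n : ℝ) - 1) < y)
    (hy₂ : y < π / ((n : ℝ) - 2)) : GapRange n y := by
  have hn' : (4 : ℝ) ≤ n := by exact_mod_cast hn
  rw [div_lt_iff₀ (by linarith)] at hy₁
  rw [lt_div_iff₀ (by linarith)] at hy₂
  exact ⟨hn, by linarith, by linarith⟩

theorem GapRange.pos {n : ℕ} {y : ℝ} (h : GapRange n y) : 0 < y := by linarith [h.lower, h.upper]

variable {n : ℕ} [NeZero n]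

/-- The polytope of all `ξ` with `∑ ξ = π`, `ξ l ≤ y` and `y ≤ ξ l + ξ (l + 1)`. -/
def gapPolytope (n : ℕ) [NeZero n] (y : ℝ) : Set (Fin n → ℝ) :=
  {ξ | ∑ i, ξ i = π ∧ ∀ l, ξ l ≤ y ∧ y ≤ ξ l + ξ (l + 1)}

/-- The functionals of the defining inequalities of `gapPolytope`. -/
noncomputable def gapFunctional (n : ℕ) [NeZero n] : Fin n ⊕ Fin n → StrongDual ℝ (Fin n → ℝ)
  | .inl l => ContinuousLinearMap.proj (R := ℝ) (φ := fun _ : Fin n => ℝ) l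
  | .inr l => -(ContinuousLinearMap.proj (R := ℝ) (φ := fun _ : Fin n => ℝ) l +
      ContinuousLinearMap.proj (R := ℝ) (φ := fun _ : Fin n => ℝ) (l + 1))

/-- The right-hand sides of the defining inequalities of `gapPolytope`. -/
def gapBound (n : ℕ) (y : ℝ) : Fin n ⊕ Fin n → ℝ
  | .inl _ => y
  | .inr _ => -y

theorem gapPolytope_eq_hPolytope (y : ℝ) :
    gapPolytope n y = hPolytope (sumFunctional n) π (gapFunctional n) (gapBound n y) := by
  ext ξ
  simp only [gapPolytope, hPolytope, Set.mem_ofPred_eq, sumFunctional_apply, Sum.forall,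
    gapFunctional, gapBound, forall_and]
  simp

theorem hFace_inl (y : ℝ) (l : Fin n) :
    hFace (sumFunctional n) π (gapFunctional n) (gapBound n y) (.inl l)
      = {ξ ∈ gapPolytope n y | ξ l = y} := by
  rw [gapPolytope_eq_hPolytope]; rfl

theorem hFace_inr (y : ℝ) (l : Fin n) :
    hFace (sumFunctional n) π (gapFunctional n) (gapBound n y) (.inr l)
      = {ξ ∈ gapPolytope n y | ξ l + ξ (l + 1) = y} := by
  rw [gapPolytope_eq_hPolytope]
  ext ξ
  simp only [hFace, Set.mem_ofPred_eq]
  refine and_congr_right fun _ => ?_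
  change -(ξ l + ξ (l + 1)) = -y ↔ _
  exact neg_inj

theorem Fin.val_add_one_eq_ite (hn : 2 ≤ n) (l : Fin n) :
    ((l + 1 : Fin n) : ℕ) = if (l : ℕ) + 1 = n then 0 else (l : ℕ) + 1 := by
  have hl := l.2
  rw [Fin.val_add, Fin.val_one', Nat.mod_eq_of_lt (show 1 < n by omega)]
  split_ifs with h
  · rw [h, Nat.mod_self]
  · exact Nat.mod_eq_of_lt (by omega)

theorem Fin.add_one_ne_self (hn : 4 ≤ n) (l : Fin n) : l + 1 ≠ l := by
  intro h
  have h1 := Fin.val_add_one_eq_ite (by omega) l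
  rw [h] at h1
  split_ifs at h1 <;> omega

theorem Fin.add_one_add_one_ne_self (hn : 4 ≤ n) (l : Fin n) : l + 1 + 1 ≠ l := by
  intro h
  have h1 := Fin.val_add_one_eq_ite (by omega) l
  have h2 := Fin.val_add_one_eq_ite (by omega) (l + 1)
  rw [h] at h2
  split_ifs at h1 h2 <;> omega

theorem Fin.add_one_add_one_add_one_ne_self (hn : 4 ≤ n) (l : Fin n) : l + 1 + 1 + 1 ≠ l := by
  intro h
  have h1 := Fin.val_add_one_eq_ite (by omega) l
  have h2 := Fin.val_add_one_eq_ite (by omega) (l + 1)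
  have h3 := Fin.val_add_one_eq_ite (by omega) (l + 1 + 1)
  rw [h] at h3
  split_ifs at h1 h2 h3 <;> omega

namespace GapRange

variable {y : ℝ}

theorem isFacetSystem (h : GapRange n y) :
    IsFacetSystem (sumFunctional n) π (gapFunctional n) (gapBound n y) := by
  have hn := h.four_le
  have hn' : (4 : ℝ) ≤ n := by exact_mod_cast hn
  have hy := h.pos
  have hlo := h.lower
  have hup := h.upper
  have hiff : ∀ {ξ : Fin n → ℝ} {c}, gapFunctional n c ξ < gapBound n y c ↔
      match c with
      | .inl l => ξ l < y
      | .inr l => y < ξ l + ξ (l + 1) := by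
    intro ξ c
    rcases c with l | l
    · rfl
    · change -(ξ l + ξ (l + 1)) < -y ↔ _
      exact neg_lt_neg_iff
  constructor
  · rw [← gapPolytope_eq_hPolytope]
    have h1 : π / n < y := by rw [div_lt_iff₀ (by linarith)]; linarith
    have h2 : y < π / n + π / n := by
      rw [← add_div, lt_div_iff₀ (by linarith)]; nlinarith
    refine ⟨fun _ => π / n, ⟨?_, fun l => ⟨h1.le, h2.le⟩⟩, fun c => hiff.2 ?_⟩
    · simp
      field_simp
    · rcases c with l | l
      · exact h1
      · exact h2
  · rintro (l | l)
    · rw [hFace_inl]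
      obtain ⟨p, rfl⟩ : ∃ p : Fin n, l = p + 1 := ⟨l - 1, by simp⟩
      set ε := (2 * y - (n * y - π)) / n with hε
      have hεn : n * ε = 2 * y - (n * y - π) := by rw [hε]; field_simp
      have hε0 : 0 < ε := by rw [hε]; exact div_pos (by linarith) (by linarith)
      set β := ((n * y - π) - (n - 3) * ε) / 2 with hβ
      have hβε : β + ε < y := by nlinarith
      have hβ0 : 0 < β := by nlinarith
      have hεy : ε + ε < y := by nlinarith
      set ξ : Fin n → ℝ := fun j => if j = p then y - β else if j = p + 1 then y
        else if j = p + 1 + 1 then y - β else y - ε with hξ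
      have h1 := Fin.add_one_ne_self hn p
      have h2 := Fin.add_one_add_one_ne_self hn p
      have h3 := Fin.add_one_ne_self hn (p + 1)
      have hsum : ∑ j, ξ j = π := by
        rw [hξ, sum_ite_three h1.symm h2.symm h3.symm, Fintype.card_fin]
        linarith
      have hle : ∀ j, j ≠ p + 1 → ξ j < y := by
        intro j hj
        simp only [hξ, hj, if_false]
        split_ifs <;> linarith
      have hξ1 : ξ (p + 1) = y := by simp [hξ, h1]
      have hedge : ∀ j, y < ξ j + ξ (j + 1) := by
        intro j
        by_cases e1 : j + 1 = p
        · have e2 : j ≠ p := fun h => Fin.add_one_ne_self hn j (e1.trans h.symm)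
          have e3 : j ≠ p + 1 := fun h => by
            rw [← e1] at h
            exact Fin.add_one_add_one_ne_self hn j h.symm
          have e4 : j ≠ p + 1 + 1 := fun h => by
            rw [← e1] at h
            exact Fin.add_one_add_one_add_one_ne_self hn j h.symm
          simp only [hξ, e1, e2, e3, e4, if_true, if_false]
          linarith
        · by_cases e2 : j = p
          · subst e2
            simp only [hξ, h1, if_true, if_false]
            linarith
          · by_cases e3 : j = p + 1
            · subst e3
              simp only [hξ, h1, h2, h3, if_true, if_false]
              linarith
            · simp only [hξ, e1, e2, e3, add_left_inj, if_false]
              split_ifs <;> linarith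
      refine ⟨ξ, ⟨⟨hsum, fun j => ⟨?_, (hedge j).le⟩⟩, hξ1⟩, fun c hc => hiff.2 ?_⟩
      · by_cases hj : j = p + 1
        · rw [hj, hξ1]
        · exact (hle j hj).le
      · rcases c with j | j
        · exact hle j fun h => hc (by rw [h])
        · exact hedge j
    · rw [hFace_inr]
      set ε := ((n * y - π) - y) / (n - 2) with hε
      have hεn : (n - 2) * ε = (n * y - π) - y := by
        rw [hε]
        have : (n : ℝ) - 2 ≠ 0 := by linarith
        field_simp
      have hε0 : 0 < ε := by rw [hε]; exact div_pos (by linarith) (by linarith)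
      have hεy : ε < y / 2 := by nlinarith
      set ξ : Fin n → ℝ := fun j => if j = l then y / 2 else if j = l + 1 then y / 2
        else y - ε with hξ
      have h1 := Fin.add_one_ne_self hn l
      have h2 := Fin.add_one_add_one_ne_self hn l
      have h3 := Fin.add_one_ne_self hn (l + 1)
      have hsum : ∑ j, ξ j = π := by
        rw [hξ, sum_ite_two h1.symm, Fintype.card_fin]
        linarith
      have hle : ∀ j, ξ j < y := by
        intro j
        simp only [hξ]
        split_ifs <;> linarith
      have hξl : ξ l + ξ (l + 1) = y := by
        simp only [hξ, h1, if_true, if_false]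
        linarith
      have hedge : ∀ j, j ≠ l → y < ξ j + ξ (j + 1) := by
        intro j hj
        by_cases e1 : j + 1 = l
        · have e3 : j ≠ l + 1 := fun h => by
            rw [← e1] at h
            exact Fin.add_one_add_one_ne_self hn j h.symm
          simp only [hξ, e1, hj, e3, if_true, if_false]
          linarith
        · simp only [hξ, e1, hj, add_left_inj, if_false]
          split_ifs <;> linarith
      refine ⟨ξ, ⟨⟨hsum, fun j => ⟨(hle j).le, ?_⟩⟩, hξl⟩, fun c hc => hiff.2 ?_⟩
      · by_cases hj : j = l
        · rw [hj, hξl]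
        · exact (hedge j hj).le
      · rcases c with j | j
        · exact hle j
        · exact hedge j fun h => hc (by rw [h])

theorem affineDim_gapPolytope (h : GapRange n y) : affineDim (gapPolytope n y) = n - 1 := by
  have hne : sumFunctional n ≠ 0 := by
    intro h0
    have h1 := congrArg (fun f : StrongDual ℝ (Fin n → ℝ) => f fun _ => 1) h0
    simp only [sumFunctional_apply] at h1
    simp at h1
    exact NeZero.ne n h1
  have := h.isFacetSystem.affineDim_add_one hne
  rw [gapPolytope_eq_hPolytope]
  omega

theorem ncard_facets_gapPolytope (h : GapRange n y) :
    (polytopeFacets (gapPolytope n y)).ncard = 2 * n := by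
  rw [gapPolytope_eq_hPolytope, h.isFacetSystem.ncard_facets]
  simp
  ring

theorem facets_gapPolytope (h : GapRange n y) : polytopeFacets (gapPolytope n y) =
    (Set.range fun l => {ξ ∈ gapPolytope n y | ξ l = y}) ∪
    (Set.range fun l => {ξ ∈ gapPolytope n y | ξ l + ξ (l + 1) = y}) := by
  rw [show polytopeFacets (gapPolytope n y) = _ from
    (congrArg polytopeFacets (gapPolytope_eq_hPolytope y)).trans h.isFacetSystem.facets_eq]
  ext F
  simp only [Set.mem_range, Set.mem_union, Sum.exists, hFace_inl, hFace_inr]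

theorem ncard_facets_gapPolytope_mem (h : GapRange n y) {v : Fin n → ℝ} (hv : v ∈ gapPolytope n y) :
    {F ∈ polytopeFacets (gapPolytope n y) | v ∈ F}.ncard =
      {l | v l = y}.ncard + {l | v l + v (l + 1) = y}.ncard := by
  rw [gapPolytope_eq_hPolytope] at hv ⊢
  rw [h.isFacetSystem.ncard_facets_mem hv]
  have : {c | gapFunctional n c v = gapBound n y c}
      = Sum.inl '' {l | v l = y} ∪ Sum.inr '' {l | v l + v (l + 1) = y} := by
    ext c
    rcases c with l | l
    · simp [gapFunctional, gapBound]
    · simp only [gapFunctional, gapBound, Set.mem_ofPred_eq, Set.mem_union, Set.mem_image]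
      simp
      constructor <;> intro h <;> linarith
  rw [this, Set.ncard_union_eq, Set.ncard_image_of_injective _ Sum.inl_injective,
    Set.ncard_image_of_injective _ Sum.inr_injective]
  rw [Set.disjoint_left]
  rintro _ ⟨l, -, rfl⟩ ⟨l', -, h⟩
  cases h

end GapRange

end GapPolytope

section Vertices

variable {n : ℕ} [NeZero n] {y : ℝ}

/-- The cyclic translate of `vertexR` centred at `p + 1`. -/
noncomputable def regularVertex (y : ℝ) (p : Fin n) : Fin n → ℝ := fun j =>
  if j = p then π - ((n : ℝ) - 2) * y else if j = p + 1 then ((n : ℝ) - 1) * y - π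
  else if j = p + 1 + 1 then π - ((n : ℝ) - 2) * y else y

/-- The cyclic translate of `vertexI` with zero component `p + 1` and exceptional component `m`. -/
noncomputable def singularVertex (y : ℝ) (p m : Fin n) : Fin n → ℝ := fun j =>
  if j = p + 1 then 0 else if j = m then π - ((n : ℝ) - 2) * y else y

theorem sum_gap_le {ξ : Fin n → ℝ} (hξ : ξ ∈ gapPolytope n y) (s : Finset (Fin n)) :
    ∑ j ∈ s, (y - ξ j) ≤ n * y - π := by
  have h1 : ∑ j, (y - ξ j) = n * y - π := by
    rw [Finset.sum_sub_distrib, hξ.1]; simp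
  rw [← h1]
  exact Finset.sum_le_univ_sum_of_nonneg fun j => sub_nonneg.2 (hξ.2 j).1

theorem sum_add_sum_compl_gap {ξ : Fin n → ℝ} (hξ : ξ ∈ gapPolytope n y) (s : Finset (Fin n)) :
    ∑ j ∈ s, (y - ξ j) + ∑ j ∈ sᶜ, (y - ξ j) = n * y - π := by
  rw [Finset.sum_add_sum_compl, Finset.sum_sub_distrib, hξ.1]; simp

theorem exists_notMem_lt_of_sum_lt {ξ : Fin n → ℝ} (hξ : ξ ∈ gapPolytope n y) {s : Finset (Fin n)}
    (h : ∑ j ∈ s, (y - ξ j) < n * y - π) : ∃ m, m ∉ s ∧ ξ m < y := by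
  by_contra! hcon
  have h1 := sum_add_sum_compl_gap hξ s
  have h2 : ∑ j ∈ sᶜ, (y - ξ j) ≤ 0 :=
    Finset.sum_nonpos fun j hj => sub_nonpos.2 (hcon j (Finset.mem_compl.1 hj))
  linarith

namespace GapRange

theorem tight_edges_adjacent (h : GapRange n y) {ξ : Fin n → ℝ} (hξ : ξ ∈ gapPolytope n y)
    {l m : Fin n} (hl : ξ l + ξ (l + 1) = y) (hm : ξ m + ξ (m + 1) = y) :
    m = l ∨ m = l + 1 ∨ l = m + 1 := by
  by_contra! hcon
  obtain ⟨h1, h2, h3⟩ := hcon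
  have hn := h.four_le
  have hs := sum_gap_le hξ {l, l + 1, m, m + 1}
  rw [Finset.sum_insert, Finset.sum_insert, Finset.sum_insert, Finset.sum_singleton] at hs
  · linarith [h.upper]
  · simpa using (Fin.add_one_ne_self hn m).symm
  · simp [h2.symm, h1.symm]
  · simp [(Fin.add_one_ne_self hn l).symm, h1.symm, h3]

theorem tight_edges_iff (h : GapRange n y) {ξ : Fin n → ℝ} (hξ : ξ ∈ gapPolytope n y) {p : Fin n}
    (hp : ξ p + ξ (p + 1) = y) (hp' : ξ (p + 1) + ξ (p + 1 + 1) = y) (l : Fin n) :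
    ξ l + ξ (l + 1) = y ↔ l = p ∨ l = p + 1 := by
  constructor
  · intro hl
    rcases h.tight_edges_adjacent hξ hp hl with h1 | h1 | h1
    · exact Or.inl h1
    · exact Or.inr h1
    rcases h.tight_edges_adjacent hξ hp' hl with h2 | h2 | h2
    · exact Or.inr h2
    · subst h1
      exact absurd h2.symm (Fin.add_one_add_one_add_one_ne_self h.four_le l)
    · exact Or.inl (add_right_cancel h2).symm
  · rintro (rfl | rfl)
    · exact hp
    · exact hp'

/-- A vertex of the polytope admits no nonzero perturbation along which the tight inequalities
remain tight. -/
theorem perturbation_eq_zero {v d : Fin n → ℝ} (hv : v ∈ (gapPolytope n y).exposedPoints ℝ)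
    (hsum : ∑ j, d j = 0) (hsupp : ∀ j, v j < y ∨ d j = 0)
    (hedge : ∀ l, v l + v (l + 1) = y → d l + d (l + 1) = 0) : d = 0 := by
  have hvP := hv.1
  rw [gapPolytope_eq_hPolytope] at hv
  refine eq_zero_of_mem_exposedPoints_hPolytope hv (by rwa [sumFunctional_apply]) ?_
  rintro (l | l)
  · exact hsupp l
  · change -(v l + v (l + 1)) < -y ∨ -(d l + d (l + 1)) = 0
    rcases (hvP.2 l).2.lt_or_eq with h1 | h1
    · exact Or.inl (neg_lt_neg h1)
    · exact Or.inr (by rw [hedge l h1.symm, neg_zero])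

theorem exchange_eq {v : Fin n → ℝ} (hv : v ∈ (gapPolytope n y).exposedPoints ℝ) {i j : Fin n}
    (hi : v i < y) (hj : v j < y)
    (hedge : ∀ l, v l + v (l + 1) = y → ((l = i ∨ l + 1 = i) ↔ (l = j ∨ l + 1 = j)))
    (h1 : ∀ l : Fin n, l + 1 ≠ l) : i = j := by
  by_contra hij
  have hd : (fun k => if k = i then (1 : ℝ) else if k = j then -1 else 0) = 0 := by
    refine perturbation_eq_zero hv ?_ (fun k => ?_) fun l hl => ?_
    · rw [sum_ite_two hij]; ring
    · by_cases h1 : k = i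
      · exact Or.inl (h1 ▸ hi)
      · by_cases h2 : k = j
        · exact Or.inl (h2 ▸ hj)
        · simp [h1, h2]
    · have h2 := hedge l hl
      have h3 := h1 l
      clear hedge h1
      by_cases a1 : l = i <;> by_cases a2 : l + 1 = i <;> by_cases a3 : l = j <;>
        by_cases a4 : l + 1 = j <;> simp_all
  have := congrFun hd i
  simp at this

theorem exists_tight_pair (h : GapRange n y) {v : Fin n → ℝ}
    (hv : v ∈ (gapPolytope n y).exposedPoints ℝ) :
    ∃ p, v p + v (p + 1) = y ∧ v (p + 1) + v (p + 1 + 1) = y := by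
  have hn := h.four_le
  have hvP := hv.1
  have hlo := h.lower
  have hy := h.pos
  have hnonneg : ∀ j, 0 ≤ v j := fun j => by linarith [(hvP.2 j).2, (hvP.2 (j + 1)).1]
  have hne := Fin.add_one_ne_self hn
  obtain ⟨l, hl⟩ : ∃ l, v l + v (l + 1) = y := by
    by_contra! hcon
    obtain ⟨i, -, hi⟩ := exists_notMem_lt_of_sum_lt hvP (s := ∅) (by simp; linarith)
    obtain ⟨j, hj, hj'⟩ := exists_notMem_lt_of_sum_lt hvP (s := {i}) (by
      simp; linarith [hnonneg i])
    exact hj (Finset.mem_singleton.2 (exchange_eq hv hi hj' (fun l hl => absurd hl (hcon l)) hne).symm)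
  by_contra! hcon
  have honly : ∀ m, v m + v (m + 1) = y → m = l := by
    intro m hm
    rcases h.tight_edges_adjacent hvP hl hm with h1 | h1 | h1
    · exact h1
    · subst h1; exact absurd hm (hcon l hl)
    · subst h1; exact absurd hl (hcon m hm)
  rcases (hvP.2 l).1.lt_or_eq with h1 | h1
  · rcases (hvP.2 (l + 1)).1.lt_or_eq with h2 | h2
    · have := exchange_eq hv h1 h2 (fun m hm => by
        have := honly m hm
        subst this
        simp) hne
      exact hne l this.symm
    · have h3 : v l = 0 := by linarith
      obtain ⟨q, rfl⟩ : ∃ q : Fin n, l = q + 1 := ⟨l - 1, by simp⟩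
      have h4 : v q = y := le_antisymm (hvP.2 q).1 (by linarith [(hvP.2 q).2])
      exact hcon q (by rw [h4, h3, add_zero]) hl
  · have h3 : v (l + 1) = 0 := by linarith
    have h4 : v (l + 1 + 1) = y := le_antisymm (hvP.2 _).1 (by linarith [(hvP.2 (l + 1)).2])
    exact hcon l hl (by rw [h3, h4, zero_add])

theorem eq_regular_or_singular_of_mem_exposedPoints (h : GapRange n y) {v : Fin n → ℝ}
    (hv : v ∈ (gapPolytope n y).exposedPoints ℝ) :
    (∃ p, v = regularVertex y p) ∨
      ∃ p m, m ≠ p ∧ m ≠ p + 1 ∧ m ≠ p + 1 + 1 ∧ v = singularVertex y p m := by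
  have hn := h.four_le
  have hvP := hv.1
  have hlo := h.lower
  have hup := h.upper
  have hy := h.pos
  obtain ⟨p, hp, hp'⟩ := h.exists_tight_pair hv
  have hedges := h.tight_edges_iff hvP hp hp'
  have h1 := Fin.add_one_ne_self hn p
  have h2 := Fin.add_one_add_one_ne_self hn p
  have h3 := Fin.add_one_ne_self hn (p + 1)
  have hsum3 : ∑ j ∈ {p, p + 1, p + 1 + 1}, (y - v j)
      = (y - v p) + ((y - v (p + 1)) + (y - v (p + 1 + 1))) := by
    rw [Finset.sum_insert (by simp [h1.symm, h2.symm]), Finset.sum_insert (by simp [h3.symm]),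
      Finset.sum_singleton]
  have htot := sum_add_sum_compl_gap hvP {p, p + 1, p + 1 + 1}
  have hnonneg : 0 ≤ v (p + 1) := by linarith [(hvP.2 (p + 1)).2, (hvP.2 (p + 1 + 1)).1]
  rcases hnonneg.eq_or_lt with h0 | h0
  · right
    obtain ⟨m, hm, hmy⟩ := exists_notMem_lt_of_sum_lt hvP (s := {p, p + 1, p + 1 + 1})
      (by rw [hsum3]; linarith)
    simp only [Finset.mem_insert, Finset.mem_singleton, not_or] at hm
    refine ⟨p, m, hm.1, hm.2.1, hm.2.2, ?_⟩
    have hother : ∀ j, j ≠ p + 1 → j ≠ m → v j = y := by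
      intro j hj1 hj2
      by_contra hjy
      have hjlt := lt_of_le_of_ne (hvP.2 j).1 hjy
      have hjp : j ≠ p := fun e => by subst e; linarith
      have hjp2 : j ≠ p + 1 + 1 := fun e => by subst e; linarith
      refine hj2 (exchange_eq hv hjlt hmy (fun l hl => ?_) (Fin.add_one_ne_self hn))
      rcases (hedges l).1 hl with rfl | rfl
      · simp [Ne.symm hjp, Ne.symm hj1, Ne.symm hm.1, Ne.symm hm.2.1]
      · simp [Ne.symm hjp2, Ne.symm hj1, Ne.symm hm.2.2, Ne.symm hm.2.1]
    have hsum2 := sum_add_sum_compl_gap hvP {p + 1, m}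
    rw [Finset.sum_insert (by simp [Ne.symm hm.2.1]), Finset.sum_singleton,
      Finset.sum_eq_zero (s := {p + 1, m}ᶜ)] at hsum2
    · funext j
      simp only [singularVertex]
      split_ifs with e1 e2
      · rw [e1, h0]
      · rw [e2]; linarith
      · exact hother j e1 e2
    · intro j hj
      simp only [Finset.mem_compl, Finset.mem_insert, Finset.mem_singleton, not_or] at hj
      rw [hother j hj.1 hj.2, sub_self]
  · left
    refine ⟨p, ?_⟩
    have hpy : v p < y := by linarith
    have hpy' : v (p + 1 + 1) < y := by linarith
    have hcomp0 : 0 ≤ ∑ j ∈ {p, p + 1, p + 1 + 1}ᶜ, (y - v j) :=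
      Finset.sum_nonneg fun j _ => sub_nonneg.2 (hvP.2 j).1
    have hay : v (p + 1) < y := by linarith
    have hother : ∀ j, j ≠ p → j ≠ p + 1 → j ≠ p + 1 + 1 → v j = y := by
      intro m hm1 hm2 hm3
      by_contra hmy
      have hmlt := lt_of_le_of_ne (hvP.2 m).1 hmy
      set d : Fin n → ℝ := fun k => (if k = p then -1 else if k = p + 1 then 1
        else if k = p + 1 + 1 then -1 else 0) + if k = m then 1 else 0 with hd
      have hd0 : d = 0 := by
        refine perturbation_eq_zero hv ?_ (fun k => ?_) fun l hl => ?_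
        · rw [hd, Finset.sum_add_distrib, sum_ite_three h1.symm h2.symm h3.symm]
          simp
        · by_cases e1 : k = p
          · exact Or.inl (e1 ▸ hpy)
          · by_cases e2 : k = p + 1
            · exact Or.inl (e2 ▸ hay)
            · by_cases e3 : k = p + 1 + 1
              · exact Or.inl (e3 ▸ hpy')
              · by_cases e4 : k = m
                · exact Or.inl (e4 ▸ hmlt)
                · simp [hd, e1, e2, e3, e4]
        · rcases (hedges l).1 hl with rfl | rfl
          · simp [hd, h1, Ne.symm hm1, Ne.symm hm2]
          · simp [hd, h1, h2, h3, Ne.symm hm2, Ne.symm hm3]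
      have := congrFun hd0 m
      simp [hd, hm1, hm2, hm3] at this
    have hrest : ∑ j ∈ {p, p + 1, p + 1 + 1}ᶜ, (y - v j) = 0 := by
      refine Finset.sum_eq_zero fun j hj => ?_
      simp only [Finset.mem_compl, Finset.mem_insert, Finset.mem_singleton, not_or] at hj
      rw [hother j hj.1 hj.2.1 hj.2.2, sub_self]
    rw [hsum3, hrest] at htot
    funext j
    simp only [regularVertex]
    split_ifs with e1 e2 e3
    · rw [e1]; linarith
    · rw [e2]; linarith
    · rw [e3]; linarith
    · exact hother j e1 e2 e3

theorem mem_exposedPoints_of_tight {v : Fin n → ℝ} (hv : v ∈ gapPolytope n y)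
    (huniq : ∀ x ∈ gapPolytope n y, (∀ j, v j = y → x j = y) →
      (∀ l, v l + v (l + 1) = y → x l + x (l + 1) = y) → x = v) :
    v ∈ (gapPolytope n y).exposedPoints ℝ := by
  rw [gapPolytope_eq_hPolytope] at hv huniq ⊢
  refine mem_exposedPoints_hPolytope hv fun x hx hT => huniq x hx (fun j hj => hT (.inl j) hj)
    fun l hl => ?_
  have := hT (.inr l) (by change -(v l + v (l + 1)) = -y; rw [hl])
  change -(x l + x (l + 1)) = -y at this
  linarith

theorem regularVertex_apply (h : GapRange n y) (p : Fin n) :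
    regularVertex y p p = π - ((n : ℝ) - 2) * y ∧
    regularVertex y p (p + 1) = ((n : ℝ) - 1) * y - π ∧
    regularVertex y p (p + 1 + 1) = π - ((n : ℝ) - 2) * y := by
  have hn := h.four_le
  simp [regularVertex, Fin.add_one_ne_self hn, Fin.add_one_add_one_ne_self hn]

theorem regularVertex_eq_iff (h : GapRange n y) (p j : Fin n) :
    regularVertex y p j = y ↔ j ≠ p ∧ j ≠ p + 1 ∧ j ≠ p + 1 + 1 := by
  have hlo := h.lower
  have hup := h.upper
  simp only [regularVertex]
  split_ifs with e1 e2 e3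
  · simp only [e1, ne_eq, not_true, false_and, iff_false]; intro; linarith
  · simp only [e2, ne_eq, not_true, false_and, and_false, iff_false]; intro; linarith
  · simp only [e3, ne_eq, not_true, and_false, iff_false]; intro; linarith
  · simp [e1, e2, e3]

theorem regularVertex_pos (h : GapRange n y) (p j : Fin n) : 0 < regularVertex y p j := by
  have hlo := h.lower
  have hup := h.upper
  have hy := h.pos
  simp only [regularVertex]
  split_ifs <;> linarith

theorem regularVertex_mem (h : GapRange n y) (p : Fin n) : regularVertex y p ∈ gapPolytope n y := by
  have hn := h.four_le
  have hlo := h.lower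
  have hup := h.upper
  have h1 := Fin.add_one_ne_self hn p
  have h2 := Fin.add_one_add_one_ne_self hn p
  have h3 := Fin.add_one_ne_self hn (p + 1)
  obtain ⟨r1, r2, r3⟩ := h.regularVertex_apply p
  have hr := h.regularVertex_eq_iff p
  refine ⟨?_, fun l => ⟨?_, ?_⟩⟩
  · rw [show (∑ i, regularVertex y p i) = _ from sum_ite_three h1.symm h2.symm h3.symm _ _ _ _,
      Fintype.card_fin]
    ring
  · simp only [regularVertex]
    split_ifs <;> linarith
  · by_cases e1 : l = p
    · rw [e1, r1, r2]; linarith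
    · by_cases e2 : l = p + 1
      · rw [e2, r2, r3]; linarith
      · by_cases e3 : l = p + 1 + 1
        · rw [e3, r3, (hr _).2]
          · linarith
          · exact ⟨Fin.add_one_add_one_add_one_ne_self hn p, Fin.add_one_add_one_ne_self hn (p + 1),
              Fin.add_one_ne_self hn _⟩
        · rw [(hr l).2 ⟨e1, e2, e3⟩]
          linarith [h.regularVertex_pos p (l + 1)]

theorem regularVertex_tight_edge (h : GapRange n y) (p l : Fin n) :
    regularVertex y p l + regularVertex y p (l + 1) = y ↔ l = p ∨ l = p + 1 := by
  obtain ⟨r1, r2, r3⟩ := h.regularVertex_apply p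
  exact h.tight_edges_iff (h.regularVertex_mem p) (by rw [r1, r2]; ring) (by rw [r2, r3]; ring) l

theorem regularVertex_mem_exposedPoints (h : GapRange n y) (p : Fin n) :
    regularVertex y p ∈ (gapPolytope n y).exposedPoints ℝ := by
  refine mem_exposedPoints_of_tight (h.regularVertex_mem p) fun x hx hT hE => ?_
  have hn := h.four_le
  have h1 := Fin.add_one_ne_self hn p
  have h2 := Fin.add_one_add_one_ne_self hn p
  have h3 := Fin.add_one_ne_self hn (p + 1)
  have e1 := hE p ((h.regularVertex_tight_edge p p).2 (Or.inl rfl))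
  have e2 := hE (p + 1) ((h.regularVertex_tight_edge p (p + 1)).2 (Or.inr rfl))
  have hother : ∀ j, j ≠ p → j ≠ p + 1 → j ≠ p + 1 + 1 → x j = y := fun j a1 a2 a3 =>
    hT j ((h.regularVertex_eq_iff p j).2 ⟨a1, a2, a3⟩)
  have htot := sum_add_sum_compl_gap hx {p, p + 1, p + 1 + 1}
  rw [Finset.sum_insert (by simp [h1.symm, h2.symm]), Finset.sum_insert (by simp [h3.symm]),
    Finset.sum_singleton, Finset.sum_eq_zero (s := {p, p + 1, p + 1 + 1}ᶜ)] at htot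
  · funext j
    simp only [regularVertex]
    split_ifs with a1 a2 a3
    · rw [a1]; linarith
    · rw [a2]; linarith
    · rw [a3]; linarith
    · exact hother j a1 a2 a3
  · intro j hj
    simp only [Finset.mem_compl, Finset.mem_insert, Finset.mem_singleton, not_or] at hj
    rw [hother j hj.1 hj.2.1 hj.2.2, sub_self]

theorem singularVertex_eq_iff (h : GapRange n y) (p m j : Fin n) :
    singularVertex y p m j = y ↔ j ≠ p + 1 ∧ j ≠ m := by
  have hlo := h.lower
  have hy := h.pos
  simp only [singularVertex]
  split_ifs with e1 e2
  · simp only [e1, ne_eq, not_true, false_and, iff_false]; intro; linarith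
  · simp only [e2, ne_eq, not_true, and_false, iff_false]; intro; linarith
  · simp [e1, e2]

theorem singularVertex_eq_zero_iff (h : GapRange n y) (p m j : Fin n) :
    singularVertex y p m j = 0 ↔ j = p + 1 := by
  have hup := h.upper
  have hy := h.pos
  simp only [singularVertex]
  split_ifs with e1 e2
  · simp [e1]
  · simp only [e1, iff_false]; intro; linarith
  · simp only [e1, iff_false]; exact hy.ne'

theorem singularVertex_mem (h : GapRange n y) {p m : Fin n} (hm : m ≠ p) (hm1 : m ≠ p + 1)
    (hm2 : m ≠ p + 1 + 1) : singularVertex y p m ∈ gapPolytope n y := by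
  have hn := h.four_le
  have hlo := h.lower
  have hup := h.upper
  have hy := h.pos
  have h0 : ∀ j, 0 ≤ singularVertex y p m j := by
    intro j
    simp only [singularVertex]
    split_ifs <;> linarith
  have hv := h.singularVertex_eq_iff p m
  have hz := h.singularVertex_eq_zero_iff p m
  refine ⟨?_, fun l => ⟨?_, ?_⟩⟩
  · rw [show (∑ i, singularVertex y p m i) = _ from sum_ite_two hm1.symm _ _ _, Fintype.card_fin]
    ring
  · simp only [singularVertex]
    split_ifs <;> linarith
  · by_cases e1 : l = p + 1
    · rw [(hv (l + 1)).2]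
      · linarith [h0 l]
      · rw [e1]
        exact ⟨Fin.add_one_ne_self hn _, hm2.symm⟩
    · by_cases e2 : l = m
      · rw [(hv (l + 1)).2]
        · linarith [h0 l]
        · rw [e2]
          exact ⟨fun e => hm (add_right_cancel e), Fin.add_one_ne_self hn m⟩
      · rw [(hv l).2 ⟨e1, e2⟩]
        linarith [h0 (l + 1)]

theorem singularVertex_tight_edge (h : GapRange n y) {p m : Fin n} (hm : m ≠ p) (hm1 : m ≠ p + 1)
    (hm2 : m ≠ p + 1 + 1) (l : Fin n) :
    singularVertex y p m l + singularVertex y p m (l + 1) = y ↔ l = p ∨ l = p + 1 := by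
  have hn := h.four_le
  have hv := h.singularVertex_eq_iff p m
  have hz := (h.singularVertex_eq_zero_iff p m (p + 1)).2 rfl
  refine h.tight_edges_iff (h.singularVertex_mem hm hm1 hm2) ?_ ?_ l
  · rw [hz, (hv p).2 ⟨(Fin.add_one_ne_self hn p).symm, hm.symm⟩, add_zero]
  · rw [hz, (hv (p + 1 + 1)).2 ⟨Fin.add_one_ne_self hn (p + 1), hm2.symm⟩, zero_add]

theorem singularVertex_mem_exposedPoints (h : GapRange n y) {p m : Fin n} (hm : m ≠ p)
    (hm1 : m ≠ p + 1) (hm2 : m ≠ p + 1 + 1) :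
    singularVertex y p m ∈ (gapPolytope n y).exposedPoints ℝ := by
  refine mem_exposedPoints_of_tight (h.singularVertex_mem hm hm1 hm2) fun x hx hT hE => ?_
  have hn := h.four_le
  have e1 := hE p ((h.singularVertex_tight_edge hm hm1 hm2 p).2 (Or.inl rfl))
  have hother : ∀ j, j ≠ p + 1 → j ≠ m → x j = y := fun j a1 a2 =>
    hT j ((h.singularVertex_eq_iff p m j).2 ⟨a1, a2⟩)
  rw [hother p (Fin.add_one_ne_self hn p).symm hm.symm] at e1
  have htot := sum_add_sum_compl_gap hx {p + 1, m}
  rw [Finset.sum_insert (by simp [hm1.symm]), Finset.sum_singleton,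
    Finset.sum_eq_zero (s := {p + 1, m}ᶜ)] at htot
  · funext j
    simp only [singularVertex]
    split_ifs with a1 a2
    · rw [a1]; linarith
    · rw [a2]; linarith
    · exact hother j a1 a2
  · intro j hj
    simp only [Finset.mem_compl, Finset.mem_insert, Finset.mem_singleton, not_or] at hj
    rw [hother j hj.1 hj.2, sub_self]

end GapRange

end Vertices

section Orbits

variable {n : ℕ} [NeZero n] {y : ℝ}

theorem Fin.val_nsmul_one (hn : 2 ≤ n) {k : ℕ} (hk : k < n) : ((k • (1 : Fin n) : Fin n) : ℕ) = k := by
  induction k with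
  | zero => simp
  | succ k ih =>
    rw [succ_nsmul, Fin.val_add_one_eq_ite hn, ih (by omega), if_neg (by omega)]

theorem cyclicShift_iterate (ξ : Fin n → ℝ) (k : ℕ) :
    cyclicShift^[k] ξ = fun j => ξ (j + k • 1) := by
  induction k with
  | zero => simp
  | succ k ih =>
    rw [Function.iterate_succ_apply', ih]
    funext j
    simp only [cyclicShift, finRotate_apply]
    rw [succ_nsmul, add_assoc, add_comm 1]

theorem mem_cyclicOrbit_iff (hn : 2 ≤ n) {ξ η : Fin n → ℝ} :
    η ∈ cyclicOrbit ξ ↔ ∃ p : Fin n, η = fun j => ξ (j - (p + 1)) := by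
  constructor
  · rintro ⟨k, rfl⟩
    refine ⟨-(k • 1) - 1, ?_⟩
    rw [cyclicShift_iterate, sub_add_cancel]
    simp
  · rintro ⟨p, rfl⟩
    refine ⟨((-(p + 1) : Fin n) : ℕ), ?_⟩
    rw [cyclicShift_iterate]
    have : ((-(p + 1) : Fin n) : ℕ) • (1 : Fin n) = -(p + 1) :=
      Fin.ext (Fin.val_nsmul_one hn (-(p + 1) : Fin n).2)
    rw [this]
    simp only [sub_eq_add_neg]

theorem Fin.val_sub_add_one_conditions (hn : 4 ≤ n) (p j : Fin n) :
    (((j - (p + 1) : Fin n) : ℕ) = 0 ↔ j = p + 1) ∧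
    (((j - (p + 1) : Fin n) : ℕ) = 1 ↔ j = p + 1 + 1) ∧
    (((j - (p + 1) : Fin n) : ℕ) + 1 = n ↔ j = p) := by
  obtain ⟨i, rfl⟩ : ∃ i : Fin n, j = i + (p + 1) := ⟨j - (p + 1), by simp⟩
  rw [add_sub_cancel_right]
  have h1 : i + (p + 1) = p + 1 ↔ i = 0 := by simp
  have h2 : i + (p + 1) = p + 1 + 1 ↔ i = 1 := by rw [add_comm i, add_right_inj]
  have h3 : i + (p + 1) = p ↔ i + 1 = 0 := by
    rw [add_comm p 1, ← add_assoc]; simp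
  rw [h1, h2, h3]
  refine ⟨?_, ?_, ?_⟩
  · rw [Fin.ext_iff]; simp
  · rw [Fin.ext_iff, Fin.val_one', Nat.mod_eq_of_lt (by omega)]
  · rw [Fin.ext_iff, Fin.val_add_one_eq_ite (by omega)]
    split_ifs with h <;> simp [h]

theorem vertexR_sub_eq (hn : 4 ≤ n) (p : Fin n) :
    (fun j => vertexR n y (j - (p + 1))) = regularVertex y p := by
  funext j
  obtain ⟨h1, h2, h3⟩ := Fin.val_sub_add_one_conditions hn p j
  simp only [vertexR, regularVertex, h1, h2, h3]
  have e1 := Fin.add_one_ne_self hn p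
  by_cases a : j = p
  · subst a
    simp [e1.symm]
  · simp [a]

theorem vertexI_sub_eq (hn : 4 ≤ n) (p m : Fin n) {s : ℕ}
    (hm : ((m - (p + 1) : Fin n) : ℕ) = 1 + s) :
    (fun j => vertexI n y s (j - (p + 1))) = singularVertex y p m := by
  funext j
  obtain ⟨h1, -, -⟩ := Fin.val_sub_add_one_conditions hn p j
  have h4 : ((j - (p + 1) : Fin n) : ℕ) = 1 + s ↔ j = m := by
    rw [← hm, ← Fin.ext_iff, sub_left_inj]
  simp only [vertexI, singularVertex, h1, h4]

theorem cyclicOrbit_vertexR (hn : 4 ≤ n) :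
    cyclicOrbit (vertexR n y) = Set.range (regularVertex y) := by
  ext η
  rw [mem_cyclicOrbit_iff (by omega)]
  simp only [vertexR_sub_eq hn, Set.mem_range, eq_comm]

/-- The pairs `(p, m)` for which `singularVertex y p m` is a vertex. -/
def singularIndices (n : ℕ) [NeZero n] : Finset (Fin n × Fin n) :=
  Finset.univ.filter fun q => q.2 ≠ q.1 ∧ q.2 ≠ q.1 + 1 ∧ q.2 ≠ q.1 + 1 + 1

theorem mem_singularIndices {q : Fin n × Fin n} :
    q ∈ singularIndices n ↔ q.2 ≠ q.1 ∧ q.2 ≠ q.1 + 1 ∧ q.2 ≠ q.1 + 1 + 1 := by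
  simp [singularIndices]

theorem card_three (hn : 4 ≤ n) (p : Fin n) : ({p, p + 1, p + 1 + 1} : Finset (Fin n)).card = 3 :=
  Finset.card_eq_three.2 ⟨p, p + 1, p + 1 + 1, (Fin.add_one_ne_self hn p).symm,
    (Fin.add_one_add_one_ne_self hn p).symm, (Fin.add_one_ne_self hn (p + 1)).symm, rfl⟩

theorem card_singularIndices (hn : 4 ≤ n) : (singularIndices n).card = n * (n - 3) := by
  have h : ∀ p : Fin n, (∑ m : Fin n,
      if m ≠ p ∧ m ≠ p + 1 ∧ m ≠ p + 1 + 1 then 1 else 0) = n - 3 := by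
    intro p
    rw [← Finset.card_filter]
    have : (Finset.univ.filter fun m => m ≠ p ∧ m ≠ p + 1 ∧ m ≠ p + 1 + 1)
        = ({p, p + 1, p + 1 + 1} : Finset (Fin n))ᶜ := by
      ext m; simp
    rw [this, Finset.card_compl, card_three hn, Fintype.card_fin]
  rw [singularIndices, Finset.card_filter, Fintype.sum_prod_type]
  simp only [h]
  simp

theorem iUnion_cyclicOrbit_vertexI (hn : 4 ≤ n) :
    (⋃ s ∈ Finset.Icc 1 (n - 3), cyclicOrbit (vertexI n y s))
      = (fun q : Fin n × Fin n => singularVertex y q.1 q.2) '' singularIndices n := by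
  ext η
  simp only [Set.mem_iUnion, mem_cyclicOrbit_iff (show 2 ≤ n by omega), Set.mem_image,
    Finset.mem_coe, mem_singularIndices, Finset.mem_Icc, Prod.exists, exists_prop]
  constructor
  · rintro ⟨s, ⟨hs1, hs2⟩, p, rfl⟩
    set m : Fin n := ⟨1 + s, by omega⟩ + (p + 1) with hmdef
    have hm : ((m - (p + 1) : Fin n) : ℕ) = 1 + s := by rw [hmdef, add_sub_cancel_right]
    obtain ⟨h1, h2, h3⟩ := Fin.val_sub_add_one_conditions hn p m
    rw [hm] at h1 h2 h3
    exact ⟨p, m, ⟨fun e => by have := h3.2 e; omega, fun e => by have := h1.2 e; omega,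
      fun e => by have := h2.2 e; omega⟩, (vertexI_sub_eq hn p m hm).symm⟩
  · rintro ⟨p, m, ⟨e1, e2, e3⟩, rfl⟩
    obtain ⟨h1, h2, h3⟩ := Fin.val_sub_add_one_conditions hn p m
    have hlt := (m - (p + 1)).2
    have a1 := mt h1.1 e2
    have a2 := mt h2.1 e3
    have a3 := mt h3.1 e1
    refine ⟨((m - (p + 1) : Fin n) : ℕ) - 1, ⟨by omega, by omega⟩, p, ?_⟩
    exact (vertexI_sub_eq hn p m (by omega)).symm

end Orbits

namespace GapRange

variable {n : ℕ} [NeZero n] {y : ℝ}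

theorem regularVertex_injective (h : GapRange n y) : Function.Injective (regularVertex (n := n) y) := by
  intro p q hpq
  have hn := h.four_le
  have h1 := (h.regularVertex_tight_edge p p).2 (Or.inl rfl)
  have h2 := (h.regularVertex_tight_edge p (p + 1)).2 (Or.inr rfl)
  rw [hpq, h.regularVertex_tight_edge] at h1 h2
  rcases h1 with h1 | h1
  · exact h1
  · subst h1
    rcases h2 with h2 | h2
    · exact absurd h2 (Fin.add_one_add_one_ne_self hn q)
    · exact absurd h2 (Fin.add_one_ne_self hn (q + 1))

theorem singularVertex_injOn (h : GapRange n y) :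
    Set.InjOn (fun q : Fin n × Fin n => singularVertex y q.1 q.2) (singularIndices n) := by
  rintro ⟨p, m⟩ hq ⟨p', m'⟩ hq' he
  simp only [Finset.mem_coe, mem_singularIndices] at hq hq' he
  have h1 := (h.singularVertex_eq_zero_iff p m (p + 1)).2 rfl
  rw [he, h.singularVertex_eq_zero_iff] at h1
  obtain rfl := add_right_cancel h1
  have h2 := mt (h.singularVertex_eq_iff p m m).1 fun hc => hc.2 rfl
  rw [he, h.singularVertex_eq_iff] at h2
  have h3 : m = m' := by
    by_contra hne
    exact h2 ⟨hq.2.1, hne⟩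
  rw [h3]

theorem gapPolytope_subset_alcove (y : ℝ) : gapPolytope n y ⊆ alcove n := fun ξ hξ =>
  ⟨hξ.1, fun l => by linarith [(hξ.2 l).2, (hξ.2 (l + 1)).1]⟩

theorem vertices_gapPolytope (h : GapRange n y) : polytopeVertices (gapPolytope n y) =
    Set.range (regularVertex y) ∪
      (fun q : Fin n × Fin n => singularVertex y q.1 q.2) '' singularIndices n := by
  refine Set.Subset.antisymm (fun v hv => ?_) ?_
  · rcases h.eq_regular_or_singular_of_mem_exposedPoints hv with ⟨p, rfl⟩ | ⟨p, m, h1, h2, h3, rfl⟩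
    · exact Or.inl ⟨p, rfl⟩
    · exact Or.inr ⟨(p, m), mem_singularIndices.2 ⟨h1, h2, h3⟩, rfl⟩
  · rintro v (⟨p, rfl⟩ | ⟨⟨p, m⟩, hq, rfl⟩)
    · exact h.regularVertex_mem_exposedPoints p
    · obtain ⟨h1, h2, h3⟩ := mem_singularIndices.1 hq
      exact h.singularVertex_mem_exposedPoints h1 h2 h3

theorem regularVertex_mem_alcoveReg (h : GapRange n y) (p : Fin n) :
    regularVertex y p ∈ alcoveReg n :=
  ⟨gapPolytope_subset_alcove y (h.regularVertex_mem p), h.regularVertex_pos p⟩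

theorem singularVertex_mem_alcoveBoundary (h : GapRange n y) {q : Fin n × Fin n}
    (hq : q ∈ singularIndices n) : singularVertex y q.1 q.2 ∈ alcoveBoundary n := by
  obtain ⟨h1, h2, h3⟩ := mem_singularIndices.1 hq
  exact ⟨gapPolytope_subset_alcove y (h.singularVertex_mem h1 h2 h3),
    q.1 + 1, (h.singularVertex_eq_zero_iff q.1 q.2 _).2 rfl⟩

theorem disjoint_alcoveReg_alcoveBoundary (n : ℕ) : Disjoint (alcoveReg n) (alcoveBoundary n) := by
  rw [Set.disjoint_left]
  rintro ξ ⟨-, h1⟩ ⟨-, i, hi⟩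
  exact (h1 i).ne' hi

theorem regular_vertices (h : GapRange n y) :
    polytopeVertices (gapPolytope n y) ∩ alcoveReg n = Set.range (regularVertex y) := by
  rw [h.vertices_gapPolytope]
  refine Set.Subset.antisymm ?_ ?_
  · rintro v ⟨hv | ⟨q, hq, rfl⟩, hreg⟩
    · exact hv
    · exact absurd (h.singularVertex_mem_alcoveBoundary hq)
        (Set.disjoint_left.1 (disjoint_alcoveReg_alcoveBoundary n) hreg)
  · rintro _ ⟨p, rfl⟩
    exact ⟨Or.inl ⟨p, rfl⟩, h.regularVertex_mem_alcoveReg p⟩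

theorem singular_vertices (h : GapRange n y) :
    polytopeVertices (gapPolytope n y) ∩ alcoveBoundary n =
      (fun q : Fin n × Fin n => singularVertex y q.1 q.2) '' singularIndices n := by
  rw [h.vertices_gapPolytope]
  refine Set.Subset.antisymm ?_ ?_
  · rintro v ⟨⟨p, rfl⟩ | hv, hbd⟩
    · exact absurd hbd
        (Set.disjoint_left.1 (disjoint_alcoveReg_alcoveBoundary n) (h.regularVertex_mem_alcoveReg p))
    · exact hv
  · rintro _ ⟨q, hq, rfl⟩
    exact ⟨Or.inr ⟨q, hq, rfl⟩, h.singularVertex_mem_alcoveBoundary hq⟩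

theorem ncard_regular_vertices (h : GapRange n y) :
    (Set.range (regularVertex (n := n) y)).ncard = n := by
  rw [Set.ncard_range_of_injective h.regularVertex_injective]
  simp

theorem ncard_singular_vertices (h : GapRange n y) :
    ((fun q : Fin n × Fin n => singularVertex y q.1 q.2) '' singularIndices n).ncard
      = n * (n - 3) := by
  rw [h.singularVertex_injOn.ncard_image, Set.ncard_coe_finset,
    card_singularIndices h.four_le]

theorem ncard_vertices (h : GapRange n y) :
    (polytopeVertices (gapPolytope n y)).ncard = n * (n - 2) := by
  have hn := h.four_le
  rw [h.vertices_gapPolytope, Set.ncard_union_eq ?_ (Set.finite_range _)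
    ((Finset.finite_toSet _).image _), h.ncard_regular_vertices, h.ncard_singular_vertices]
  · obtain ⟨k, hk⟩ : ∃ k, n = k + 3 := ⟨n - 3, by omega⟩
    rw [show n - 3 = k by omega, show n - 2 = k + 1 by omega]
    ring
  · refine (disjoint_alcoveReg_alcoveBoundary n).mono ?_ ?_
    · rintro _ ⟨p, rfl⟩
      exact h.regularVertex_mem_alcoveReg p
    · rintro _ ⟨q, hq, rfl⟩
      exact h.singularVertex_mem_alcoveBoundary hq

theorem ncard_tight_edges (h : GapRange n y) (p : Fin n) : {l | l = p ∨ l = p + 1}.ncard = 2 :=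
  Set.ncard_pair (Fin.add_one_ne_self h.four_le p).symm

theorem ncard_facets_regularVertex (h : GapRange n y) (p : Fin n) :
    {F ∈ polytopeFacets (gapPolytope n y) | regularVertex y p ∈ F}.ncard = n - 1 := by
  have hn := h.four_le
  rw [h.ncard_facets_gapPolytope_mem (h.regularVertex_mem p)]
  simp only [h.regularVertex_eq_iff, h.regularVertex_tight_edge]
  have : {l | l ≠ p ∧ l ≠ p + 1 ∧ l ≠ p + 1 + 1}
      = (({p, p + 1, p + 1 + 1} : Finset (Fin n))ᶜ : Finset (Fin n)) := by
    ext l; simp; tauto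
  rw [this, Set.ncard_coe_finset, Finset.card_compl, card_three hn, Fintype.card_fin,
    h.ncard_tight_edges]
  omega

theorem ncard_facets_singularVertex (h : GapRange n y) {q : Fin n × Fin n}
    (hq : q ∈ singularIndices n) :
    {F ∈ polytopeFacets (gapPolytope n y) | singularVertex y q.1 q.2 ∈ F}.ncard = n := by
  have hn := h.four_le
  obtain ⟨h1, h2, h3⟩ := mem_singularIndices.1 hq
  rw [h.ncard_facets_gapPolytope_mem (h.singularVertex_mem h1 h2 h3)]
  simp only [h.singularVertex_eq_iff, h.singularVertex_tight_edge h1 h2 h3]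
  have : {l | l ≠ q.1 + 1 ∧ l ≠ q.2}
      = (({q.1 + 1, q.2} : Finset (Fin n))ᶜ : Finset (Fin n)) := by
    ext l; simp; tauto
  rw [this, Set.ncard_coe_finset, Finset.card_compl, Finset.card_pair h2.symm, Fintype.card_fin,
    h.ncard_tight_edges]
  omega

end GapRange

theorem theorem5p1 (n : ℕ) (hn : 4 ≤ n) (y : ℝ)
    (hy₁ : π / ((n : ℝ) - 1) < y) (hy₂ : y < π / ((n : ℝ) - 2)) :
    -- the polytope and its `2n` defining inequalities
    momentumPolytope n y =
        {ξ | ∑ i, ξ i = π ∧ ∀ l, ξ l ≤ y ∧ y ≤ ξ l + ξ (finRotate n l)} ∧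
    affineDim (momentumPolytope n y) = n - 1 ∧
    -- the number of vertices and of facets
    (polytopeVertices (momentumPolytope n y)).ncard = n * (n - 2) ∧
    (polytopeFacets (momentumPolytope n y)).ncard = 2 * n ∧
    -- the vertices
    polytopeVertices (momentumPolytope n y) =
        cyclicOrbit (vertexR n y) ∪ ⋃ s ∈ Finset.Icc 1 (n - 3), cyclicOrbit (vertexI n y s) ∧
    -- the regular and the singular vertices
    polytopeVertices (momentumPolytope n y) ∩ alcoveReg n = cyclicOrbit (vertexR n y) ∧
    polytopeVertices (momentumPolytope n y) ∩ alcoveBoundary n =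
        ⋃ s ∈ Finset.Icc 1 (n - 3), cyclicOrbit (vertexI n y s) ∧
    (polytopeVertices (momentumPolytope n y) ∩ alcoveReg n).ncard = n ∧
    (polytopeVertices (momentumPolytope n y) ∩ alcoveBoundary n).ncard = n * (n - 3) ∧
    (∀ v ∈ polytopeVertices (momentumPolytope n y) ∩ alcoveBoundary n, ∃! i, v i = 0) ∧
    -- each defining inequality gives a facet, and these are all the facets
    (∀ l, {ξ ∈ momentumPolytope n y | ξ l = y} ∈ polytopeFacets (momentumPolytope n y)) ∧
    (∀ l, {ξ ∈ momentumPolytope n y | ξ l + ξ (finRotate n l) = y} ∈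
        polytopeFacets (momentumPolytope n y)) ∧
    polytopeFacets (momentumPolytope n y) =
        (Set.range fun l => {ξ ∈ momentumPolytope n y | ξ l = y}) ∪
        (Set.range fun l => {ξ ∈ momentumPolytope n y | ξ l + ξ (finRotate n l) = y}) ∧
    -- incidence of vertices with facets
    (∀ v ∈ polytopeVertices (momentumPolytope n y) ∩ alcoveReg n,
        {F ∈ polytopeFacets (momentumPolytope n y) | v ∈ F}.ncard = n - 1) ∧
    (∀ v ∈ polytopeVertices (momentumPolytope n y) ∩ alcoveBoundary n,
        {F ∈ polytopeFacets (momentumPolytope n y) | v ∈ F}.ncard = n) := by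
  have : NeZero n := ⟨by omega⟩
  have h := GapRange.of_div hn hy₁ hy₂
  have hP : momentumPolytope n y = gapPolytope n y := by
    rw [momentumPolytope_eq hn hy₁ hy₂]
    simp only [finRotate_apply]
    rfl
  rw [cyclicOrbit_vertexR hn, iUnion_cyclicOrbit_vertexI hn]
  simp only [hP, finRotate_apply]
  rw [h.regular_vertices, h.singular_vertices]
  refine ⟨rfl, h.affineDim_gapPolytope, h.ncard_vertices, h.ncard_facets_gapPolytope,
    h.vertices_gapPolytope, rfl, rfl, h.ncard_regular_vertices, h.ncard_singular_vertices,
    ?_, fun l => ?_, fun l => ?_, h.facets_gapPolytope, ?_, ?_⟩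
  · rintro _ ⟨q, -, rfl⟩
    exact ⟨q.1 + 1, (h.singularVertex_eq_zero_iff q.1 q.2 _).2 rfl,
      fun j hj => (h.singularVertex_eq_zero_iff q.1 q.2 j).1 hj⟩
  · rw [h.facets_gapPolytope]
    exact Or.inl ⟨l, rfl⟩
  · rw [h.facets_gapPolytope]
    exact Or.inr ⟨l, rfl⟩
  · rintro _ ⟨p, rfl⟩
    exact h.ncard_facets_regularVertex p
  · rintro _ ⟨q, hq, rfl⟩
    exact h.ncard_facets_singularVertex hq
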